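/- Let $\Sigma,\Omega$ be finite alphabets and $\mathcal X$ a finite, linearly ordered set of variables, and let $\Gamma_{\mathcal X}=\{\vdash_x,\dashv_x\mid x\in\mathcal X\}$ be a set of opening and closing brackets. A span of a document $D\in\Sigma^*$ is a pair $[i,j\rangle$ with $1\le i\le j\le |D|+1$; spans $[i,j\rangle$, $[i',j'\rangle$ are disjoint if $j\le i'$ or $j'\le i$. A multispan-tuple over $D$ maps each $x\in\mathcal X$ to a set of pairwise disjoint spans of $D$. A multispanner $E$ maps every $D\in\Sigma^*$ to a set $E(D)$ of multispan-tuples over $D$. A multispanner-expression is built by $R ::= \varepsilon\mid a\mid (R\cdot R)\mid (R+R)\mid R^*\mid x\{R\}$ with $a\in\Sigma$, $x\in\mathcal X$, where $x\{R\}$ is allowed only if $x$ does not appear in $R$; its language $L(R)\subseteq(\Sigma\cup\Gamma_{\mathcal X})^*$ is defined as usual, with $L(x\{R\})=\{\vdash_x\}\cdot L(R)\cdot\{\dashv_x\}$. Each $w\in L(R)$ describes the document $\mathrm{doc}(w)$ obtained by erasing the brackets, and the multispan-tuple over $\mathrm{doc}(w)$ that maps $x$ to the set of spans enclosed by the matching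 pairs $\vdash_x\ldots\dashv_x$ of $w$. $E$ is a regex multispanner if for some $R$ and all $D$, $E(D)$ is the set of tuples described by the words $w\in L(R)$ with $\mathrm{doc}(w)=D$. For a document $D$ and a multispan-tuple $t$ over $D$, let $\mathrm{nref}(t,D)=t[1]\,D[1]\,t[2]\,D[2]\cdots D[|D|]\,t[|D|+1]$, where $t[i]$ is the concatenation, in the order of the variables, of the words $(\dashv_x)^{c}(\vdash_x\dashv_x)^{e}(\vdash_x)^{o}$ with $c,e,o\in\{0,1\}$, $c=1$ iff $[j,i\rangle\in t(x)$ for some $j\ne i$, $e=1$ iff $[i,i\rangle\in t(x)$, and $o=1$ iff $[i,j\rangle\in t(x)$ for some $j\neq i$. A linear ET program is a pair $(E,T)$ of a regex multispanner $E$ over $\Sigma$ and $\mathcal X$ and a linear polyregular function $T:(\Sigma\cup\Gamma_{\mathcal X})^*\rightharpoonup\Omega^*$, that is, a partial function computed by a (copyless) deterministic streaming string transducer. Its output on $D$ is the bag $[\![E\cdot T]\!](D)=\{\!\{T(\mathrm{nref}(t,D))\mid t\in E(D),\ T(\mathrm{nref}(t,D))\text{ defined}\}\!\}$. **Theorem.**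 For every fixed linear ET program $(E,T)$, the problem of enumerating, on input $D\in\Sigma^*$, the bag $[\![E\cdot T]\!](D)$ (with repetitions) admits an algorithm with linear preprocessing and output-linear delay in the model of random access machines with uniform cost measure and with addition and subtraction as arithmetic operations. That is, there are a constant $k$ and two RAM programs, depending only on $(E,T)$ and on the encoding of the letters by nonzero integers, such that for every $D\in\Sigma^*$: the first program, on input $D$, halts after at most $k\cdot(|D|+1)$ steps without writing any output; the second program, started on the memory left behind by the first one and with no other input, writes some sequence $w_1,\ldots,w_\ell$ that contains every element of the bag $[\![E\cdot T]\!](D)$ exactly as often as its multiplicity, each word being followed by an end marker, and then halts; for every $i$, the time from the completion of $w_{i-1}$ (from the start of the second program if $i=1$) to the completion of $w_i$ is at most $k\cdot(|w_i|+1)$, and the time from the completion of the last word (from the start if $\ell=0$) to halting is at most $k$. -/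

import Mathlib

namespace ET

/-! ### Documents, spans and multispanners -/

/-- The meta-symbols: an opening and a closing bracket for every variable. -/
inductive Bracket (X : Type*) where
  | opn (x : X)
  | cls (x : X)

/-- The alphabet of multiref-words: letters of the document alphabet and brackets. -/
abbrev RefSym (A X : Type*) := A ⊕ Bracket X

/-- A span `[i, j⟩` is the pair `(i, j)`; positions start at `1`. -/
abbrev Span := ℕ × ℕ

/-- `s` is a span of the document `D`. -/
def IsSpanOf {A : Type*} (D : List A) (s : Span) : Prop :=
  1 ≤ s.1 ∧ s.1 ≤ s.2 ∧ s.2 ≤ D.length + 1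

/-- Disjointness of two spans. -/
def SpanDisjoint (s s' : Span) : Prop := s.2 ≤ s'.1 ∨ s'.2 ≤ s.1

/-- `t` is a multispan-tuple over the document `D`: every variable is mapped to a set of
pairwise disjoint spans of `D`. -/
def IsMultispanTuple {A X : Type*} (D : List A) (t : X → Set Span) : Prop :=
  ∀ x, (∀ s ∈ t x, IsSpanOf D s) ∧ (t x).Pairwise SpanDisjoint

/-- A multispanner maps every document `D` to a set of multispan-tuples over `D`. -/
structure Multispanner (A X : Type*) where
  rel : List A → Set (X → Set Span)
  valid : ∀ D, ∀ t ∈ rel D, IsMultispanTuple D t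

theorem Multispanner.finite {A X : Type*} [Finite X] (E : Multispanner A X) (D : List A) :
    (E.rel D).Finite := by
  have hS : {s : Span | IsSpanOf D s}.Finite := by
    refine Set.Finite.subset
      ((Set.finite_Iic (D.length + 1)).prod (Set.finite_Iic (D.length + 1))) ?_
    rintro ⟨i, j⟩ ⟨_, h2, h3⟩
    simp only [Set.mem_prod, Set.mem_Iic] at *
    omega
  refine Set.Finite.subset
    (Set.Finite.pi (t := fun _ : X => {U : Set Span | U ⊆ {s | IsSpanOf D s}})
      (fun _ => hS.finite_subsets)) ?_
  intro t ht x _ s hs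
  exact (E.valid D t ht x).1 s hs

/-! ### Multiref-words and regex multispanners -/

/-- The document described by a word with brackets: erase the brackets. -/
def doc {A X : Type*} (w : List (RefSym A X)) : List A := w.filterMap Sum.getLeft?

theorem doc_append {A X : Type*} (u v : List (RefSym A X)) : doc (u ++ v) = doc u ++ doc v :=
  List.filterMap_append

theorem doc_cons_inr {A X : Type*} (b : Bracket X) (u : List (RefSym A X)) :
    doc (Sum.inr b :: u) = doc u :=
  List.filterMap_cons_none rfl

/-- The multispan-tuple described by a word with brackets: the spans of `x` are the ones enclosed
by an occurrence of the opening bracket of `x` and the next bracket of `x`, if that is closing. -/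
def tupleOf {A X : Type*} (w : List (RefSym A X)) (x : X) : Set Span :=
  {s | ∃ u v z : List (RefSym A X),
    w = u ++ Sum.inr (Bracket.opn x) :: (v ++ Sum.inr (Bracket.cls x) :: z) ∧
    Sum.inr (Bracket.opn x) ∉ v ∧ Sum.inr (Bracket.cls x) ∉ v ∧
    s = ((doc u).length + 1, (doc u).length + (doc v).length + 1)}

theorem tupleOf_aux {A X : Type*} {x : X} {u v z u' v' z' : List (RefSym A X)}
    (h : u ++ Sum.inr (Bracket.opn x) :: (v ++ Sum.inr (Bracket.cls x) :: z) =
      u' ++ Sum.inr (Bracket.opn x) :: (v' ++ Sum.inr (Bracket.cls x) :: z'))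
    (hv : Sum.inr (Bracket.opn x) ∉ v) (hv2 : Sum.inr (Bracket.cls x) ∉ v)
    (hv2' : Sum.inr (Bracket.cls x) ∉ v') :
    (doc u).length + (doc v).length ≤ (doc u').length ∨
    ((doc u).length = (doc u').length ∧ (doc v).length = (doc v').length) ∨
    u'.length < u.length := by
  rcases List.append_eq_append_iff.1 h with ⟨a, ha, hb⟩ | ⟨a, ha, hb⟩
  · cases a with
    | nil =>
      right; left
      simp only [List.nil_append, List.cons.injEq, true_and, List.append_nil] at hb ha
      subst ha
      refine ⟨rfl, ?_⟩
      rcases List.append_eq_append_iff.1 hb with ⟨b, hb1, hb2⟩ | ⟨b, hb1, hb2⟩ <;>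
      · cases b with
        | nil => simp at hb1; rw [hb1]
        | cons c b =>
          simp only [List.cons_append, List.cons.injEq] at hb2
          exfalso
          have h1 := hb2.1
          subst h1
          subst hb1
          simp at hv2 hv2'
    | cons c a =>
      left
      simp only [List.cons_append, List.cons.injEq] at hb
      obtain ⟨rfl, hb⟩ := hb
      rcases List.append_eq_append_iff.1 hb with ⟨b, hb1, -⟩ | ⟨b, hb1, hb2⟩
      · rw [ha, hb1]; simp [doc_append, doc_cons_inr]
      · cases b with
        | nil => rw [ha]; simp at hb1; rw [hb1]; simp [doc_append, doc_cons_inr]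
        | cons c b =>
          simp only [List.cons_append, List.cons.injEq] at hb2
          rw [hb1, ← hb2.1] at hv
          simp at hv
  · cases a with
    | nil =>
      right; left
      simp only [List.nil_append, List.cons.injEq, true_and, List.append_nil] at hb ha
      subst ha
      refine ⟨rfl, ?_⟩
      rcases List.append_eq_append_iff.1 hb with ⟨b, hb1, hb2⟩ | ⟨b, hb1, hb2⟩ <;>
      · cases b with
        | nil => simp at hb1; rw [hb1]
        | cons c b =>
          simp only [List.cons_append, List.cons.injEq] at hb2
          exfalso
          have h1 := hb2.1
          subst h1
          subst hb1
          simp at hv2 hv2'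
    | cons c a =>
      right; right
      rw [ha]; simp

theorem isMultispanTuple_tupleOf {A X : Type*} (w : List (RefSym A X)) :
    IsMultispanTuple (doc w) (tupleOf w) := by
  intro x
  refine ⟨?_, ?_⟩
  · rintro s ⟨u, v, z, rfl, -, -, rfl⟩
    refine ⟨by simp, by simp, ?_⟩
    simp [doc_append, doc_cons_inr]
  · rintro s ⟨u, v, z, h, hv, hv2, rfl⟩ s' ⟨u', v', z', h', hv', hv2', rfl⟩ hne
    have e := h.symm.trans h'
    have h1 := tupleOf_aux e hv hv2 hv2'
    have h2 := tupleOf_aux e.symm hv' hv2' hv2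
    simp only [ne_eq, Prod.mk.injEq, not_and] at hne
    simp only [SpanDisjoint]
    omega

/-- The multispanner described by a language of words with brackets. -/
def Multispanner.ofLanguage {A X : Type*} (L : Language (RefSym A X)) : Multispanner A X where
  rel D := {t | ∃ w ∈ L, doc w = D ∧ tupleOf w = t}
  valid := by
    rintro D t ⟨w, -, rfl, rfl⟩
    exact isMultispanTuple_tupleOf w

/-- Raw multispanner-expressions. -/
inductive MExpr (A X : Type*) where
  | eps
  | sym (a : A)
  | cat (R S : MExpr A X)
  | alt (R S : MExpr A X)
  | star (R : MExpr A X)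
  | bind (x : X) (R : MExpr A X)

/-- The set of variables that appear in an expression. -/
def MExpr.vars {A X : Type*} : MExpr A X → Set X
  | .eps => ∅
  | .sym _ => ∅
  | .cat R S => R.vars ∪ S.vars
  | .alt R S => R.vars ∪ S.vars
  | .star R => R.vars
  | .bind x R => insert x R.vars

/-- `x{R}` is allowed only if `x` does not appear in `R`. -/
def MExpr.WellFormed {A X : Type*} : MExpr A X → Prop
  | .eps => True
  | .sym _ => True
  | .cat R S => R.WellFormed ∧ S.WellFormed
  | .alt R S => R.WellFormed ∧ S.WellFormed
  | .star R => R.WellFormed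
  | .bind x R => x ∉ R.vars ∧ R.WellFormed

/-- The language that consists of a single one-letter word. -/
def letterLang {B : Type*} (b : B) : Language B := ({[b]} : Set (List B))

/-- The language of an expression. -/
def MExpr.lang {A X : Type*} : MExpr A X → Language (RefSym A X)
  | .eps => 1
  | .sym a => letterLang (Sum.inl a)
  | .cat R S => R.lang * S.lang
  | .alt R S => R.lang + S.lang
  | .star R => KStar.kstar R.lang
  | .bind x R =>
      letterLang (Sum.inr (Bracket.opn x)) * R.lang * letterLang (Sum.inr (Bracket.cls x))

/-- `E` is a regex multispanner. -/
def Multispanner.IsRegex {A X : Type*} (E : Multispanner A X) : Prop :=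
  ∃ R : MExpr A X, R.WellFormed ∧ E = Multispanner.ofLanguage R.lang

/-! ### The unique multiref-word of a document and a multispan-tuple -/

open Classical in
/-- The brackets of the variable `x` in front of position `i`. -/
noncomputable def blockVar {A X : Type*} (t : X → Set Span) (i : ℕ) (x : X) :
    List (RefSym A X) :=
  (if ∃ j, j ≠ i ∧ (j, i) ∈ t x then [Sum.inr (Bracket.cls x)] else []) ++
  (if (i, i) ∈ t x then [Sum.inr (Bracket.opn x), Sum.inr (Bracket.cls x)] else []) ++
  (if ∃ j, j ≠ i ∧ (i, j) ∈ t x then [Sum.inr (Bracket.opn x)] else [])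

/-- All brackets in front of position `i`, in the order of the variables. -/
noncomputable def block {A X : Type*} [Fintype X] [LinearOrder X] (t : X → Set Span) (i : ℕ) :
    List (RefSym A X) :=
  ((Finset.univ : Finset X).sort (· ≤ ·)).flatMap (blockVar t i)

/-- The encoding of a suffix of a document that starts at position `i`. -/
noncomputable def nrefFrom {A X : Type*} [Fintype X] [LinearOrder X] (t : X → Set Span) :
    ℕ → List A → List (RefSym A X)
  | i, [] => block t i
  | i, a :: D => block t i ++ Sum.inl a :: nrefFrom t (i + 1) D

/-- The multiref-word that encodes the multispan-tuple `t` and the document `D`. -/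
noncomputable def nref {A X : Type*} [Fintype X] [LinearOrder X] (t : X → Set Span)
    (D : List A) : List (RefSym A X) :=
  nrefFrom t 1 D

/-! ### Extract-transform programs -/

/-- The output bag of the ET program `(E, T)` on `D`: one copy of `T (nref t D)` for every tuple
`t` extracted by `E` for which it is defined. -/
noncomputable def outputBag {A X O : Type*} [Fintype X] [LinearOrder X] (E : Multispanner A X)
    (T : List (RefSym A X) → Option (List O)) (D : List A) : Multiset (List O) :=
  (E.finite D).toFinset.val.filterMap (fun t => T (nref t D))

/-- Assignments: partial functions from registers to strings of registers and letters. -/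
abbrev Assignment (R O : Type*) := R → Option (List (R ⊕ O))

/-- Valuations: partial functions from registers to strings of letters. -/
abbrev Valuation (R O : Type*) := R → Option (List O)

/-- The extension of a valuation to strings of registers and letters. -/
def Valuation.eval {R O : Type*} (ν : Valuation R O) : List (R ⊕ O) → Option (List O)
  | [] => some []
  | Sum.inl r :: s => (ν r).bind fun u => (eval ν s).map fun v => u ++ v
  | Sum.inr o :: s => (eval ν s).map fun v => o :: v

/-- The composition `ν ∘ σ`. -/
def Valuation.comp {R O : Type*} (ν : Valuation R O) (σ : Assignment R O) : Valuation R O :=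
  fun r => (σ r).bind ν.eval

open Classical in
/-- Every register occurs at most once in all the strings of the assignment together. -/
def Assignment.Copyless {R O : Type*} [Fintype R] (σ : Assignment R O) : Prop :=
  ∀ r : R, ∑ r' : R, ((σ r').getD []).count (Sum.inl r) ≤ 1

open Classical in
/-- Deterministic streaming string transducers. -/
structure DSST (B O : Type*) where
  Q : Type
  R : Type
  [finQ : Fintype Q]
  [finR : Fintype R]
  /-- the transition function -/
  δ : Q → B → Option (Assignment R O × Q)
  copyless : ∀ q b σ q', δ q b = some (σ, q') → σ.Copyless
  /-- the initial state -/
  q₀ : Q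
  /-- the final function -/
  F : Q → Option (List (R ⊕ O))
  final_copyless : ∀ q s, F q = some s → ∀ r : R, s.count (Sum.inl r) ≤ 1

/-- The configuration reached from `(q, ν)` by the run over a string, if there is one. -/
def DSST.run {B O : Type*} (M : DSST B O) :
    M.Q → Valuation M.R O → List B → Option (M.Q × Valuation M.R O)
  | q, ν, [] => some (q, ν)
  | q, ν, b :: w => (M.δ q b).bind fun p => M.run p.2 (ν.comp p.1) w

/-- The string-to-string function of a DSST. -/
def DSST.fn {B O : Type*} (M : DSST B O) (w : List B) : Option (List O) :=
  (M.run M.q₀ (fun _ => some []) w).bind fun p => (M.F p.1).bind p.2.eval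

/-- The linear polyregular functions, modelled by deterministic streaming string transducers. -/
def IsLinearPolyregular {B O : Type*} (T : List B → Option (List O)) : Prop :=
  ∃ M : DSST B O, ∀ w, T w = M.fn w

/-- `(E, T)` is a linear ET program. -/
def IsLinearET {A X O : Type*} (E : Multispanner A X)
    (T : List (RefSym A X) → Option (List O)) : Prop :=
  E.IsRegex ∧ IsLinearPolyregular T

/-! ### Random access machines

Registers `0, 1, 2, …` hold integers and register `0` is the accumulator; there are a read-only
input tape and a write-only output tape.  Every executed instruction costs one time unit. -/

/-- Operands: a constant, the content of a register, indirect addressing. -/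
inductive Operand where
  | const (z : ℤ)
  | reg (i : ℕ)
  | ind (i : ℕ)

inductive Instr where
  | load (a : Operand)
  | store (a : Operand)
  | add (a : Operand)
  | sub (a : Operand)
  | read (a : Operand)
  | write (a : Operand)
  | jump (l : ℕ)
  | jgtz (l : ℕ)
  | jzero (l : ℕ)
  | halt

abbrev Program := List Instr

structure Config where
  /-- the program counter -/
  pc : ℕ
  /-- the memory -/
  mem : ℕ → ℤ
  /-- the unread part of the input tape -/
  inp : List ℤ
  /-- what has been written on the output tape -/
  out : List ℤ

/-- The address that an operand refers to; a constant has none, and a negative address is an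
error. -/
def Operand.addr (m : ℕ → ℤ) : Operand → Option ℕ
  | .const _ => none
  | .reg i => some i
  | .ind i => if 0 ≤ m i then some (m i).toNat else none

/-- The value of an operand. -/
def Operand.val (m : ℕ → ℤ) : Operand → Option ℤ
  | .const z => some z
  | .reg i => some (m i)
  | .ind i => if 0 ≤ m i then some (m (m i).toNat) else none

/-- The effect of one instruction; `none` for `halt` and for errors. Beyond its end, the input
tape holds the end marker `0`. -/
def Instr.exec (c : Config) : Instr → Option Config
  | .load a => (a.val c.mem).map fun v =>
      { c with pc := c.pc + 1, mem := Function.update c.mem 0 v }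
  | .store a => (a.addr c.mem).map fun i =>
      { c with pc := c.pc + 1, mem := Function.update c.mem i (c.mem 0) }
  | .add a => (a.val c.mem).map fun v =>
      { c with pc := c.pc + 1, mem := Function.update c.mem 0 (c.mem 0 + v) }
  | .sub a => (a.val c.mem).map fun v =>
      { c with pc := c.pc + 1, mem := Function.update c.mem 0 (c.mem 0 - v) }
  | .read a => (a.addr c.mem).map fun i =>
      { c with
        pc := c.pc + 1
        mem := Function.update c.mem i (c.inp.headD 0)
        inp := c.inp.tail }
  | .write a => (a.val c.mem).map fun v =>
      { c with pc := c.pc + 1, out := c.out ++ [v] }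
  | .jump l => some { c with pc := l }
  | .jgtz l => some { c with pc := if 0 < c.mem 0 then l else c.pc + 1 }
  | .jzero l => some { c with pc := if c.mem 0 = 0 then l else c.pc + 1 }
  | .halt => none

/-- One step of the program `P`. -/
def Program.step (P : Program) (c : Config) : Option Config :=
  (P[c.pc]?).bind (Instr.exec c)

/-- `n` steps of the program `P`. -/
def Program.steps (P : Program) : ℕ → Config → Option Config
  | 0, c => some c
  | n + 1, c => (P.step c).bind (P.steps n)

/-- The machine has halted properly. -/
def Program.Halted (P : Program) (c : Config) : Prop := P[c.pc]? = some Instr.halt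

/-- Started in configuration `c`, the program `P` writes the words of the given list in this
order, each followed by the end marker `0`, and then halts. The time from `c`, or from the end
marker of the previous word, to the end marker of a word `w` is at most `k * (|w| + 1)`, and the
time after the last end marker is at most `k`. -/
inductive Program.Enumerates (P : Program) (k : ℕ) : Config → List (List ℤ) → Prop
  | nil {c c' : Config} {n : ℕ} (hn : n ≤ k) (hs : P.steps n c = some c')
      (hout : c'.out = c.out) (hh : P.Halted c') : Enumerates P k c []
  | cons {c c₁ c₂ : Config} {n : ℕ} {w : List ℤ} {ws : List (List ℤ)}
      (hn : n + 1 ≤ k * (w.length + 1))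
      (hs : P.steps n c = some c₁) (hout₁ : c₁.out = c.out ++ w)
      (hs₂ : P.step c₁ = some c₂) (hout₂ : c₂.out = c₁.out ++ [0])
      (hw : Enumerates P k c₂ ws) : Enumerates P k c (w :: ws)

/-- The problem of enumerating the bag `f D` on input `D` admits a RAM algorithm with linear
preprocessing and output-linear delay: whatever nonzero integers encode the letters, there are a
program `pre` that on input `D` halts within `k * (|D| + 1)` steps without any output, and a
program `enum` that, started on the memory content that `pre` has left behind, enumerates the
elements of the bag `f D` with output-linear delay. -/
def AdmitsLinearEnumeration {A O : Type*} (f : List A → Multiset (List O)) : Prop :=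
  ∀ (codeA : A → ℤ) (codeO : O → ℤ),
    Function.Injective codeA → (∀ a, codeA a ≠ 0) →
    Function.Injective codeO → (∀ o, codeO o ≠ 0) →
    ∃ (pre enum : Program) (k : ℕ), ∀ D : List A,
      ∃ (n : ℕ) (c : Config) (ws : List (List O)),
        n ≤ k * (D.length + 1) ∧
        pre.steps n ⟨0, fun _ => 0, D.map codeA, []⟩ = some c ∧
        pre.Halted c ∧ c.out = [] ∧
        (ws : Multiset (List O)) = f D ∧
        enum.Enumerates k ⟨0, c.mem, [], []⟩ (ws.map (List.map codeO))

end ET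

set_option linter.unusedSimpArgs false
set_option linter.unusedSectionVars false

namespace ET

/-! ### A structured list-processing language and its compilation to random access machines -/

/-! Three independent reductions lead from the program to a machine.

From tuples to choices. The brackets at a position amount to three flags per variable: does a
nonempty span end here, is there an empty span here, does a nonempty span start here. Since the
spans of a variable are pairwise disjoint, the sequence of flags determines the tuple
(`eq_of_flagList_eq`). The brackets in a word of a well-formed expression alternate for every
variable, so its flags can be read off letter by letter, and a subset construction over a DFA for
the language recognizes exactly the flag sequences of extracted tuples (`acceptsFlags_iff`). Run
side by side with the transducer, this gives a copyless transducer that chooses the flags of each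
position. Tuples correspond one to one to accepted choice sequences, so multiplicities are right
(`outputBag_eq`).

From long runs to short ones. A run visits the whole document even if its output is short, so steps
that write nothing useful must be skipped. Each state is enriched by a guess of the registers that
will still be used, which is unique for every run (`choiceOutputs_eq`), and by a pending copyless
assignment without letters, of which there are finitely many. A step that puts no letter into a live
register is absorbed by the pending assignment; any other step becomes a label. A letter in a live
register reaches the output, so a run has at most as many labels as its output has letters
(`length_le_length_output`).

Enumerating label sequences. The document is processed from right to left, and for each state a bag
of label sequences is kept as a shared immutable structure: an event is a label followed by a
nonempty bag, two bags are merged by a constant number of new pairs (`Exec.addBag`), and a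
transition without label reuses a bag as it is. As no event is empty, a depth-first traversal with a
stack of pending alternatives never meets a dead end and spends constant time per label
(`Exec.popForest`, `Exec.descend`). The output of a run is written by expanding its final string
through the assignments of its labels; copylessness makes this linear in the number of labels
(`expandCost_le`).

The algorithms are written in a small language with immutable pairs, whose compilation to random
access machines costs a constant factor (`Exec.simulate`). -/

/-- Values of the structured language: integers and pairs. -/
inductive Val where
  | atom (z : ℤ)
  | cell (a b : Val)

/-- The value `v` is known to be different from the integer `z`. -/
def Val.Differs : Val → ℤ → Prop
  | .atom y, z => y ≠ z
  | .cell _ _, z => z = 0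

/-- Commands over variables `V`. -/
inductive Cmd (V : Type*) where
  | skip
  | cons (d a b : V)
  | car (d a : V)
  | cdr (d a : V)
  | const (d : V) (z : ℤ)
  | move (d a : V)
  | read (d : V)
  | write (a : V)
  | seq (c₁ c₂ : Cmd V)
  /-- if the value of `a` is the integer `z`, then `c₁`, else `c₂` -/
  | ite (a : V) (z : ℤ) (c₁ c₂ : Cmd V)
  /-- while the value of `a` is not `0` -/
  | loop (a : V) (c : Cmd V)

/-- A state: the values of the variables and the unread input. -/
abbrev CState (V : Type*) := (V → Val) × List ℤ

open Function (update)

/-- Big-step semantics, with the output and the time. -/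
inductive Exec {V : Type*} [DecidableEq V] : Cmd V → CState V → List ℤ → ℕ → CState V → Prop
  | skip (s) : Exec .skip s [] 0 s
  | cons (d a b σ i) : Exec (.cons d a b) (σ, i) [] 1 (update σ d (.cell (σ a) (σ b)), i)
  | car {d a σ x y} (i) (h : σ a = .cell x y) : Exec (.car d a) (σ, i) [] 1 (update σ d x, i)
  | cdr {d a σ x y} (i) (h : σ a = .cell x y) : Exec (.cdr d a) (σ, i) [] 1 (update σ d y, i)
  | const (d z σ i) : Exec (.const d z) (σ, i) [] 1 (update σ d (.atom z), i)
  | move (d a σ i) : Exec (.move d a) (σ, i) [] 1 (update σ d (σ a), i)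
  | read (d σ i) : Exec (.read d) (σ, i) [] 1 (update σ d (.atom (i.headD 0)), i.tail)
  | write {a σ z} (i) (h : σ a = .atom z) : Exec (.write a) (σ, i) [z] 1 (σ, i)
  | seq {c₁ c₂ s w t s' w' t' s''} (h₁ : Exec c₁ s w t s') (h₂ : Exec c₂ s' w' t' s'') :
      Exec (.seq c₁ c₂) s (w ++ w') (t + t') s''
  | ite_eq {a z c₁ c₂ w t s'} {s : CState V} (h : s.1 a = .atom z) (h₁ : Exec c₁ s w t s') :
      Exec (.ite a z c₁ c₂) s w (t + 1) s'
  | ite_ne {a z c₁ c₂ w t s'} {s : CState V} (h : (s.1 a).Differs z) (h₂ : Exec c₂ s w t s') :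
      Exec (.ite a z c₁ c₂) s w (t + 1) s'
  | loop_done {a c} {s : CState V} (h : s.1 a = .atom 0) : Exec (.loop a c) s [] 1 s
  | loop_step {a c w t s' w' t' s''} {s : CState V} (h : (s.1 a).Differs 0)
      (h₁ : Exec c s w t s') (h₂ : Exec (.loop a c) s' w' t' s'') :
      Exec (.loop a c) s (w ++ w') (t + t' + 1) s''

/-- The length of the code of a command. -/
def Cmd.len {V : Type*} : Cmd V → ℕ
  | .skip => 0
  | .cons _ _ _ => 12
  | .car _ _ => 2
  | .cdr _ _ => 5
  | .const _ _ => 2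
  | .move _ _ => 2
  | .read _ => 1
  | .write _ => 1
  | .seq c₁ c₂ => c₁.len + c₂.len
  | .ite _ _ c₁ c₂ => c₁.len + c₂.len + 4
  | .loop _ c => c.len + 3

/-- The code of a command, placed at address `l`. Variables live at odd addresses from `5` on,
the cells of the heap occupy the addresses `4 * k` and `4 * k + 2` with `0 < k`, register `1` points
to the last allocated cell and register `3` is used for address computations. -/
def Cmd.code {V : Type*} (κ : V → ℕ) : Cmd V → ℕ → Program
  | .skip, _ => []
  | .cons d a b, _ =>
      [.load (.reg 1), .add (.const 4), .store (.reg 1), .load (.reg (2 * κ a + 5)),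
       .store (.ind 1), .load (.reg 1), .add (.const 2), .store (.reg 3),
       .load (.reg (2 * κ b + 5)), .store (.ind 3), .load (.reg 1), .store (.reg (2 * κ d + 5))]
  | .car d a, _ => [.load (.ind (2 * κ a + 5)), .store (.reg (2 * κ d + 5))]
  | .cdr d a, _ =>
      [.load (.reg (2 * κ a + 5)), .add (.const 2), .store (.reg 3), .load (.ind 3),
       .store (.reg (2 * κ d + 5))]
  | .const d z, _ => [.load (.const z), .store (.reg (2 * κ d + 5))]
  | .move d a, _ => [.load (.reg (2 * κ a + 5)), .store (.reg (2 * κ d + 5))]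
  | .read d, _ => [.read (.reg (2 * κ d + 5))]
  | .write a, _ => [.write (.reg (2 * κ a + 5))]
  | .seq c₁ c₂, l => c₁.code κ l ++ c₂.code κ (l + c₁.len)
  | .ite a z c₁ c₂, l =>
      [.load (.reg (2 * κ a + 5)), .sub (.const z), .jzero (l + 3 + c₂.len + 1)] ++
      (c₂.code κ (l + 3) ++ ([.jump (l + 3 + c₂.len + 1 + c₁.len)] ++
        c₁.code κ (l + 3 + c₂.len + 1)))
  | .loop a c, l =>
      [.load (.reg (2 * κ a + 5)), .jzero (l + 3 + c.len)] ++
      (c.code κ (l + 2) ++ [.jump l])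

theorem Cmd.length_code {V : Type*} (κ : V → ℕ) (c : Cmd V) (l : ℕ) :
    (c.code κ l).length = c.len := by
  induction c generalizing l
  all_goals simp [Cmd.code, Cmd.len, *]
  all_goals omega

/-! ### Executing code that is embedded in a larger program. -/

/-- The instructions `l` are found in the program `P` at address `i`. -/
def Program.At (P : Program) (i : ℕ) (l : List Instr) : Prop :=
  ∃ p q, P = p ++ l ++ q ∧ p.length = i

theorem Program.At.left {P : Program} {i : ℕ} {l l' : List Instr} (h : P.At i (l ++ l')) :
    P.At i l := by
  obtain ⟨p, q, rfl, rfl⟩ := h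
  exact ⟨p, l' ++ q, by simp, rfl⟩

theorem Program.At.right {P : Program} {i : ℕ} {l l' : List Instr} (h : P.At i (l ++ l')) :
    P.At (i + l.length) l' := by
  obtain ⟨p, q, rfl, rfl⟩ := h
  exact ⟨p ++ l, q, by simp, by simp⟩

theorem Program.At.get {P : Program} {i : ℕ} {l : List Instr} (h : P.At i l) (j : ℕ)
    (hj : j < l.length) : P[i + j]? = some l[j] := by
  obtain ⟨p, q, rfl, rfl⟩ := h
  rw [List.append_assoc, List.getElem?_append_right (by omega), Nat.add_sub_cancel_left,
    List.getElem?_append_left hj, List.getElem?_eq_getElem hj]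

theorem Program.steps_add (P : Program) (m n : ℕ) (c : Config) :
    P.steps (m + n) c = (P.steps m c).bind (P.steps n) := by
  induction m generalizing c with
  | zero => simp [Program.steps]
  | succ m ih =>
    rw [Nat.succ_add]
    simp only [Program.steps]
    cases h : P.step c with
    | none => simp
    | some d => simp [ih]

theorem Program.steps_trans {P : Program} {m n : ℕ} {c d e : Config}
    (h₁ : P.steps m c = some d) (h₂ : P.steps n d = some e) : P.steps (m + n) c = some e := by
  rw [Program.steps_add, h₁]; exact h₂

theorem Program.steps_one (P : Program) (c : Config) : P.steps 1 c = P.step c := by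
  simp only [Program.steps]; cases P.step c <;> rfl

/-! ### Representation of values in memory and correctness of the compiled code. -/

/-- The integer `z` represents the value `v` in a memory with `h` allocated cells. -/
def Val.Rep (m : ℕ → ℤ) (h : ℕ) : Val → ℤ → Prop
  | .atom y, z => z = y
  | .cell a b, z => ∃ k : ℕ, 0 < k ∧ k ≤ h ∧ z = (4 * k : ℕ) ∧
      a.Rep m h (m (4 * k)) ∧ b.Rep m h (m (4 * k + 2))

/-- Values are immutable: allocated cells are never overwritten, so a representation survives the
growth of the heap. This is what permits unlimited sharing of substructures. -/
theorem Val.Rep.mono {m m' : ℕ → ℤ} {h h' : ℕ} {v : Val} {z : ℤ} (hv : v.Rep m h z)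
    (hm : ∀ k, 0 < k → k ≤ h → m' (4 * k) = m (4 * k) ∧ m' (4 * k + 2) = m (4 * k + 2))
    (hh : h ≤ h') : v.Rep m' h' z := by
  induction v generalizing z with
  | atom y => exact hv
  | cell a b iha ihb =>
    obtain ⟨k, h0, h1, h2, h3, h4⟩ := hv
    refine ⟨k, h0, h1.trans hh, h2, ?_, ?_⟩
    · rw [(hm k h0 h1).1]; exact iha h3
    · rw [(hm k h0 h1).2]; exact ihb h4

/-- Cells have positive addresses, so a pair can be told apart from `0`. Nothing is claimed for
other integers, since an address may coincide with an atom. -/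
theorem Val.Rep.ne {m : ℕ → ℤ} {h : ℕ} {v : Val} {y z : ℤ} (hv : v.Rep m h y)
    (hz : v.Differs z) : y ≠ z := by
  cases v with
  | atom y => rw [show _ = _ from hv]; exact hz
  | cell a b =>
    obtain ⟨k, h0, h1, h2, -⟩ := hv
    rw [show z = 0 from hz, h2]
    simp; omega

/-- The memory `m` represents the values `σ` of the variables. -/
def Simulates {V : Type*} (κ : V → ℕ) (σ : V → Val) (m : ℕ → ℤ) : Prop :=
  ∃ h : ℕ, m 1 = (4 * h : ℕ) ∧ ∀ v, (σ v).Rep m h (m (2 * κ v + 5))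

theorem Simulates.update_var {V : Type*} [DecidableEq V] {κ : V → ℕ} (hκ : κ.Injective)
    {σ : V → Val} {m m' : ℕ → ℤ} {h h' : ℕ} (hh : h ≤ h')
    (h1 : m' 1 = (4 * h' : ℕ)) (hs : ∀ v, (σ v).Rep m h (m (2 * κ v + 5)))
    (hm : ∀ k, 0 < k → k ≤ h → m' (4 * k) = m (4 * k) ∧ m' (4 * k + 2) = m (4 * k + 2))
    {d : V} (hv : ∀ k, k ≠ κ d → m' (2 * k + 5) = m (2 * k + 5)) {x : Val}
    (hx : x.Rep m' h' (m' (2 * κ d + 5))) : Simulates κ (update σ d x) m' := by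
  refine ⟨h', h1, fun v => ?_⟩
  by_cases hvd : v = d
  · subst hvd; simpa using hx
  · rw [Function.update_of_ne hvd, hv _ (fun e => hvd (hκ e))]
    exact (hs v).mono hm hh

/-- Covers every command that sets a variable without allocating. Registers `0` and `3` are scratch;
by parity and size, neither they nor the register of `d` can lie in the heap. -/
theorem Simulates.store {V : Type*} [DecidableEq V] {κ : V → ℕ} (hκ : κ.Injective)
    {σ : V → Val} {m m' : ℕ → ℤ} {h : ℕ} (h1 : m 1 = (4 * h : ℕ))
    (hs : ∀ v, (σ v).Rep m h (m (2 * κ v + 5))) {d : V} {x : Val} {z : ℤ} (hx : x.Rep m h z)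
    (hz : m' (2 * κ d + 5) = z)
    (hm : ∀ k, k ≠ 0 → k ≠ 3 → k ≠ 2 * κ d + 5 → m' k = m k) :
    Simulates κ (Function.update σ d x) m' := by
  have hm' : ∀ k, 0 < k → k ≤ h → m' (4 * k) = m (4 * k) ∧ m' (4 * k + 2) = m (4 * k + 2) :=
    fun k hk _ => ⟨hm _ (by omega) (by omega) (by omega), hm _ (by omega) (by omega) (by omega)⟩
  refine Simulates.update_var hκ le_rfl ?_ hs hm' ?_ ?_
  · rw [hm _ (by omega) (by omega) (by omega), h1]
  · exact fun k hk => hm _ (by omega) (by omega) (by omega)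
  · rw [hz]; exact hx.mono hm' le_rfl

theorem Simulates.scratch {V : Type*} {κ : V → ℕ} {σ : V → Val} {m m' : ℕ → ℤ}
    (hs : Simulates κ σ m) (hm : ∀ k, k ≠ 0 → m' k = m k) : Simulates κ σ m' := by
  obtain ⟨h, h1, h2⟩ := hs
  refine ⟨h, by rw [hm _ (by omega), h1], fun v => ?_⟩
  rw [hm _ (by omega)]
  exact (h2 v).mono
    (fun k hk _ => ⟨hm _ (by omega), hm _ (by omega)⟩) le_rfl

theorem Program.At.head {P : Program} {i : ℕ} {x : Instr} {l : List Instr}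
    (h : P.At i (x :: l)) : P[i]? = some x := h.get 0 (by simp)

theorem Program.At.tail {P : Program} {i : ℕ} {x : Instr} {l : List Instr}
    (h : P.At i (x :: l)) : P.At (i + 1) l := Program.At.right (l := [x]) h

section Straight

variable {P : Program} {i : ℕ} {l : List Instr} {m : ℕ → ℤ} {inp out : List ℤ} {n : ℕ}
  {c : Config}

theorem Program.steps_cons {x : Instr} (h : P.At i (x :: l)) {c' : Config}
    (hx : x.exec ⟨i, m, inp, out⟩ = some c') (hl : P.At (i + 1) l → P.steps n c' = some c) :
    P.steps (n + 1) ⟨i, m, inp, out⟩ = some c := by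
  simp only [Program.steps, Program.step]
  simp [h.head, hx, hl h.tail]

theorem Program.steps_load_const {z : ℤ} (h : P.At i (.load (.const z) :: l))
    (hl : P.At (i + 1) l → P.steps n ⟨i + 1, update m 0 z, inp, out⟩ = some c) :
    P.steps (n + 1) ⟨i, m, inp, out⟩ = some c := Program.steps_cons h rfl hl

theorem Program.steps_load_reg {r : ℕ} {v : ℤ} (h : P.At i (.load (.reg r) :: l)) (hv : m r = v)
    (hl : P.At (i + 1) l → P.steps n ⟨i + 1, update m 0 v, inp, out⟩ = some c) :
    P.steps (n + 1) ⟨i, m, inp, out⟩ = some c :=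
  Program.steps_cons h (by simp [Instr.exec, Operand.val, hv]) hl

theorem Program.steps_load_ind {r k : ℕ} (h : P.At i (.load (.ind r) :: l)) (hk : m r = k)
    (hl : P.At (i + 1) l → P.steps n ⟨i + 1, update m 0 (m k), inp, out⟩ = some c) :
    P.steps (n + 1) ⟨i, m, inp, out⟩ = some c :=
  Program.steps_cons h (by simp [Instr.exec, Operand.val, hk]) hl

theorem Program.steps_add_const {z v : ℤ} (h : P.At i (.add (.const z) :: l)) (hv : m 0 + z = v)
    (hl : P.At (i + 1) l → P.steps n ⟨i + 1, update m 0 v, inp, out⟩ = some c) :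
    P.steps (n + 1) ⟨i, m, inp, out⟩ = some c :=
  Program.steps_cons h (by simp [Instr.exec, Operand.val, hv]) hl

theorem Program.steps_sub_const {z : ℤ} (h : P.At i (.sub (.const z) :: l))
    (hl : P.At (i + 1) l → P.steps n ⟨i + 1, update m 0 (m 0 - z), inp, out⟩ = some c) :
    P.steps (n + 1) ⟨i, m, inp, out⟩ = some c := Program.steps_cons h rfl hl

theorem Program.steps_store_reg {r : ℕ} {v : ℤ} (h : P.At i (.store (.reg r) :: l))
    (hv : m 0 = v)
    (hl : P.At (i + 1) l → P.steps n ⟨i + 1, update m r v, inp, out⟩ = some c) :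
    P.steps (n + 1) ⟨i, m, inp, out⟩ = some c :=
  Program.steps_cons h (by simp [Instr.exec, Operand.addr, hv]) hl

theorem Program.steps_store_ind {r k : ℕ} {v : ℤ} (h : P.At i (.store (.ind r) :: l))
    (hk : m r = k) (hv : m 0 = v)
    (hl : P.At (i + 1) l → P.steps n ⟨i + 1, update m k v, inp, out⟩ = some c) :
    P.steps (n + 1) ⟨i, m, inp, out⟩ = some c :=
  Program.steps_cons h (by simp [Instr.exec, Operand.addr, hk, hv]) hl

theorem Program.steps_jump {r : ℕ} (h : P.At i (.jump r :: l)) :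
    P.steps 1 ⟨i, m, inp, out⟩ = some ⟨r, m, inp, out⟩ :=
  Program.steps_cons h rfl fun _ => rfl

theorem Program.steps_jzero {r : ℕ} (h : P.At i (.jzero r :: l)) :
    P.steps 1 ⟨i, m, inp, out⟩ = some ⟨if m 0 = 0 then r else i + 1, m, inp, out⟩ :=
  Program.steps_cons h rfl fun _ => rfl

end Straight

/-- The only command that allocates. The new cell has number `h + 1`, beyond all cells in use. -/
theorem Simulates.cons {V : Type*} [DecidableEq V] {κ : V → ℕ} (hκ : κ.Injective) {P : Program}
    {l : ℕ} {d a b : V} (hP : P.At l (Cmd.code κ (.cons d a b) l)) {σ : V → Val} {m : ℕ → ℤ}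
    (hs : Simulates κ σ m) {i out : List ℤ} :
    ∃ m', P.steps 12 ⟨l, m, i, out⟩ = some ⟨l + 12, m', i, out⟩ ∧
      Simulates κ (update σ d (.cell (σ a) (σ b))) m' := by
  obtain ⟨h, h1, hs⟩ := hs
  refine ⟨?mem1, ?_, ?_⟩
  -- The final memory is left open and gets determined by executing the code.
  rotate_left
  · refine Program.steps_load_reg (v := (4 * h : ℕ)) hP h1 fun hP => ?_
    refine Program.steps_add_const (v := (4 * (h + 1) : ℕ)) hP
      (by simp (disch := omega) only [Function.update_of_ne, Function.update_self, h1]; push_cast; ring) fun hP => ?_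
    refine Program.steps_store_reg (v := (4 * (h + 1) : ℕ)) hP
      (by simp (disch := omega) only [Function.update_of_ne, Function.update_self]) fun hP => ?_
    refine Program.steps_load_reg (v := m (2 * κ a + 5)) hP
      (by simp (disch := omega) only [Function.update_of_ne, Function.update_self]) fun hP => ?_
    refine Program.steps_store_ind (k := 4 * (h + 1)) (v := m (2 * κ a + 5)) hP
      (by simp (disch := omega) only [Function.update_of_ne, Function.update_self])
      (by simp (disch := omega) only [Function.update_of_ne, Function.update_self]) fun hP => ?_
    refine Program.steps_load_reg (v := (4 * (h + 1) : ℕ)) hP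
      (by simp (disch := omega) only [Function.update_of_ne, Function.update_self]) fun hP => ?_
    refine Program.steps_add_const (v := (4 * (h + 1) + 2 : ℕ)) hP
      (by simp) fun hP => ?_
    refine Program.steps_store_reg (v := (4 * (h + 1) + 2 : ℕ)) hP
      (by simp (disch := omega) only [Function.update_of_ne, Function.update_self]) fun hP => ?_
    refine Program.steps_load_reg (v := m (2 * κ b + 5)) hP
      (by simp (disch := omega) only [Function.update_of_ne, Function.update_self]) fun hP => ?_
    refine Program.steps_store_ind (k := 4 * (h + 1) + 2) (v := m (2 * κ b + 5)) hP
      (by simp (disch := omega) only [Function.update_of_ne, Function.update_self])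
      (by simp (disch := omega) only [Function.update_of_ne, Function.update_self]) fun hP => ?_
    refine Program.steps_load_reg (v := (4 * (h + 1) : ℕ)) hP
      (by simp (disch := omega) only [Function.update_of_ne, Function.update_self]) fun hP => ?_
    refine Program.steps_store_reg (v := (4 * (h + 1) : ℕ)) hP
      (by simp (disch := omega) only [Function.update_of_ne, Function.update_self]) fun hP => ?_
    rfl
  -- Only a few entries of the final memory matter, so the nested updates are replaced by an
  -- arbitrary `m'` with these entries.
  · have hmono : ∀ m' : ℕ → ℤ, (∀ k ≠ 0, k ≠ 1 → k ≠ 3 → k ≠ 4 * (h + 1) →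
        k ≠ 4 * (h + 1) + 2 → k ≠ 2 * κ d + 5 → m' k = m k) →
        m' 1 = (4 * (h + 1) : ℕ) → m' (2 * κ d + 5) = (4 * (h + 1) : ℕ) →
        m' (4 * (h + 1)) = m (2 * κ a + 5) → m' (4 * (h + 1) + 2) = m (2 * κ b + 5) →
        Simulates κ (update σ d (.cell (σ a) (σ b))) m' := by
      intro m' hm e1 e2 e3 e4
      have hm' : ∀ k, 0 < k → k ≤ h →
          m' (4 * k) = m (4 * k) ∧ m' (4 * k + 2) = m (4 * k + 2) := fun k _ _ =>
        ⟨hm _ (by omega) (by omega) (by omega) (by omega) (by omega) (by omega),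
         hm _ (by omega) (by omega) (by omega) (by omega) (by omega) (by omega)⟩
      refine Simulates.update_var hκ (Nat.le_succ h) e1 hs hm' (fun k hk =>
        hm _ (by omega) (by omega) (by omega) (by omega) (by omega) (by omega)) ?_
      refine ⟨h + 1, by omega, le_rfl, e2, ?_, ?_⟩
      · rw [e3]; exact (hs a).mono hm' (Nat.le_succ h)
      · rw [e4]; exact (hs b).mono hm' (Nat.le_succ h)
    apply hmono
    · intro k h0 h1 h2 h3 h4 h5
      simp (disch := assumption) only [Function.update_of_ne]
    all_goals
      simp (disch := omega) only [Function.update_of_ne, Function.update_self]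

/-- The compiled code of a command simulates its big-step semantics. -/
theorem Exec.simulate {V : Type*} [DecidableEq V] {κ : V → ℕ} (hκ : κ.Injective) {c : Cmd V}
    {s s' : CState V} {w : List ℤ} {t : ℕ} (h : Exec c s w t s') :
    ∀ {P : Program} {l : ℕ} {m : ℕ → ℤ} {out : List ℤ}, P.At l (c.code κ l) →
      Simulates κ s.1 m → ∃ n m', n ≤ 12 * t ∧
        P.steps n ⟨l, m, s.2, out⟩ = some ⟨l + c.len, m', s'.2, out ++ w⟩ ∧
        Simulates κ s'.1 m' := by
  induction h with
  | skip s =>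
    intro P l m out hP hs
    exact ⟨0, m, by simp, by simp [Program.steps, Cmd.len], hs⟩
  | cons d a b σ i =>
    intro P l m out hP hs
    obtain ⟨m', e, hs'⟩ := Simulates.cons hκ hP hs
    -- The factor `12` comes from this command, the longest elementary one; tests and jumps need at
    -- most four instructions per unit of time.
    exact ⟨12, m', le_rfl, by simpa [Cmd.len] using e, hs'⟩
  | car i h =>
    rename_i d a σ x y
    intro P l m out hP ⟨k, h1, hs⟩
    have ha := hs a
    simp only [h] at ha
    obtain ⟨k, hk, hkh, hz, hx, hy⟩ := ha
    refine ⟨2, ?mem2, by omega, ?_, ?_⟩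
    rotate_left
    · refine Program.steps_load_ind hP hz fun hP => ?_
      refine Program.steps_store_reg hP rfl fun hP => ?_
      simp only [Program.steps, Cmd.len, List.append_nil]
      rfl
    · refine Simulates.store hκ h1 hs hx (by simp) fun j h0 h3 h5 => ?_
      rw [Function.update_of_ne h5, Function.update_of_ne h0]
  | cdr i h =>
    rename_i d a σ x y
    intro P l m out hP ⟨k, h1, hs⟩
    have ha := hs a
    simp only [h] at ha
    obtain ⟨k, hk, hkh, hz, hx, hy⟩ := ha
    refine ⟨5, ?mem3, by omega, ?_, ?_⟩
    rotate_left
    · refine Program.steps_load_reg hP rfl fun hP => ?_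
      refine Program.steps_add_const hP rfl fun hP => ?_
      refine Program.steps_store_reg hP rfl fun hP => ?_
      refine Program.steps_load_ind (k := 4 * k + 2) hP
        (by simp [hz]) fun hP => ?_
      refine Program.steps_store_reg hP rfl fun hP => ?_
      simp only [Program.steps, Cmd.len, List.append_nil]
      rfl
    · refine Simulates.store hκ h1 hs hy ?_ fun j h0 h3 h5 => ?_
      · simp (disch := omega) only [Function.update_of_ne, Function.update_self]
      · simp (disch := assumption) only [Function.update_of_ne]
  | const d z σ i =>
    intro P l m out hP ⟨k, h1, hs⟩
    refine ⟨2, ?mem4, by omega, ?_, ?_⟩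
    rotate_left
    · refine Program.steps_load_const hP fun hP => ?_
      refine Program.steps_store_reg hP rfl fun hP => ?_
      simp only [Program.steps, Cmd.len, List.append_nil]
      rfl
    · refine Simulates.store hκ h1 hs (x := .atom z) (z := z) rfl (by simp) fun j h0 h3 h5 => ?_
      rw [Function.update_of_ne h5, Function.update_of_ne h0]
  | move d a σ i =>
    intro P l m out hP ⟨k, h1, hs⟩
    refine ⟨2, ?mem5, by omega, ?_, ?_⟩
    rotate_left
    · refine Program.steps_load_reg hP rfl fun hP => ?_
      refine Program.steps_store_reg hP rfl fun hP => ?_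
      simp only [Program.steps, Cmd.len, List.append_nil]
      rfl
    · refine Simulates.store hκ h1 hs (hs a) (by simp) fun j h0 h3 h5 => ?_
      rw [Function.update_of_ne h5, Function.update_of_ne h0]
  | read d σ i =>
    intro P l m out hP ⟨k, h1, hs⟩
    refine ⟨1, ?mem6, by omega, ?_, ?_⟩
    rotate_left
    · refine Program.steps_cons hP rfl fun _ => ?_
      simp only [Program.steps, Cmd.len, List.append_nil]
      rfl
    · refine Simulates.store hκ h1 hs (x := .atom (i.headD 0)) (z := i.headD 0) rfl (by simp) fun j h0 h3 h5 => ?_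
      rw [Function.update_of_ne h5]
  | write i h =>
    rename_i a σ z
    intro P l m out hP hs
    obtain ⟨k, h1, hs'⟩ := id hs
    have ha := hs' a
    simp only [h] at ha
    refine ⟨1, m, by omega, ?_, hs⟩
    refine Program.steps_cons hP rfl fun _ => ?_
    simp [Program.steps, Cmd.len, show m (2 * κ a + 5) = z from ha]
  | seq h₁ h₂ ih₁ ih₂ =>
    intro P l m out hP hs
    have hP2 := hP.right
    rw [Cmd.length_code] at hP2
    obtain ⟨n₁, m₁, hn₁, e₁, hs₁⟩ := ih₁ (out := out) hP.left hs
    obtain ⟨n₂, m₂, hn₂, e₂, hs₂⟩ := ih₂ (out := out ++ _) hP2 hs₁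
    refine ⟨n₁ + n₂, m₂, by omega, ?_, hs₂⟩
    rw [Program.steps_trans e₁ e₂]
    simp [Cmd.len, add_assoc]
  | ite_eq h h₁ ih =>
    rename_i a z c₁ c₂ w t s' s
    intro P l m out hP hs
    have ha : m (2 * κ a + 5) = z := by
      obtain ⟨k, h1, hs⟩ := id hs
      have ha := hs a
      rw [h] at ha
      exact ha
    have hP3 := hP.right.right.right
    simp only [Cmd.length_code, List.length_cons, List.length_nil, zero_add] at hP3
    have hs' : Simulates κ s.1 (update (update m 0 z) 0 0) :=
      hs.scratch fun k hk => by
        rw [Function.update_of_ne hk, Function.update_of_ne hk]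
    obtain ⟨n, m', hn, e, hs'⟩ := ih (out := out) hP3 hs'
    refine ⟨3 + n, m', by omega, ?_, hs'⟩
    refine Program.steps_trans (d := ⟨l + 3 + c₂.len + 1, update (update m 0 z) 0 0, s.2, out⟩) ?_ ?_
    · refine Program.steps_load_reg hP rfl fun hP => ?_
      refine Program.steps_sub_const hP fun hP => ?_
      rw [Program.steps_jzero hP]
      simp [ha]
    · rw [e]
      simp only [Cmd.len, Option.some.injEq, Config.mk.injEq, and_self, and_true]
      omega
  | ite_ne h h₁ ih =>
    rename_i a z c₁ c₂ w t s' s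
    intro P l m out hP hs
    have ha : m (2 * κ a + 5) ≠ z := by
      obtain ⟨k, h1, hs⟩ := id hs
      exact (hs a).ne h
    have hP3 := hP.right.left
    have hP4 := hP.right.right.left
    simp only [Cmd.length_code, List.length_cons, List.length_nil, zero_add] at hP3 hP4
    have hs' : Simulates κ s.1 (update (update m 0 (m (2 * κ a + 5))) 0
        (m (2 * κ a + 5) - z)) :=
      hs.scratch fun k hk => by
        rw [Function.update_of_ne hk, Function.update_of_ne hk]
    obtain ⟨n, m', hn, e, hs'⟩ := ih (out := out) hP3 hs'
    refine ⟨3 + n + 1, m', by omega, ?_, hs'⟩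
    refine Program.steps_trans (Program.steps_trans (d := ⟨l + 3, (update (update m 0
      (m (2 * κ a + 5))) 0 (m (2 * κ a + 5) - z)), s.2, out⟩) ?_ e) ?_
    · refine Program.steps_load_reg hP rfl fun hP => ?_
      refine Program.steps_sub_const hP fun hP => ?_
      rw [Program.steps_jzero hP]
      simp [sub_eq_zero, ha]
    · rw [Program.steps_jump hP4]
      simp only [Cmd.len, Option.some.injEq, Config.mk.injEq, and_self, and_true]
      omega
  | loop_done h =>
    rename_i a c s
    intro P l m out hP hs
    have ha : m (2 * κ a + 5) = 0 := by
      obtain ⟨k, h1, hs⟩ := id hs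
      have ha := hs a
      rw [h] at ha
      exact ha
    refine ⟨2, update m 0 0, by omega, ?_, hs.scratch fun k hk => Function.update_of_ne hk ..⟩
    refine Program.steps_load_reg hP rfl fun hP => ?_
    rw [Program.steps_jzero hP]
    simp only [ha, Function.update_self, Cmd.len, if_true, List.append_nil, Option.some.injEq,
      Config.mk.injEq, and_self, and_true]
    omega
  | loop_step h h₁ h₂ ih₁ ih₂ =>
    rename_i a c w t s' w' t' s'' s
    intro P l m out hP hs
    have ha : m (2 * κ a + 5) ≠ 0 := by
      obtain ⟨k, h1, hs⟩ := id hs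
      exact (hs a).ne h
    have hP3 := hP.right.left
    have hP4 := hP.right.right
    simp only [Cmd.length_code, List.length_cons, List.length_nil, zero_add] at hP3 hP4
    have hs' : Simulates κ s.1 (update m 0 (m (2 * κ a + 5))) :=
      hs.scratch fun k hk => Function.update_of_ne hk ..
    obtain ⟨n, m', hn, e, hs'⟩ := ih₁ (out := out) hP3 hs'
    obtain ⟨n', m'', hn', e', hs''⟩ := ih₂ (out := out ++ w) hP hs'
    refine ⟨2 + n + 1 + n', m'', by omega, ?_, hs''⟩
    rw [← List.append_assoc, ← e']
    rw [Program.steps_add, show P.steps (2 + n + 1) ⟨l, m, s.2, out⟩ = _ from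
      Program.steps_trans (Program.steps_trans (d := ⟨l + 2, update m 0 (m (2 * κ a + 5)), s.2, out⟩)
        ?_ e) (Program.steps_jump hP4)]
    · simp
    · refine Program.steps_load_reg hP rfl fun hP => ?_
      rw [Program.steps_jzero hP]
      simp [ha]

/-! ### From structured enumeration loops to machines with bounded delay. -/

/-- Started in the given state, the loop with the body `seq c (write z)` enumerates the words of the
list, with a time bound for `c` that is linear in the length of the word. -/
inductive EnumLoop {V : Type*} [DecidableEq V] (a : V) (c : Cmd V) (z : V) (k : ℕ) :
    CState V → List (List ℤ) → Prop
  | done {s : CState V} (h : s.1 a = .atom 0) : EnumLoop a c z k s []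
  | step {s s' : CState V} {w : List ℤ} {ws : List (List ℤ)} {t : ℕ} (h : (s.1 a).Differs 0)
      (hc : Exec c s w t s') (ht : t ≤ k * (w.length + 1)) (hz : s'.1 z = .atom 0)
      (hs : EnumLoop a c z k s' ws) : EnumLoop a c z k s (w :: ws)

/-- The delay is measured from `d`, the configuration right after the last end marker or at the
start, whereas the loop head is reached `j` steps later. Hence the induction carries a bound `J` on
`j`: it pays for the initialization before the first word, and for the single jump back before all
others. -/
theorem EnumLoop.enumerates {V : Type*} [DecidableEq V] {κ : V → ℕ} (hκ : κ.Injective)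
    {a z : V} {c : Cmd V} {k : ℕ} {s : CState V} {ws : List (List ℤ)}
    (h : EnumLoop a c z k s ws) {P : Program} {l J : ℕ} (hJ : 1 ≤ J)
    (hP : P.At l (Cmd.code κ (.loop a (.seq c (.write z))) l ++ [.halt])) :
    ∀ (d : Config) (j : ℕ) (m : ℕ → ℤ), j ≤ J → P.steps j d = some ⟨l, m, s.2, d.out⟩ →
      Simulates κ s.1 m → P.Enumerates (12 * k + J + 12) d ws := by
  have hhalt := hP.right.head
  rw [Cmd.length_code] at hhalt
  have hl := hP.left
  induction h with
  | done h =>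
    intro d j m hj hd hs
    obtain ⟨n, m', hn, e, hs'⟩ := Exec.simulate hκ (Exec.loop_done (c := .seq c (.write z)) h)
      (out := d.out) hl hs
    rw [List.append_nil] at e
    exact .nil (by omega) (Program.steps_trans hd e) rfl hhalt
  | step h hc ht hz hs ih =>
    rename_i s s' w ws t
    intro d j m hj hd hm
    have ha : m (2 * κ a + 5) ≠ 0 := by
      obtain ⟨k, h1, hs⟩ := id hm
      exact (hs a).ne h
    have hP3 := hl.right.left.left
    have hP4 := hl.right.left.right
    have hP5 := hl.right.right
    simp only [Cmd.length_code, List.length_cons, List.length_nil, zero_add] at hP3 hP4 hP5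
    have hm' : Simulates κ s.1 (Function.update m 0 (m (2 * κ a + 5))) :=
      hm.scratch fun k hk => Function.update_of_ne hk ..
    obtain ⟨n, m', hn, e, hs'⟩ := Exec.simulate hκ hc (out := d.out) hP3 hm'
    have hz' : m' (2 * κ z + 5) = 0 := by
      obtain ⟨k, h1, hs⟩ := id hs'
      have ha := hs z
      rw [hz] at ha
      exact ha
    have e1 : P.steps 2 ⟨l, m, s.2, d.out⟩ =
        some ⟨l + 2, Function.update m 0 (m (2 * κ a + 5)), s.2, d.out⟩ := by
      refine Program.steps_load_reg hl rfl fun hP => ?_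
      rw [Program.steps_jzero hP]
      simp [ha]
    have e2 : P.step ⟨l + 2 + c.len, m', s'.2, d.out ++ w⟩ =
        some ⟨l + 2 + c.len + 1, m', s'.2, d.out ++ w ++ [0]⟩ := by
      rw [← Program.steps_one]
      refine Program.steps_cons hP4 ?_ fun _ => rfl
      simp [Instr.exec, Operand.val, hz']
    refine .cons ?_ (Program.steps_trans hd (Program.steps_trans e1 e)) rfl e2 rfl ?_
    · have : 12 * t ≤ 12 * k * (w.length + 1) := by rw [mul_assoc]; omega
      have : J + 12 ≤ (J + 12) * (w.length + 1) := Nat.le_mul_of_pos_right _ (by omega)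
      rw [show 12 * k + J + 12 = 12 * k + (J + 12) by ring, add_mul]
      omega
    · exact ih _ 1 m' hJ (Program.steps_jump hP5) hs'

/-- Enumeration algorithms may be written in the structured language. -/
theorem admitsLinearEnumeration_of_cmd {A O : Type*} {f : List A → Multiset (List O)}
    (H : ∀ (codeA : A → ℤ) (codeO : O → ℤ), (∀ a, codeA a ≠ 0) → codeA.Injective →
      (∀ o, codeO o ≠ 0) →
      ∃ (V : Type) (_ : DecidableEq V) (κ : V → ℕ) (_ : κ.Injective)
        (cpre cinit body : Cmd V) (a z : V) (k : ℕ), ∀ D : List A,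
        ∃ (t t' : ℕ) (σ : V → Val) (i : List ℤ) (s : CState V) (ws : List (List O)),
          t ≤ k * (D.length + 1) ∧ t' ≤ k ∧
          Exec cpre (fun _ => .atom 0, D.map codeA) [] t (σ, i) ∧
          Exec cinit (σ, []) [] t' s ∧
          EnumLoop a body z k s (ws.map (List.map codeO)) ∧ (ws : Multiset (List O)) = f D) :
    AdmitsLinearEnumeration f := by
  intro codeA codeO hA hA0 _ hO0
  obtain ⟨V, _, κ, hκ, cpre, cinit, body, a, z, k, H⟩ := H codeA codeO hA0 hA hO0
  let main : Cmd V := .loop a (.seq body (.write z))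
  let penum : Program := cinit.code κ 0 ++ (main.code κ (0 + cinit.len) ++ [.halt])
  have hpenum : penum.At 0 (cinit.code κ 0 ++ (main.code κ (0 + cinit.len) ++ [.halt])) :=
    ⟨[], [], by simp [penum], rfl⟩
  -- The middle summand is `J`: at most `12 * k` steps of initialization, and at least one step for
  -- the jump back. Both programs use the same layout `κ`, so the second one finds the variables and
  -- the heap where the first one left them.
  refine ⟨cpre.code κ 0 ++ [.halt], penum, 12 * k + (12 * k + 1) + 12, fun D => ?_⟩
  obtain ⟨t, t', σ, i, s, ws, ht, ht', epre, einit, hloop, hws⟩ := H D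
  have hpre : Program.At (cpre.code κ 0 ++ [.halt]) 0 (cpre.code κ 0 ++ [.halt]) :=
    ⟨[], [], by simp, rfl⟩
  have hsim0 : Simulates κ (fun _ => .atom 0) (fun _ => 0) := ⟨0, rfl, fun v => rfl⟩
  obtain ⟨n, m, hn, e, hs⟩ := epre.simulate hκ (out := []) hpre.left hsim0
  obtain ⟨n', m', hn', e', hs'⟩ := einit.simulate hκ (out := []) hpenum.left hs
  refine ⟨n, _, ws, ?_, e, ?_, rfl, hws, ?_⟩
  · calc n ≤ 12 * t := hn
      _ ≤ 12 * (k * (D.length + 1)) := by omega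
      _ = (12 * k) * (D.length + 1) := by ring
      _ ≤ _ := Nat.mul_le_mul_right _ (by omega)
  · have := hpre.right.head
    rwa [Cmd.length_code] at this
  · have hP := hpenum.right
    rw [Cmd.length_code] at hP
    exact hloop.enumerates hκ (J := 12 * k + 1) (by omega) hP _ n' m' (by omega) e' hs'

end ET

namespace ET
open Function (update update_of_ne)

/-! ### Auxiliary facts on the structured language -/

section General

variable {V : Type*}

/-- Sequencing after a silent command, with the output `[] ++ w` reduced to `w` so that executions
unify. -/
theorem Exec.andThen [DecidableEq V] {c₁ c₂ : Cmd V} {s s' s'' : CState V} {w : List ℤ} {t t' : ℕ}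
    (h₁ : Exec c₁ s [] t s') (h₂ : Exec c₂ s' w t' s'') : Exec (.seq c₁ c₂) s w (t + t') s'' :=
  Exec.seq h₁ h₂

/-- Loop-free commands. -/
def Cmd.LoopFree : Cmd V → Prop
  | .seq c₁ c₂ => c₁.LoopFree ∧ c₂.LoopFree
  | .ite _ _ c₁ c₂ => c₁.LoopFree ∧ c₂.LoopFree
  | .loop _ _ => False
  | _ => True

/-- A time bound for loop-free commands. -/
def Cmd.bound : Cmd V → ℕ
  | .seq c₁ c₂ => c₁.bound + c₂.bound
  | .ite _ _ c₁ c₂ => c₁.bound + c₂.bound + 1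
  | _ => 1

/-- Thanks to this syntactic bound, which adds up both branches of a test, the time of loop-free
code never has to be tracked: it is enough that some execution exists. -/
theorem Exec.le_bound [DecidableEq V] {c : Cmd V} {s s' : CState V} {w : List ℤ} {t : ℕ} (h : Exec c s w t s')
    (hc : c.LoopFree) : t ≤ c.bound := by
  induction h with
  | seq h₁ h₂ ih₁ ih₂ => exact Nat.add_le_add (ih₁ hc.1) (ih₂ hc.2)
  | ite_eq h h₁ ih => have := ih hc.1; simp only [Cmd.bound]; omega
  | ite_ne h h₁ ih => have := ih hc.2; simp only [Cmd.bound]; omega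
  | loop_done => exact hc.elim
  | loop_step => exact hc.elim
  | _ => simp [Cmd.bound]

/-- The sequential composition of a list of commands. -/
def Cmd.seqs : List (Cmd V) → Cmd V
  | [] => .skip
  | c :: l => .seq c (seqs l)

theorem Cmd.loopFree_seqs {l : List (Cmd V)} (h : ∀ c ∈ l, c.LoopFree) :
    (Cmd.seqs l).LoopFree := by
  induction l with
  | nil => trivial
  | cons c l ih => exact ⟨h c (by simp), ih fun d hd => h d (by simp [hd])⟩

/-- Case distinction on the value of a variable. -/
def Cmd.switch {α : Type*} (a : V) (code : α → ℤ) (c : α → Cmd V) : List α → Cmd V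
  | [] => .skip
  | x :: l => .ite a (code x) (c x) (switch a code c l)

theorem Cmd.loopFree_switch {α : Type*} {a : V} {code : α → ℤ} {c : α → Cmd V} {l : List α}
    (h : ∀ x, (c x).LoopFree) : (Cmd.switch a code c l).LoopFree := by
  induction l with
  | nil => trivial
  | cons x l ih => exact ⟨h x, ih⟩

/-- The tests before the entry `x` fail because `code` is injective. The time depends on the place
of `x` in the list, so it is left existential and bounded later by `Exec.le_bound`. -/
theorem Exec.switch [DecidableEq V] {α : Type*} {a : V} {code : α → ℤ} (hcode : code.Injective)
    {c : α → Cmd V} {l : List α} {x : α} (hx : x ∈ l) {s s' : CState V} {w : List ℤ} {t : ℕ}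
    (hs : s.1 a = .atom (code x)) (h : Exec (c x) s w t s') :
    ∃ t', Exec (Cmd.switch a code c l) s w t' s' := by
  induction l with
  | nil => simp at hx
  | cons y l ih =>
    by_cases hxy : x = y
    · subst hxy; exact ⟨_, .ite_eq hs h⟩
    · obtain ⟨t', h'⟩ := ih ((List.mem_cons.1 hx).resolve_left hxy)
      exact ⟨_, .ite_ne (by rw [hs]; exact fun e => hxy (hcode e)) h'⟩

end General

/-! ### The variables of the enumeration algorithm -/

inductive Var where
  | bag (i : ℕ)
  | newBag (i : ℕ)
  | aux (i : ℕ)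

noncomputable instance : DecidableEq Var := fun _ _ => Classical.propDecidable _

/-- The number of a variable. -/
def Var.code : Var → ℕ
  | .bag i => 3 * i
  | .newBag i => 3 * i + 1
  | .aux i => 3 * i + 2

theorem Var.code_injective : Var.code.Injective := by
  intro a b h
  cases a <;> cases b <;> simp only [Var.code] at h <;> first | omega | (congr 1; omega)

namespace Var
/-- always `0` -/
abbrev nil : Var := aux 0
/-- the unprocessed part of the document, last letter first -/
abbrev docu : Var := aux 1
/-- the stack of pending alternatives -/
abbrev stack : Var := aux 2
/-- the history of the current output -/
abbrev hist : Var := aux 3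
/-- the current event -/
abbrev event : Var := aux 4
/-- a tag -/
abbrev tag : Var := aux 5
/-- the stack of symbols to be written or expanded -/
abbrev todo : Var := aux 6
abbrev x₁ : Var := aux 7
abbrev x₂ : Var := aux 8
abbrev x₃ : Var := aux 9
abbrev x₄ : Var := aux 10
abbrev x₅ : Var := aux 11
end Var

/-! ### The representation of bags of runs -/

section Layered

variable {A O St Λ F R : Type*}

/-- The runs of a layered system over a document: their productive labels and final symbols. -/
def layeredRuns (tr : St → A → List (Option Λ × St)) (fin : St → List F) :
    St → List A → Multiset (List Λ × F)
  | s, [] => ((fin s).map fun f => (([] : List Λ), f) : List (List Λ × F))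
  | s, a :: D => ((tr s a).map fun p => p.1.elim (layeredRuns tr fin p.2 D) fun l =>
      (layeredRuns tr fin p.2 D).map fun q => (l :: q.1, q.2)).sum

/-- Values that represent events (`true`) and forests of events (`false`), with the list of runs
that they stand for. -/
inductive Enc (lc : Λ → ℤ) (fc : F → ℤ) : Bool → Val → List (List Λ × F) → Prop
  | leaf (f : F) : Enc lc fc true (.cell (.atom 0) (.atom (fc f))) [([], f)]
  | ev {e c : Val} {M N : List (List Λ × F)} (l : Λ) (he : Enc lc fc true e M)
      (hc : Enc lc fc false c N) :
      Enc lc fc true (.cell (.atom (lc l)) (.cell e c)) ((M ++ N).map fun q => (l :: q.1, q.2))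
  | nil : Enc lc fc false (.atom 0) []
  | node {e c s : Val} {M N K : List (List Λ × F)} (he : Enc lc fc true e M)
      (hc : Enc lc fc false c N) (hs : Enc lc fc false s K) :
      Enc lc fc false (.cell e (.cell c s)) (M ++ N ++ K)

/-- A bag of runs is represented by `0`, if it is empty, or else by an event and a forest. -/
def EncBag (lc : Λ → ℤ) (fc : F → ℤ) (v : Val) (M : Multiset (List Λ × F)) : Prop :=
  (v = .atom 0 ∧ M = 0) ∨ ∃ e c M₁ M₂, v = .cell e c ∧ Enc lc fc true e M₁ ∧
    Enc lc fc false c M₂ ∧ M = ((M₁ ++ M₂ : List (List Λ × F)) : Multiset (List Λ × F))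

variable {lc : Λ → ℤ} {fc : F → ℤ}

/-! ### Merging bags and extending them by one letter. -/

/-- Add the bag in `g` to the bag in `acc`. -/
def Cmd.addBag (acc g : Var) : Cmd Var :=
  .ite g 0 .skip <| .ite acc 0 (.move acc g) <|
    .seq (.car .x₁ acc) <| .seq (.cdr .x₂ acc) <| .seq (.car .x₃ g) <| .seq (.cdr .x₄ g) <|
    .seq (.cons .x₄ .x₄ .x₂) <| .seq (.cons .x₄ .x₃ .x₄) <| .cons acc .x₁ .x₄

/-- Two nonempty bags `(e₁, c₁)` and `(e₂, c₂)` are merged by hanging `e₂` with its forest `c₂` in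
front of `c₁`. This takes constant time whatever the size of the bags, and both old bags remain
intact for other uses. The side conditions keep the operands apart from the scratch variables. -/
theorem Exec.addBag {acc g : Var} (hacc : ∀ i, 7 ≤ i → acc ≠ .aux i)
    (hg : ∀ i, 7 ≤ i → i ≤ 10 → g ≠ .aux i) {σ : Var → Val} {M N : Multiset (List Λ × F)}
    (hM : EncBag lc fc (σ acc) M) (hN : EncBag lc fc (σ g) N) (i : List ℤ) :
    ∃ t σ', Exec (.addBag acc g) (σ, i) [] t (σ', i) ∧ EncBag lc fc (σ' acc) (M + N) ∧
      ∀ v, v ≠ acc → (∀ i, 7 ≤ i → v ≠ .aux i) → σ' v = σ v := by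
  rcases hN with ⟨h0, rfl⟩ | ⟨e₂, c₂, N₁, N₂, hv₂, he₂, hc₂, rfl⟩
  · exact ⟨_, σ, .ite_eq h0 (.skip _), by simpa using hM, fun _ _ _ => rfl⟩
  · have hd : (σ g).Differs 0 := by rw [hv₂]; rfl
    rcases hM with ⟨h0, rfl⟩ | ⟨e₁, c₁, M₁, M₂, hv₁, he₁, hc₁, rfl⟩
    · refine ⟨_, _, .ite_ne hd (.ite_eq h0 (.move ..)), ?_, fun v hv _ => update_of_ne hv ..⟩
      rw [Function.update_self, zero_add]
      exact .inr ⟨e₂, c₂, N₁, N₂, hv₂, he₂, hc₂, rfl⟩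
    · have hd' : (σ acc).Differs 0 := by rw [hv₁]; rfl
      have a7 := hacc 7 (by simp)
      have a8 := hacc 8 (by simp)
      have a9 := hacc 9 (by simp)
      have a10 := hacc 10 (by simp)
      have g7 := hg 7 (by simp) (by simp)
      have g8 := hg 8 (by simp) (by simp)
      have g9 := hg 9 (by simp) (by simp)
      refine ⟨?t, ?s, ?exec, ?enc, ?frame⟩
      case exec =>
        refine .ite_ne hd <| .ite_ne hd' <| .andThen (.car _ hv₁) <| .andThen (.cdr _ (x := e₁) (y := c₁) ?_) <|
          .andThen (.car _ (x := e₂) (y := c₂) ?_) <| .andThen (.cdr _ (x := e₂) (y := c₂) ?_) <|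
          .andThen (.cons ..) <| .andThen (.cons ..) <| .cons ..
        all_goals simp [*]
      case enc =>
        rw [Function.update_self]
        refine .inr ⟨e₁, .cell e₂ (.cell c₂ c₁), M₁, N₁ ++ N₂ ++ M₂, by simp, he₁,
          .node he₂ hc₂ hc₁, ?_⟩
        -- The new order of the runs differs from concatenation, so the equation holds only for
        -- multisets.
        simp only [← Multiset.coe_add]
        abel
      case frame =>
        intro v hv hv'
        have a7 := hv' 7 (by simp)
        have a8 := hv' 8 (by simp)
        have a9 := hv' 9 (by simp)
        have a10 := hv' 10 (by simp)
        simp [*]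

theorem Cmd.loopFree_addBag (acc g : Var) : (Cmd.addBag acc g).LoopFree := by
  simp [Cmd.addBag, Cmd.LoopFree]

variable (lc fc)
variable (iS : St → ℕ) (tr : St → A → List (Option Λ × St)) (fin : St → List F)

/-- The runs that a transition contributes. -/
def stepRuns (p : Option Λ × St) (D : List A) : Multiset (List Λ × F) :=
  p.1.elim (layeredRuns tr fin p.2 D) fun l =>
    (layeredRuns tr fin p.2 D).map fun q => (l :: q.1, q.2)

/-- Add the contribution of a transition to the bag in `acc`. -/
def Cmd.addStep (acc : Var) : Option Λ × St → Cmd Var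
  | (none, s') => .addBag acc (.bag (iS s'))
  | (some l, s') => .ite (.bag (iS s')) 0 .skip <| .seq (.const .x₅ (lc l)) <|
      .seq (.cons .x₅ .x₅ (.bag (iS s'))) <| .seq (.cons .x₅ .x₅ .nil) <| .addBag acc .x₅

/-- The memory holds the bags of runs over the document `D` from every state. -/
def BagInv (σ : Var → Val) (D : List A) : Prop :=
  σ .nil = .atom 0 ∧ ∀ s, EncBag lc fc (σ (.bag (iS s))) (layeredRuns tr fin s D)

variable {lc fc iS tr fin}

theorem BagInv.congr {σ σ' : Var → Val} {D : List A} (h : BagInv lc fc iS tr fin σ D)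
    (h0 : σ' .nil = σ .nil) (hb : ∀ i, σ' (.bag i) = σ (.bag i)) :
    BagInv lc fc iS tr fin σ' D :=
  ⟨h0.trans h.1, fun s => by rw [hb]; exact h.2 s⟩

/-- A transition without label contributes the bag of its target unchanged, which is why it costs
nothing during the enumeration. A labelled one wraps this bag into a single event, but only if the
bag is nonempty, so that every event stands for at least one run. -/
theorem Exec.addStep {k : ℕ} {σ : Var → Val} {D : List A} (hσ : BagInv lc fc iS tr fin σ D)
    {M : Multiset (List Λ × F)} (hM : EncBag lc fc (σ (.newBag k)) M) (p : Option Λ × St)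
    (i : List ℤ) :
    ∃ t σ', Exec (.addStep lc iS (.newBag k) p) (σ, i) [] t (σ', i) ∧
      EncBag lc fc (σ' (.newBag k)) (M + stepRuns tr fin p D) ∧
      ∀ v, v ≠ .newBag k → (∀ i, 7 ≤ i → v ≠ .aux i) → σ' v = σ v := by
  obtain ⟨o, s⟩ := p
  cases o with
  | none => exact Exec.addBag (by simp) (by simp) hM (hσ.2 s) i
  | some l =>
    rcases hσ.2 s with ⟨h0, hr⟩ | ⟨e, c, N₁, N₂, hv, he, hc, hr⟩
    · refine ⟨_, σ, .ite_eq h0 (.skip _), ?_, fun _ _ _ => rfl⟩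
      simpa [stepRuns, hr] using hM
    · have hd : (σ (.bag (iS s))).Differs 0 := by rw [hv]; rfl
      let σ₃ := update (update (update σ .x₅ (.atom (lc l))) .x₅
        (.cell (.atom (lc l)) (.cell e c))) .x₅
        (.cell (.cell (.atom (lc l)) (.cell e c)) (.atom 0))
      obtain ⟨t, σ', ex, hb, hfr⟩ := Exec.addBag (lc := lc) (fc := fc) (acc := .newBag k)
        (g := .x₅) (σ := σ₃) (M := M) (N := stepRuns tr fin (some l, s) D) (by simp)
        (fun j _ hj => by simp; omega)
        (by simpa [σ₃] using hM) (.inr ⟨_, _, _, [], by simp [σ₃], .ev l he hc, .nil, by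
          simp [stepRuns, hr]⟩) i
      refine ⟨_, σ', .ite_ne hd (.andThen (.const ..) <| .andThen (.cons ..) <|
        .andThen (.cons ..) (?_ : Exec _ _ _ t _)), hb, fun v hv hv' => ?_⟩
      · convert ex using 2
        simp [σ₃, hv, hσ.1]
      · rw [hfr v hv hv']
        have := hv' 11 (by simp)
        simp [σ₃, this]

theorem Cmd.loopFree_addStep (acc : Var) (p : Option Λ × St) :
    (Cmd.addStep lc iS acc p).LoopFree := by
  obtain ⟨_ | l, s⟩ := p <;> simp [Cmd.addStep, Cmd.LoopFree, Cmd.loopFree_addBag]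

theorem Exec.addSteps {k : ℕ} {D : List A} (i : List ℤ) (l : List (Option Λ × St)) :
    ∀ {σ : Var → Val}, BagInv lc fc iS tr fin σ D →
    ∀ {M : Multiset (List Λ × F)}, EncBag lc fc (σ (.newBag k)) M →
    ∃ t σ', Exec (.seqs (l.map (.addStep lc iS (.newBag k)))) (σ, i) [] t (σ', i) ∧
      EncBag lc fc (σ' (.newBag k)) (M + (l.map fun p => stepRuns tr fin p D).sum) ∧
      ∀ v, v ≠ .newBag k → (∀ i, 7 ≤ i → v ≠ .aux i) → σ' v = σ v := by
  induction l with
  | nil => exact fun {σ} hσ M hM => ⟨_, σ, .skip _, by simpa using hM, fun _ _ _ => rfl⟩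
  | cons p l ih =>
    intro σ hσ M hM
    obtain ⟨t, σ₁, e₁, h₁, f₁⟩ := Exec.addStep hσ hM p i
    obtain ⟨t', σ₂, e₂, h₂, f₂⟩ := ih
      (hσ.congr (f₁ _ (by simp) (by simp; omega)) fun j => f₁ _ (by simp) (by simp)) h₁
    refine ⟨_, σ₂, .andThen e₁ e₂, by simpa [add_assoc] using h₂, fun v hv hv' => ?_⟩
    rw [f₂ v hv hv', f₁ v hv hv']

variable (lc iS tr) in
/-- Compute the bag of a state after a letter has been prepended to the document. -/
def Cmd.stateStep (a : A) (s : St) : Cmd Var :=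
  .seq (.const (.newBag (iS s)) 0) (.seqs ((tr s a).map (.addStep lc iS (.newBag (iS s)))))

theorem Exec.stateStep {σ : Var → Val} {D : List A} (hσ : BagInv lc fc iS tr fin σ D)
    (a : A) (s : St) (i : List ℤ) :
    ∃ t σ', Exec (.stateStep lc iS tr a s) (σ, i) [] t (σ', i) ∧
      EncBag lc fc (σ' (.newBag (iS s))) (layeredRuns tr fin s (a :: D)) ∧
      ∀ v, v ≠ .newBag (iS s) → (∀ i, 7 ≤ i → v ≠ .aux i) → σ' v = σ v := by
  obtain ⟨t, σ', e, h, f⟩ := Exec.addSteps (fc := fc) (fin := fin) (D := D) (k := iS s) i (tr s a)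
    (σ := update σ (.newBag (iS s)) (.atom 0)) (hσ.congr (by simp) (by simp)) (M := 0)
    (.inl ⟨by simp, rfl⟩)
  refine ⟨_, σ', .andThen (.const ..) e, ?_, fun v hv hv' => ?_⟩
  · simpa [layeredRuns, stepRuns] using h
  · rw [f v hv hv', update_of_ne hv]

/-- The results go to the variables `newBag`, because the bags for the shorter suffix are needed
until all states have been treated. Injectivity of `iS` keeps the results apart. -/
theorem Exec.stateSteps (hS : iS.Injective) {D : List A} (a : A) (i : List ℤ) (l : List St) :
    ∀ {σ : Var → Val}, BagInv lc fc iS tr fin σ D →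
    ∃ t σ', Exec (.seqs (l.map (.stateStep lc iS tr a))) (σ, i) [] t (σ', i) ∧
      (∀ s ∈ l, EncBag lc fc (σ' (.newBag (iS s))) (layeredRuns tr fin s (a :: D))) ∧
      ∀ v, (∀ s ∈ l, v ≠ .newBag (iS s)) → (∀ i, 7 ≤ i → v ≠ .aux i) → σ' v = σ v := by
  induction l with
  | nil => exact fun {σ} hσ => ⟨_, σ, .skip _, by simp, fun _ _ _ => rfl⟩
  | cons s l ih =>
    intro σ hσ
    obtain ⟨t, σ₁, e₁, h₁, f₁⟩ := Exec.stateStep hσ a s i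
    obtain ⟨t', σ₂, e₂, h₂, f₂⟩ := ih
      (hσ.congr (f₁ _ (by simp) (by simp; omega)) fun j => f₁ _ (by simp) (by simp))
    refine ⟨_, σ₂, .andThen e₁ e₂, fun s' hs' => ?_, fun v hv hv' => ?_⟩
    -- If the state occurs again, the later computation yields its bag; otherwise nothing overwrites
    -- it.
    · by_cases hl : s' ∈ l
      · exact h₂ s' hl
      · obtain rfl := (List.mem_cons.1 hs').resolve_right hl
        rw [f₂ _ (fun s hs e => hl (by rw [hS (Var.newBag.inj e)]; exact hs)) (by simp)]
        exact h₁
    · rw [f₂ v (fun s hs => hv s (by simp [hs])) hv', f₁ v (hv s (by simp)) hv']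

theorem Exec.moves (hS : iS.Injective) (i : List ℤ) (l : List St) : ∀ {σ : Var → Val},
    ∃ t σ', Exec (.seqs (l.map fun s => .move (.bag (iS s)) (.newBag (iS s)))) (σ, i) [] t (σ', i) ∧
      (∀ s ∈ l, σ' (.bag (iS s)) = σ (.newBag (iS s))) ∧
      ∀ v, (∀ s ∈ l, v ≠ .bag (iS s)) → σ' v = σ v := by
  induction l with
  | nil => exact fun {σ} => ⟨_, σ, .skip _, by simp, fun _ _ => rfl⟩
  | cons s l ih =>
    intro σ
    obtain ⟨t', σ₂, e₂, h₂, f₂⟩ := ih (σ := update σ (.bag (iS s)) (σ (.newBag (iS s))))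
    refine ⟨_, σ₂, .andThen (.move ..) e₂, fun s' hs' => ?_, fun v hv => ?_⟩
    · by_cases hl : s' ∈ l
      · rw [h₂ s' hl]; simp
      · obtain rfl := (List.mem_cons.1 hs').resolve_right hl
        rw [f₂ _ fun s hs e => hl (by rw [hS (Var.bag.inj e)]; exact hs)]
        simp
    · rw [f₂ v fun s hs => hv s (by simp [hs]), update_of_ne (hv s (by simp))]

variable [Fintype St]

variable (lc iS tr) in
/-- Compute the bags of all states after a letter has been prepended to the document. -/
noncomputable def Cmd.letterStep (a : A) : Cmd Var :=
  .seq (.seqs (Finset.univ.toList.map (.stateStep lc iS tr a)))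
    (.seqs (Finset.univ.toList.map fun s => .move (.bag (iS s)) (.newBag (iS s))))

theorem Exec.letterStep (hS : iS.Injective) {σ : Var → Val} {D : List A}
    (hσ : BagInv lc fc iS tr fin σ D) (a : A) (i : List ℤ) :
    ∃ t σ', Exec (.letterStep lc iS tr a) (σ, i) [] t (σ', i) ∧
      BagInv lc fc iS tr fin σ' (a :: D) ∧ ∀ j < 7, σ' (.aux j) = σ (.aux j) := by
  obtain ⟨t, σ₁, e₁, h₁, f₁⟩ := Exec.stateSteps hS a i Finset.univ.toList hσ
  obtain ⟨t', σ₂, e₂, h₂, f₂⟩ := Exec.moves hS i Finset.univ.toList (σ := σ₁)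
  have hf : ∀ j < 7, σ₂ (.aux j) = σ (.aux j) := fun j hj => by
    rw [f₂ _ (by simp), f₁ _ (by simp) (by simp; omega)]
  refine ⟨_, σ₂, .andThen e₁ e₂, ⟨(hf 0 (by simp)).trans hσ.1, fun s => ?_⟩, hf⟩
  rw [h₂ s (by simp)]
  exact h₁ s (by simp)

theorem Cmd.loopFree_letterStep (a : A) : (Cmd.letterStep lc iS tr a).LoopFree := by
  refine ⟨Cmd.loopFree_seqs ?_, Cmd.loopFree_seqs ?_⟩
  · simp only [List.mem_map]
    rintro c ⟨s, -, rfl⟩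
    refine ⟨trivial, Cmd.loopFree_seqs ?_⟩
    simp only [List.mem_map]
    rintro c ⟨p, -, rfl⟩
    exact Cmd.loopFree_addStep _ _
  · simp only [List.mem_map]
    rintro c ⟨s, -, rfl⟩
    trivial

/-! ### Preprocessing -/

variable (fc) in
/-- Add the run that ends immediately with a final symbol. -/
def Cmd.addFinal (acc : Var) (f : F) : Cmd Var :=
  .seq (.const .x₅ (fc f)) <| .seq (.cons .x₅ .nil .x₅) <| .seq (.cons .x₅ .x₅ .nil) <|
    .addBag acc .x₅

theorem Exec.addFinals {k : ℕ} (i : List ℤ) (l : List F) :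
    ∀ {σ : Var → Val}, σ .nil = .atom 0 →
    ∀ {M : Multiset (List Λ × F)}, EncBag lc fc (σ (.bag k)) M →
    ∃ t σ', Exec (.seqs (l.map (.addFinal fc (.bag k)))) (σ, i) [] t (σ', i) ∧
      EncBag lc fc (σ' (.bag k)) (M + (l.map fun f => (([] : List Λ), f) : List (List Λ × F))) ∧
      ∀ v, v ≠ .bag k → (∀ i, 7 ≤ i → v ≠ .aux i) → σ' v = σ v := by
  induction l with
  | nil => exact fun {σ} hσ M hM => ⟨_, σ, .skip _, by simpa using hM, fun _ _ _ => rfl⟩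
  | cons f l ih =>
    intro σ hσ M hM
    let σ₃ := update (update (update σ .x₅ (.atom (fc f))) .x₅
        (.cell (.atom 0) (.atom (fc f)))) .x₅
        (.cell (.cell (.atom 0) (.atom (fc f))) (.atom 0))
    obtain ⟨t, σ₁, e₁, h₁, f₁⟩ := Exec.addBag (lc := lc) (fc := fc) (acc := .bag k)
        (g := .x₅) (σ := σ₃) (M := M) (N := {([], f)}) (by simp)
        (fun j _ hj => by simp; omega)
        (by simpa [σ₃] using hM) (.inr ⟨_, _, _, [], by simp [σ₃], .leaf f, .nil, rfl⟩) i
    have hf : ∀ v, v ≠ .bag k → (∀ i, 7 ≤ i → v ≠ .aux i) → σ₁ v = σ v := fun v hv hv' => by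
      rw [f₁ v hv hv']
      have := hv' 11 (by simp)
      simp [σ₃, this]
    obtain ⟨t', σ₂, e₂, h₂, f₂⟩ := ih ((hf _ (by simp) (by simp; omega)).trans hσ) h₁
    refine ⟨_, σ₂, .andThen (.andThen (.const ..) <| .andThen (.cons ..) <|
        .andThen (.cons ..) (?_ : Exec _ _ _ t _)) e₂, ?_, fun v hv hv' => ?_⟩
    · convert e₁ using 2
      simp [σ₃, hσ]
    · convert h₂ using 1
      rw [add_assoc]; rfl
    · rw [f₂ v hv hv', hf v hv hv']

variable (fc iS fin) in
/-- Initialize the bag of a state for the empty document. -/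
def Cmd.stateFinal (s : St) : Cmd Var :=
  .seq (.const (.bag (iS s)) 0) (.seqs ((fin s).map (.addFinal fc (.bag (iS s)))))

omit [Fintype St] in
theorem Exec.stateFinals (hS : iS.Injective) (i : List ℤ) (l : List St) :
    ∀ {σ : Var → Val}, σ .nil = .atom 0 →
    ∃ t σ', Exec (.seqs (l.map (.stateFinal fc iS fin))) (σ, i) [] t (σ', i) ∧
      (∀ s ∈ l, EncBag lc fc (σ' (.bag (iS s))) (layeredRuns tr fin s [])) ∧
      ∀ v, (∀ s ∈ l, v ≠ .bag (iS s)) → (∀ i, 7 ≤ i → v ≠ .aux i) → σ' v = σ v := by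
  induction l with
  | nil => exact fun {σ} hσ => ⟨_, σ, .skip _, by simp, fun _ _ _ => rfl⟩
  | cons s l ih =>
    intro σ hσ
    obtain ⟨t, σ₁, e₁, h₁, f₁⟩ := Exec.addFinals (lc := lc) (fc := fc) (k := iS s) i (fin s)
      (σ := update σ (.bag (iS s)) (.atom 0)) (by simpa using hσ) (M := 0)
      (.inl ⟨by simp, rfl⟩)
    have hf : ∀ v, v ≠ .bag (iS s) → (∀ i, 7 ≤ i → v ≠ .aux i) → σ₁ v = σ v :=
      fun v hv hv' => by rw [f₁ v hv hv', update_of_ne hv]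
    obtain ⟨t', σ₂, e₂, h₂, f₂⟩ := ih ((hf _ (by simp) (by simp; omega)).trans hσ)
    refine ⟨_, σ₂, .andThen (.andThen (.const ..) e₁) e₂, fun s' hs' => ?_, fun v hv hv' => ?_⟩
    · by_cases hl : s' ∈ l
      · exact h₂ s' hl
      · obtain rfl := (List.mem_cons.1 hs').resolve_right hl
        rw [f₂ _ (fun s hs e => hl (by rw [hS (Var.bag.inj e)]; exact hs)) (by simp)]
        simpa [layeredRuns] using h₁
    · rw [f₂ v (fun s hs => hv s (by simp [hs])) hv', hf v (hv s (by simp)) hv']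

/-- The list with the given entries. -/
def Val.ofList : List Val → Val
  | [] => .atom 0
  | v :: l => .cell v (ofList l)

/-- Read the document to a stack. -/
def Cmd.readDoc : Cmd Var :=
  .seq (.read .tag) (.loop .tag (.seq (.cons .docu .tag .docu) (.read .tag)))

/-- Reading is one symbol ahead: the first symbol of `D` already sits in `tag`, which is why the
input is `D.tail`. At the end `headD` delivers the marker `0`, which differs from all letters and
stops the loop. -/
theorem Exec.readDoc_loop (D : List ℤ) (hD : ∀ z ∈ D, z ≠ 0) :
    ∀ {σ : Var → Val} {l : List ℤ}, σ .docu = .ofList (l.map .atom) → σ .tag = .atom (D.headD 0) →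
    ∃ t σ', Exec (.loop .tag (.seq (.cons .docu .tag .docu) (.read .tag))) (σ, D.tail) [] t
        (σ', []) ∧ t ≤ 3 * D.length + 1 ∧
      σ' .docu = .ofList ((D.reverse ++ l).map .atom) ∧
      ∀ v, v ≠ .docu → v ≠ .tag → σ' v = σ v := by
  induction D with
  | nil => exact fun {σ l} h h' => ⟨_, σ, .loop_done h', by simp, by simpa using h, fun _ _ _ => rfl⟩
  | cons z D ih =>
    intro σ l h h'
    obtain ⟨t, σ', e, ht, hd, hf⟩ := ih (fun z hz => hD z (by simp [hz]))
      (σ := update (update σ .docu (.cell (σ .tag) (σ .docu))) .tag (.atom (D.headD 0)))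
      (l := z :: l) (by simp [h, h', Val.ofList]) (by simp)
    refine ⟨_, σ', .loop_step ?_ (.andThen (.cons ..) (.read ..)) e, ?_, by simpa using hd, ?_⟩
    · simpa [h', Val.Differs] using hD z (by simp)
    · simp only [List.length_cons]; omega
    · intro v h₁ h₂
      rw [hf v h₁ h₂, update_of_ne h₂, update_of_ne h₁]

theorem Exec.readDoc (D : List ℤ) (hD : ∀ z ∈ D, z ≠ 0) :
    ∃ t σ, Exec .readDoc (fun _ => .atom 0, D) [] t (σ, []) ∧ t ≤ 3 * D.length + 2 ∧
      σ .docu = .ofList (D.reverse.map .atom) ∧ σ .nil = .atom 0 := by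
  obtain ⟨t, σ, e, ht, hd, hf⟩ := Exec.readDoc_loop D hD
    (σ := update (fun _ => .atom 0) .tag (.atom (D.headD 0))) (l := []) (by simp [Val.ofList])
    (by simp)
  refine ⟨_, σ, .andThen (.read ..) e, by omega, by simpa using hd, ?_⟩
  rw [hf _ (by simp) (by simp)]
  simp

variable [Fintype A] (codeA : A → ℤ)

variable (lc iS tr) in
/-- The loop that processes the document from its last letter to its first letter. -/
noncomputable def Cmd.docBody : Cmd Var :=
  .seq (.car .tag .docu) <| .seq (.cdr .docu .docu) <|
    .switch .tag codeA (.letterStep lc iS tr) Finset.univ.toList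

/-- The stack `docu` holds the document backwards, so each popped letter is prepended to the suffix
processed so far. The body is loop-free, which bounds the time per letter by a constant. -/
theorem Exec.docLoop (hS : iS.Injective) (hA : codeA.Injective) (l : List A) :
    ∀ {σ : Var → Val} {D : List A}, BagInv lc fc iS tr fin σ D →
    σ .docu = .ofList (l.map fun a => .atom (codeA a)) →
    ∃ t σ', Exec (.loop .docu (.docBody lc iS tr codeA)) (σ, []) [] t (σ', []) ∧
      t ≤ ((Cmd.docBody lc iS tr codeA).bound + 1) * l.length + 1 ∧
      BagInv lc fc iS tr fin σ' (l.reverse ++ D) := by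
  induction l with
  | nil => exact fun {σ D} hσ hd => ⟨_, σ, .loop_done hd, by simp, by simpa using hσ⟩
  | cons a l ih =>
    intro σ D hσ hd
    simp only [List.map_cons, Val.ofList] at hd
    let σ₁ := update (update σ .tag (.atom (codeA a))) .docu
      (.ofList (l.map fun a => .atom (codeA a)))
    obtain ⟨t, σ₂, e₂, h₂, f₂⟩ := Exec.letterStep hS (σ := σ₁) (D := D)
      (hσ.congr (by simp [σ₁]) (by simp [σ₁])) a []
    obtain ⟨t', e'⟩ := Exec.switch hA (Finset.mem_toList.2 (Finset.mem_univ a))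
      (c := .letterStep lc iS tr) (by simp [σ₁] : σ₁ .tag = _) e₂
    obtain ⟨t'', σ₃, e₃, ht, h₃⟩ := ih h₂ (by rw [f₂ 1 (by simp)]; simp [σ₁])
    have hbody : Exec (.docBody lc iS tr codeA) (σ, []) [] (1 + (1 + t')) (σ₂, []) :=
      .andThen (.car _ hd) (.andThen (.cdr _ (x := .atom (codeA a)) (by simpa using hd)) e')
    refine ⟨_, σ₃, .loop_step (show (σ .docu).Differs 0 by rw [hd]; rfl) hbody e₃, ?_, by simpa using h₃⟩
    have := hbody.le_bound ⟨trivial, trivial, Cmd.loopFree_switch Cmd.loopFree_letterStep⟩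
    rw [List.length_cons, mul_add]
    omega

variable (lc fc iS tr fin) in
/-- The preprocessing. -/
noncomputable def Cmd.preprocess : Cmd Var :=
  .seq .readDoc <| .seq (.seqs (Finset.univ.toList.map (.stateFinal fc iS fin))) <|
    .loop .docu (.docBody lc iS tr codeA)

theorem Exec.preprocess (hS : iS.Injective) (hA : codeA.Injective) (hA0 : ∀ a, codeA a ≠ 0) :
    ∃ k, ∀ D : List A, ∃ t σ,
      Exec (.preprocess lc fc iS tr fin codeA) (fun _ => .atom 0, D.map codeA) [] t (σ, []) ∧
      t ≤ k * (D.length + 1) ∧ BagInv lc fc iS tr fin σ D := by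
  -- Per letter, three units for reading it and the bound of the loop body plus one for processing
  -- it; the last summand pays for the bags of the empty document.
  refine ⟨(Cmd.docBody lc iS tr codeA).bound + 1 + 3 +
    (Cmd.seqs (Finset.univ.toList.map (Cmd.stateFinal fc iS fin))).bound, fun D => ?_⟩
  obtain ⟨t₁, σ₁, e₁, ht₁, hd, h0⟩ := Exec.readDoc (D.map codeA) (by simp [hA0])
  obtain ⟨t₂, σ₂, e₂, h₂, f₂⟩ := Exec.stateFinals (lc := lc) (fc := fc) (tr := tr) (fin := fin)
    hS [] Finset.univ.toList h0
  obtain ⟨t₃, σ₃, e₃, ht₃, h₃⟩ := Exec.docLoop (lc := lc) (tr := tr) codeA hS hA D.reverse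
    (σ := σ₂) (D := []) ⟨(f₂ _ (by simp) (by simp; omega)).trans h0, fun s => h₂ s (by simp)⟩
    (by rw [f₂ _ (by simp) (by simp; omega), hd]; simp [← List.map_reverse, Function.comp_def])
  refine ⟨_, σ₃, .andThen e₁ (.andThen e₂ e₃), ?_, by simpa using h₃⟩
  have hb := e₂.le_bound (Cmd.loopFree_seqs (by
    simp only [List.mem_map]
    rintro c ⟨s, -, rfl⟩
    refine ⟨trivial, Cmd.loopFree_seqs ?_⟩
    simp only [List.mem_map]
    rintro c ⟨p, -, rfl⟩
    simp [Cmd.addFinal, Cmd.LoopFree, Cmd.loopFree_addBag]))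
  simp only [List.length_map, List.length_reverse] at ht₁ ht₃
  generalize (Cmd.docBody lc iS tr codeA).bound = b at *
  generalize (Cmd.seqs (Finset.univ.toList.map (Cmd.stateFinal fc iS fin))).bound = b' at *
  have : b' ≤ b' * (D.length + 1) := Nat.le_mul_of_pos_right _ (by omega)
  have : (b + 1 + 3 + b') * (D.length + 1) =
    (b + 1) * D.length + (b + 1) + 3 * (D.length + 1) + b' * (D.length + 1) := by ring
  omega

end Layered
end ET

namespace ET
open Function (update update_of_ne)

/-! ### Enumeration -/

section Enumeration

variable {A O St Λ F R : Type*} {lc : Λ → ℤ} {fc : F → ℤ}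

/-! ### Expansion of registers through a history, and the stack of pending alternatives. -/

/-- The registers that occur in a string of registers and letters. -/
def regs (s : List (R ⊕ O)) : List R := s.filterMap Sum.getLeft?

@[simp] theorem regs_nil : regs ([] : List (R ⊕ O)) = [] := rfl

@[simp] theorem regs_cons_inl (r : R) (s : List (R ⊕ O)) :
    regs (Sum.inl r :: s) = r :: regs s := rfl

@[simp] theorem regs_cons_inr (o : O) (s : List (R ⊕ O)) : regs (Sum.inr o :: s) = regs s := rfl

@[simp] theorem regs_append (s s' : List (R ⊕ O)) : regs (s ++ s') = regs s ++ regs s' :=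
  List.filterMap_append

open Classical in
/-- Every register occurs at most once in all the strings of a total assignment together. -/
def CopylessTotal [Fintype R] (σ : R → List (R ⊕ O)) : Prop :=
  ∀ r, ∑ r', (regs (σ r')).count r ≤ 1

/-- The word that a register stands for, given the history of assignments, last one first. -/
def expand (τ : Λ → R → List (R ⊕ O)) : List Λ → R → List O
  | [], _ => []
  | l :: h, r => (τ l r).flatMap (Sum.elim (expand τ h) fun o => [o])

/-- The word that a string of registers and letters stands for. -/
def expandAll (τ : Λ → R → List (R ⊕ O)) (h : List Λ) (s : List (R ⊕ O)) : List O :=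
  s.flatMap (Sum.elim (expand τ h) fun o => [o])

/-- The number of symbols to be processed in order to expand a register. -/
def expandCost (τ : Λ → R → List (R ⊕ O)) : List Λ → R → ℕ
  | [], _ => 1
  | l :: h, r => 1 + ((τ l r).map (Sum.elim (expandCost τ h) fun _ => 1)).sum

variable (lc) in
/-- The value that represents a history. -/
def Val.ofHist (h : List Λ) : Val := .ofList (h.map fun l => .atom (lc l))

/-- The representation of the stack of pending alternatives, with the outputs to come. -/
inductive EncStack (lc : Λ → ℤ) (fc : F → ℤ) : Val → List (List Λ × F) → Prop
  | nil : EncStack lc fc (.atom 0) []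
  | cons {f v : Val} {M L : List (List Λ × F)} (h : List Λ) (hf : Enc lc fc false f M)
      (hd : f.Differs 0) (hv : EncStack lc fc v L) :
      EncStack lc fc (.cell (.cell f (.ofHist lc h)) v)
        (M.map (fun q => (q.1.reverse ++ h, q.2)) ++ L)

/-- The absence of dead ends: whenever the traversal enters an event, some run will be output. -/
theorem Enc.ne_nil {v : Val} {M : List (List Λ × F)} {b : Bool} (h : Enc lc fc b v M)
    (hb : b = true) : M ≠ [] := by
  induction h with
  | leaf => simp
  | ev l he hc ihe _ => simp [ihe rfl]
  | nil => simp at hb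
  | node => simp at hb

theorem Enc.ne_nil_of_differs {v : Val} {M : List (List Λ × F)} (h : Enc lc fc false v M)
    (hd : v.Differs 0) : M ≠ [] := by
  cases h with
  | nil => exact absurd rfl hd
  | node he _ _ => simp [he.ne_nil rfl]

theorem Enc.differs_or {v : Val} {M : List (List Λ × F)} (h : Enc lc fc false v M) :
    (v = .atom 0 ∧ M = []) ∨ v.Differs 0 := by
  cases h with
  | nil => exact .inl ⟨rfl, rfl⟩
  | node he _ _ => exact .inr rfl

/-- Push the pending forest in `a`. -/
def Cmd.push (a : Var) : Cmd Var :=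
  .ite a 0 .skip (.seq (.cons a a .hist) (.cons .stack a .stack))

/-- Empty forests are not pushed, so a pop always leads to an output. The history is stored by
reference, hence pushing takes constant time. -/
theorem Exec.push {j : ℕ} (hj : 7 ≤ j) {σ : Var → Val} {M L : List (List Λ × F)} {h : List Λ}
    (hM : Enc lc fc false (σ (.aux j)) M) (hL : EncStack lc fc (σ .stack) L)
    (hh : σ .hist = .ofHist lc h) (i : List ℤ) :
    ∃ t σ', Exec (.push (.aux j)) (σ, i) [] t (σ', i) ∧
      EncStack lc fc (σ' .stack) (M.map (fun q => (q.1.reverse ++ h, q.2)) ++ L) ∧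
      ∀ v, v ≠ .stack → v ≠ .aux j → σ' v = σ v := by
  rcases hM.differs_or with ⟨h0, rfl⟩ | hd
  · exact ⟨_, σ, .ite_eq h0 (.skip _), by simpa using hL, fun _ _ _ => rfl⟩
  · refine ⟨_, _, .ite_ne hd (.andThen (.cons ..) (.cons ..)), ?_, fun v hv hv' => by simp [hv, hv']⟩
    have : j ≠ 2 := by omega
    simp [this.symm, hh]
    exact .cons h hM hd hL

/-- The body of the loop that descends to the end of a run. -/
def Cmd.descendBody : Cmd Var :=
  .seq (.cons .hist .tag .hist) <| .seq (.cdr .event .event) <| .seq (.cdr .x₁ .event) <|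
    .seq (.car .event .event) <| .seq (.push .x₁) <| .car .tag .event

theorem Cmd.loopFree_descendBody : Cmd.descendBody.LoopFree := by
  simp [Cmd.descendBody, Cmd.push, Cmd.LoopFree]

/-- Each event moves one label to the history, postpones its forest `c` together with the history
reached, and continues with its event `e`. The tag `0` marks a leaf. Only labels are visited, so the
time is linear in `ls.length` and independent of the document. -/
theorem Exec.descend (hlc : ∀ l, lc l ≠ 0) {b : Bool} {e : Val} {M : List (List Λ × F)}
    (he : Enc lc fc b e M) (hb : b = true) :
    ∀ {σ : Var → Val} {L : List (List Λ × F)} {h : List Λ},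
    σ .event = e → (∀ x y, e = .cell x y → σ .tag = x) → EncStack lc fc (σ .stack) L →
    σ .hist = .ofHist lc h →
    ∃ t σ' ls f M', M = (ls, f) :: M' ∧
      Exec (.loop .tag .descendBody) (σ, []) [] t (σ', []) ∧
      t ≤ (Cmd.descendBody.bound + 1) * ls.length + 1 ∧
      σ' .event = .cell (.atom 0) (.atom (fc f)) ∧ σ' .hist = .ofHist lc (ls.reverse ++ h) ∧
      EncStack lc fc (σ' .stack) (M'.map (fun q => (q.1.reverse ++ h, q.2)) ++ L) ∧
      σ' .nil = σ .nil := by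
  induction he with
  | leaf f =>
    intro σ L h hev htag hst hh
    exact ⟨_, σ, [], f, [], rfl, .loop_done (htag _ _ rfl), by simp, hev, by simpa using hh,
      by simpa using hst, rfl⟩
  | ev l he hc ihe ihc =>
    rename_i e c M N
    intro σ L h hev htag hst hh
    have htag := htag _ _ rfl
    let σ₁ := update (update (update (update σ .hist (.ofHist lc (l :: h))) .event (.cell e c))
      .x₁ c) .event e
    obtain ⟨t₂, σ₂, e₂, h₂, f₂⟩ := Exec.push (lc := lc) (fc := fc) (j := 7) le_rfl (σ := σ₁)
      (M := N) (L := L) (h := l :: h) (by simpa [σ₁] using hc) (by simpa [σ₁] using hst)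
      (by simp [σ₁]) []
    have hev₂ : σ₂ .event = e := by rw [f₂ _ (by simp) (by simp)]; simp [σ₁]
    obtain ⟨x, y, hxy⟩ : ∃ x y, e = .cell x y := by cases he <;> exact ⟨_, _, rfl⟩
    obtain ⟨t₃, σ₃, ls, f, M', hM', e₃, ht₃, h₃, h₃', h₃'', h₃n⟩ := ihe rfl
      (σ := update σ₂ .tag x) (L := N.map (fun q => (q.1.reverse ++ (l :: h), q.2)) ++ L)
      (h := l :: h) (by simpa using hev₂)
      (by rintro x' y' rfl; simp only [Val.cell.injEq] at hxy; simp [hxy.1])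
      (by simpa using h₂) (by rw [update_of_ne (by simp), f₂ _ (by simp) (by simp)]; simp [σ₁])
    obtain ⟨t, hbody⟩ : ∃ t, Exec .descendBody (σ, []) [] t (update σ₂ .tag x, []) := by
      refine ⟨_, .andThen (.cons ..) <| .andThen (.cdr _ (x := .atom (lc l)) (y := .cell e c)
        (by simpa using hev)) <| .andThen (.cdr _ (x := e) (y := c) (by simp)) <|
        .andThen (.car _ (x := e) (y := c) (by simp)) <| .andThen (?_ : Exec _ _ _ t₂ _)
        (.car _ (x := x) (y := y) (by rw [hev₂, hxy]))⟩
      convert e₂ using 2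
      simp [σ₁, htag, hh, Val.ofHist, Val.ofList]
    refine ⟨_, σ₃, l :: ls, f, (M' ++ N).map fun q => (l :: q.1, q.2), ?_,
      .loop_step (show (σ .tag).Differs 0 by rw [htag]; exact hlc l) hbody e₃, ?_, h₃, ?_, ?_, ?_⟩
    · simp [hM']
    · have := hbody.le_bound Cmd.loopFree_descendBody
      rw [List.length_cons, mul_add]
      omega
    · simpa using h₃'
    · simpa [Function.comp_def] using h₃''
    · rw [h₃n, update_of_ne (by simp), f₂ _ (by simp) (by simp)]; simp [σ₁]
  | nil => simp at hb
  | node => simp at hb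

/-! #### Writing the output of a run -/

variable (rc : R → ℤ) (codeO : O → ℤ) (τ : Λ → R → List (R ⊕ O))

variable (lc) in
/-- The value that represents a symbol to be processed, together with a history. -/
def Val.ofItem : (R ⊕ O) × List Λ → Val
  | (.inl r, h) => .cell (.atom (rc r)) (.ofHist lc h)
  | (.inr o, _) => .cell (.atom 0) (.atom (codeO o))

variable (lc) in
/-- The value that represents a stack of symbols to be processed. -/
def Val.ofItems (l : List ((R ⊕ O) × List Λ)) : Val := .ofList (l.map (.ofItem lc rc codeO))

/-- Push a symbol on the stack of symbols to be processed, with the history in `h`. -/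
def Cmd.pushSym (h : Var) : R ⊕ O → Cmd Var
  | .inl r => .seq (.const .x₂ (rc r)) <| .seq (.cons .x₂ .x₂ h) <| .cons .todo .x₂ .todo
  | .inr o => .seq (.const .x₂ (codeO o)) <| .seq (.cons .x₂ .nil .x₂) <| .cons .todo .x₂ .todo

/-- The last symbol ends up on top, so strings are pushed in reversed form. The history variable
must be neither `todo` nor the scratch variable `x₂`. -/
theorem Exec.pushSyms {k : ℕ} (hk6 : k ≠ 6) (hk8 : k ≠ 8) {h : List Λ} (i : List ℤ)
    (s : List (R ⊕ O)) :
    ∀ {σ : Var → Val} {l : List ((R ⊕ O) × List Λ)}, σ .nil = .atom 0 →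
    σ (.aux k) = .ofHist lc h → σ .todo = .ofItems lc rc codeO l →
    ∃ t σ', Exec (.seqs (s.map (.pushSym rc codeO (.aux k)))) (σ, i) [] t (σ', i) ∧
      σ' .todo = .ofItems lc rc codeO ((s.reverse.map fun x => (x, h)) ++ l) ∧
      ∀ v, v ≠ .todo → v ≠ .x₂ → σ' v = σ v := by
  induction s with
  | nil => exact fun {σ l} _ _ hl => ⟨_, σ, .skip _, by simpa using hl, fun _ _ _ => rfl⟩
  | cons x s ih =>
    intro σ l h0 hh hl
    obtain ⟨t, σ₁, e₁, h₁, f₁⟩ : ∃ t σ', Exec (.pushSym rc codeO (.aux k) x) (σ, i) [] t (σ', i) ∧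
        σ' .todo = .ofItems lc rc codeO ((x, h) :: l) ∧
        ∀ v, v ≠ .todo → v ≠ .x₂ → σ' v = σ v := by
      cases x with
      | inl r =>
        refine ⟨_, _, .andThen (.const ..) <| .andThen (.cons ..) <| .cons .., ?_,
          fun v h₁ h₂ => by simp [h₁, h₂]⟩
        simp [hk6, hk8, hh, hl, Val.ofItems, Val.ofItem, Val.ofList]
      | inr o =>
        refine ⟨_, _, .andThen (.const ..) <| .andThen (.cons ..) <| .cons .., ?_,
          fun v h₁ h₂ => by simp [h₁, h₂]⟩
        simp [h0, hh, hl, Val.ofItems, Val.ofItem, Val.ofList]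
    obtain ⟨t', σ₂, e₂, h₂, f₂⟩ := ih ((f₁ _ (by simp) (by simp)).trans h0)
      ((f₁ _ (by simp [hk6]) (by simp [hk8])).trans hh) h₁
    refine ⟨_, σ₂, .andThen e₁ e₂, by simpa using h₂, fun v h₁ h₂ => ?_⟩
    rw [f₂ v h₁ h₂, f₁ v h₁ h₂]

theorem Cmd.loopFree_pushSyms {h : Var} {s : List (R ⊕ O)} :
    (Cmd.seqs (s.map (.pushSym rc codeO h))).LoopFree := by
  refine Cmd.loopFree_seqs ?_
  simp only [List.mem_map]
  rintro c ⟨x, -, rfl⟩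
  cases x <;> simp [Cmd.pushSym, Cmd.LoopFree]

variable [Fintype Λ] [Fintype R]

variable (lc) in
/-- The loop that writes the output of a run. -/
noncomputable def Cmd.writeBody : Cmd Var :=
  .seq (.car .x₃ .todo) <| .seq (.cdr .todo .todo) <| .seq (.car .tag .x₃) <|
    .seq (.cdr .x₃ .x₃) <| .ite .tag 0 (.write .x₃) <| .ite .x₃ 0 .skip <|
    .seq (.car .x₄ .x₃) <| .seq (.cdr .x₃ .x₃) <|
    .switch .tag rc (fun r => .switch .x₄ lc
      (fun l => .seqs ((τ l r).reverse.map (.pushSym rc codeO .x₃))) Finset.univ.toList)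
      Finset.univ.toList

theorem Cmd.loopFree_writeBody : (Cmd.writeBody lc rc codeO τ).LoopFree := by
  refine ⟨trivial, trivial, trivial, trivial, trivial, trivial, trivial, trivial, ?_⟩
  exact Cmd.loopFree_switch fun r => Cmd.loopFree_switch fun l => Cmd.loopFree_pushSyms _ _

/-- The output of a stack of symbols. -/
def itemsWord (l : List ((R ⊕ O) × List Λ)) : List O :=
  l.flatMap fun p => Sum.elim (expand τ p.2) (fun o => [o]) p.1

/-- The number of symbols to be processed for a stack of symbols. -/
def itemsCost (l : List ((R ⊕ O) × List Λ)) : ℕ :=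
  (l.map fun p => Sum.elim (expandCost τ p.2) (fun _ => 1) p.1).sum

/-- One round processes one symbol and lowers the cost by exactly one: a letter is written, a
register with empty history disappears, and any other register is replaced by its string under the
latest assignment, paired with the shorter history. -/
theorem Exec.writeBody (hlc : lc.Injective) (hrc : rc.Injective) (hrc0 : ∀ r, rc r ≠ 0)
    {σ : Var → Val} {p : (R ⊕ O) × List Λ} {l : List ((R ⊕ O) × List Λ)}
    (h0 : σ .nil = .atom 0) (hl : σ .todo = .ofItems lc rc codeO (p :: l)) :
    ∃ t σ' l' w, Exec (.writeBody lc rc codeO τ) (σ, []) (w.map codeO) t (σ', []) ∧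
      σ' .todo = .ofItems lc rc codeO l' ∧ itemsCost τ (p :: l) = itemsCost τ l' + 1 ∧
      itemsWord τ (p :: l) = w ++ itemsWord τ l' ∧ σ' .nil = .atom 0 ∧ σ' .stack = σ .stack := by
  obtain ⟨x, h⟩ := p
  rw [Val.ofItems, List.map_cons, Val.ofList] at hl
  cases x with
  | inr o =>
    have hx : Val.ofItem lc rc codeO (Sum.inr o, h) = .cell (.atom 0) (.atom (codeO o)) := rfl
    refine ⟨_, _, l, [o], .andThen (.car _ hl) <| .andThen (.cdr _ (y := .ofItems lc rc codeO l)
      (x := Val.ofItem lc rc codeO (Sum.inr o, h)) ?_) <|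
      .andThen (.car _ (x := .atom 0) (y := .atom (codeO o)) ?_) <|
      .andThen (.cdr _ (x := .atom 0) (y := .atom (codeO o)) ?_) <|
      .ite_eq ?_ <| .write _ ?_, ?_⟩
    all_goals simp [hl, hx, Val.ofItems, itemsCost, itemsWord, h0]
    omega
  | inl r =>
    have hx : Val.ofItem lc rc codeO (Sum.inl r, h) = .cell (.atom (rc r)) (.ofHist lc h) := rfl
    let σ₁ := update (update (update (update σ .x₃ (Val.ofItem lc rc codeO (Sum.inl r, h))) .todo
      (.ofItems lc rc codeO l)) .tag (.atom (rc r))) .x₃ (.ofHist lc h)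
    have e₁ : ∀ {c : Cmd Var} {t : ℕ} {s : CState Var}, Exec c (σ₁, []) [] t s →
        Exec (.seq (.car .x₃ .todo) <| .seq (.cdr .todo .todo) <| .seq (.car .tag .x₃) <|
          .seq (.cdr .x₃ .x₃) <| .ite .tag 0 (.write .x₃) c) (σ, []) []
          (1 + (1 + (1 + (1 + (t + 1))))) s := by
      intro c t s hc
      refine .andThen (.car _ hl) <| .andThen (.cdr _ (y := .ofItems lc rc codeO l)
        (x := Val.ofItem lc rc codeO (Sum.inl r, h)) ?_) <|
        .andThen (.car _ (x := .atom (rc r)) (y := .ofHist lc h) ?_) <|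
        .andThen (.cdr _ (x := .atom (rc r)) (y := .ofHist lc h) ?_) <| .ite_ne ?_ hc
      all_goals simp [hl, hx, Val.ofItems, Val.Differs, hrc0]
    cases h with
    | nil =>
      refine ⟨_, σ₁, l, [], e₁ (.ite_eq (by simp [σ₁, Val.ofHist, Val.ofList]) (.skip _)),
        by simp [σ₁], ?_, ?_, by simp [σ₁, h0], by simp [σ₁]⟩
      · simp [itemsCost, expandCost, add_comm]
      · simp [itemsWord, expand]
    | cons b h =>
      have hx3 : σ₁ .x₃ = .cell (.atom (lc b)) (.ofHist lc h) := by
        simp [σ₁, Val.ofHist, Val.ofList]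
      obtain ⟨t, σ₂, e₂, h₂, f₂⟩ := Exec.pushSyms (lc := lc) rc codeO (k := 9) (by simp) (by simp)
        (h := h) [] (τ b r).reverse
        (σ := update (update σ₁ .x₄ (.atom (lc b))) .x₃ (.ofHist lc h)) (l := l)
        (by simp [σ₁, h0]) (by simp) (by simp [σ₁])
      obtain ⟨t', e₃⟩ := Exec.switch hlc (Finset.mem_toList.2 (Finset.mem_univ b)) (a := .x₄)
        (c := fun b => .seqs ((τ b r).reverse.map (.pushSym rc codeO .x₃))) (by simp) e₂
      obtain ⟨t'', e₄⟩ := Exec.switch hrc (Finset.mem_toList.2 (Finset.mem_univ r)) (a := .tag)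
        (c := fun r => .switch .x₄ lc
          (fun l => .seqs ((τ l r).reverse.map (.pushSym rc codeO .x₃))) Finset.univ.toList)
        (by simp [σ₁]) e₃
      refine ⟨_, σ₂, (τ b r).map (fun x => (x, h)) ++ l, [],
        e₁ <| .ite_ne (show (σ₁ .x₃).Differs 0 by rw [hx3]; rfl) <|
        .andThen (.car _ hx3) <|
        .andThen (.cdr _ (x := .atom (lc b)) (y := .ofHist lc h) (by simp [hx3])) e₄,
        by simpa using h₂, ?_, ?_, ?_, ?_⟩
      · simp only [itemsCost, List.map_cons, List.sum_cons, Sum.elim_inl, expandCost,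
          List.map_append, List.map_map, List.sum_append]
        change _ = ((τ b r).map (Sum.elim (expandCost τ h) fun _ => 1)).sum + _ + 1
        omega
      · simp [itemsWord, expand, List.flatMap_map]
      · rw [f₂ _ (by simp) (by simp)]; simp [σ₁, h0]
      · rw [f₂ _ (by simp) (by simp)]; simp [σ₁]

theorem Exec.writeLoop (hlc : lc.Injective) (hrc : rc.Injective) (hrc0 : ∀ r, rc r ≠ 0) (n : ℕ) :
    ∀ {σ : Var → Val} {l : List ((R ⊕ O) × List Λ)}, itemsCost τ l = n → σ .nil = .atom 0 →
    σ .todo = .ofItems lc rc codeO l →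
    ∃ t σ', Exec (.loop .todo (.writeBody lc rc codeO τ)) (σ, []) ((itemsWord τ l).map codeO) t
        (σ', []) ∧ t ≤ ((Cmd.writeBody lc rc codeO τ).bound + 1) * n + 1 ∧
      σ' .nil = .atom 0 ∧ σ' .stack = σ .stack := by
  induction n with
  | zero => 
    intro σ l hc h0 hl
    cases l with
    | nil => exact ⟨_, σ, .loop_done hl, by simp, h0, rfl⟩
    | cons p l =>
      obtain ⟨_, _, l', _, -, -, h, -⟩ := Exec.writeBody rc codeO τ hlc hrc hrc0 h0 hl
      omega
  | succ n ih =>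
    intro σ l hc h0 hl
    cases l with
    | nil => simp [itemsCost] at hc
    | cons p l =>
      obtain ⟨t, σ₁, l', w, e, hl', hcost, hw, h0', hst⟩ :=
        Exec.writeBody rc codeO τ hlc hrc hrc0 h0 hl
      obtain ⟨t', σ₂, e', ht', h0'', hst'⟩ := ih (by omega) h0' hl'
      rw [hw, List.map_append]
      have hd : (σ .todo).Differs 0 := by
        rw [hl]; simp only [Val.ofItems, List.map_cons, Val.ofList, Val.Differs]
      refine ⟨_, σ₂, .loop_step hd e e', ?_, h0'', hst'.trans hst⟩
      · have := e.le_bound (Cmd.loopFree_writeBody rc codeO τ)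
        rw [mul_add]; omega

-- Copylessness enters here. The induction works for the sum over all registers: the strings of `τ
-- l` together use each register at most once, so a label raises the total by at most the number of
-- registers plus the total length of these strings. For a single register the bound would not be
-- inductive.
omit [Fintype Λ] in
theorem expandCost_le [Finite Λ] (hτ : ∀ l, CopylessTotal (τ l)) :
    ∃ C, ∀ h : List Λ, ∑ r, expandCost τ h r ≤ C * (h.length + 1) := by
  classical
  have : Fintype Λ := Fintype.ofFinite Λ
  refine ⟨Fintype.card R + ∑ l, ∑ r, (τ l r).length, fun h => ?_⟩
  induction h with
  | nil => simp [expandCost]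
  | cons l h ih =>
    -- The number of occurrences of each register is made explicit, so that the copyless bound can
    -- be applied after exchanging the sums.
    have hs : ∀ s : List (R ⊕ O), (s.map (Sum.elim (expandCost τ h) fun _ => 1)).sum ≤
        s.length + ∑ r', (regs s).count r' * expandCost τ h r' := by
      intro s
      induction s with
      | nil => simp
      | cons x s ihs =>
        cases x with
        | inl r =>
          simp only [List.map_cons, List.sum_cons, Sum.elim_inl, List.length_cons,
            regs_cons_inl, List.count_cons, beq_iff_eq, add_mul, Finset.sum_add_distrib, ite_mul,
            one_mul, zero_mul, Finset.sum_ite_eq, Finset.mem_univ, if_true]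
          omega
        | inr o =>
          simp only [List.map_cons, List.sum_cons, Sum.elim_inr, List.length_cons,
            regs_cons_inr]
          omega
    calc ∑ r, expandCost τ (l :: h) r
        ≤ ∑ r, (1 + ((τ l r).length + ∑ r', (regs (τ l r)).count r' * expandCost τ h r')) :=
          Finset.sum_le_sum fun r _ => Nat.add_le_add_left (hs _) 1
      _ = Fintype.card R + ∑ r, (τ l r).length +
          ∑ r', (∑ r, (regs (τ l r)).count r') * expandCost τ h r' := by
          simp only [Finset.sum_add_distrib, Finset.sum_mul]
          rw [Finset.sum_comm (f := fun r r' => (regs (τ l r)).count r' * expandCost τ h r')]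
          simp [add_assoc]
      _ ≤ Fintype.card R + ∑ l, ∑ r, (τ l r).length + ∑ r', expandCost τ h r' := by
          refine Nat.add_le_add (Nat.add_le_add_left (Finset.single_le_sum
            (f := fun l => ∑ r, (τ l r).length) (fun _ _ => Nat.zero_le _)
            (Finset.mem_univ l)) _) (Finset.sum_le_sum fun r' _ => ?_)
          calc _ ≤ 1 * expandCost τ h r' := Nat.mul_le_mul_right _ (hτ l r')
            _ = _ := one_mul _
      _ ≤ _ := by
        rw [List.length_cons, mul_add _ (h.length + 1)]
        omega

end Enumeration
end ET

namespace ET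
open Function (update update_of_ne)

/-! ### The main loop: one output per round. -/

section MainLoop

variable {A O St Λ F R : Type*} {lc : Λ → ℤ} {fc : F → ℤ}
  (rc : R → ℤ) (codeO : O → ℤ) (τ : Λ → R → List (R ⊕ O)) (φ : F → List (R ⊕ O))

/-- Pop a pending forest and push its two parts. -/
def Cmd.popForest : Cmd Var :=
  .seq (.car .x₁ .stack) <| .seq (.cdr .stack .stack) <| .seq (.cdr .hist .x₁) <|
  .seq (.car .x₁ .x₁) <| .seq (.car .event .x₁) <| .seq (.cdr .x₁ .x₁) <|
  .seq (.cdr .x₂ .x₁) <| .seq (.car .x₁ .x₁) <| .seq (.push .x₂) <| .seq (.push .x₁) <|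
  .car .tag .event

theorem Cmd.loopFree_popForest : Cmd.popForest.LoopFree := by
  simp [Cmd.popForest, Cmd.push, Cmd.LoopFree]

/-- A nonempty forest consists of an event and two forests. The event becomes the current one; the
two forests return to the stack with the same history, the second one below the first, so that the
order of outputs is that of `EncStack`. -/
theorem Exec.popForest {σ : Var → Val} {L : List (List Λ × F)}
    (hst : EncStack lc fc (σ .stack) L) (hL : L ≠ []) :
    ∃ t σ' e M h L', L = M.map (fun q => (q.1.reverse ++ h, q.2)) ++ L' ∧
      Exec .popForest (σ, []) [] t (σ', []) ∧ Enc lc fc true e M ∧ σ' .event = e ∧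
      (∀ x y, e = .cell x y → σ' .tag = x) ∧ σ' .hist = .ofHist lc h ∧
      EncStack lc fc (σ' .stack) L' ∧ σ' .nil = σ .nil := by
  generalize hv : σ .stack = v at hst
  cases hst with
  | nil => exact absurd rfl hL
  | cons h hf hd hst =>
    rename_i f v M L
    cases hf with
    | nil => exact absurd rfl hd
    | node he hc hs =>
      rename_i e c s M N K
      obtain ⟨x, y, hxy⟩ : ∃ x y, e = .cell x y := by cases he <;> exact ⟨_, _, rfl⟩
      let σ₁ := update (update (update (update (update (update (update (update σ
        .x₁ (.cell (.cell e (.cell c s)) (.ofHist lc h))) .stack v) .hist (.ofHist lc h))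
        .x₁ (.cell e (.cell c s))) .event e) .x₁ (.cell c s)) .x₂ s) .x₁ c
      obtain ⟨t₂, σ₂, e₂, h₂, f₂⟩ := Exec.push (lc := lc) (fc := fc) (j := 8) (by simp) (σ := σ₁)
        (M := K) (L := L) (h := h) (by simpa [σ₁] using hs) (by simpa [σ₁] using hst)
        (by simp [σ₁]) []
      obtain ⟨t₃, σ₃, e₃, h₃, f₃⟩ := Exec.push (lc := lc) (fc := fc) (j := 7) (by simp) (σ := σ₂)
        (M := N) (h := h) (by rw [f₂ _ (by simp) (by simp)]; simpa [σ₁] using hc) h₂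
        (by rw [f₂ _ (by simp) (by simp)]; simp [σ₁]) []
      have hev₃ : σ₃ .event = e := by
        rw [f₃ _ (by simp) (by simp), f₂ _ (by simp) (by simp)]; simp [σ₁]
      refine ⟨_, update σ₃ .tag x, e, M, h, N.map (fun q => (q.1.reverse ++ h, q.2)) ++
        (K.map (fun q => (q.1.reverse ++ h, q.2)) ++ L), by simp,
        .andThen (.car (y := v) (x := .cell (.cell e (.cell c s)) (.ofHist lc h)) _ hv) <|
        .andThen (.cdr (y := v) (x := .cell (.cell e (.cell c s)) (.ofHist lc h)) _ ?_) <|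
        .andThen (.cdr (x := .cell e (.cell c s)) (y := .ofHist lc h) _ ?_) <|
        .andThen (.car (x := .cell e (.cell c s)) (y := .ofHist lc h) _ ?_) <|
        .andThen (.car (x := e) (y := .cell c s) _ ?_) <|
        .andThen (.cdr (x := e) (y := .cell c s) _ ?_) <|
        .andThen (.cdr (x := c) (y := s) _ ?_) <|
        .andThen (.car (x := c) (y := s) _ ?_) <|
        .andThen e₂ <| .andThen e₃ <|
        .car (x := x) (y := y) _ (hev₃.trans hxy), he, ?_, ?_, ?_, ?_, ?_⟩
      · simp [hv]
      · simp
      · simp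
      · simp
      · simp
      · simp
      · simp
      · simpa using hev₃
      · rintro x' y' rfl; simp only [Val.cell.injEq] at hxy; simp [hxy.1]
      · rw [update_of_ne (by simp), f₃ _ (by simp) (by simp), f₂ _ (by simp) (by simp)]
        simp [σ₁]
      · simpa using h₃
      · rw [update_of_ne (by simp), f₃ _ (by simp) (by simp), f₂ _ (by simp) (by simp)]
        simp [σ₁]

variable [Fintype F]

variable (fc) in
/-- Initialize the stack of symbols with the string for the final symbol of the current run. -/
noncomputable def Cmd.startWrite : Cmd Var :=
  .seq (.cdr .event .event) <| .seq (.const .todo 0) <|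
    .switch .event fc (fun f => .seqs ((φ f).reverse.map (.pushSym rc codeO .hist)))
      Finset.univ.toList

theorem Cmd.loopFree_startWrite : (Cmd.startWrite fc rc codeO φ).LoopFree :=
  ⟨trivial, trivial, Cmd.loopFree_switch fun _ => Cmd.loopFree_pushSyms _ _⟩

theorem Exec.startWrite (hfc : fc.Injective) {σ : Var → Val} {f : F} {h : List Λ}
    (hev : σ .event = .cell (.atom 0) (.atom (fc f))) (hh : σ .hist = .ofHist lc h)
    (h0 : σ .nil = .atom 0) :
    ∃ t σ', Exec (.startWrite fc rc codeO φ) (σ, []) [] t (σ', []) ∧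
      σ' .todo = .ofItems lc rc codeO ((φ f).map fun x => (x, h)) ∧ σ' .nil = .atom 0 ∧
      σ' .stack = σ .stack := by
  obtain ⟨t, σ₂, e₂, h₂, f₂⟩ := Exec.pushSyms (lc := lc) rc codeO (k := 3) (by simp) (by simp)
    (h := h) [] (φ f).reverse
    (σ := update (update σ .event (.atom (fc f))) .todo (.atom 0)) (l := [])
    (by simp [h0]) (by simp [hh]) (by simp [Val.ofItems, Val.ofList])
  obtain ⟨t', e₃⟩ := Exec.switch hfc (Finset.mem_toList.2 (Finset.mem_univ f)) (a := .event)
    (c := fun f => .seqs ((φ f).reverse.map (.pushSym rc codeO .hist))) (by simp) e₂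
  refine ⟨_, σ₂, .andThen (.cdr _ hev) <| .andThen (.const ..) e₃, by simpa using h₂, ?_, ?_⟩
  · rw [f₂ _ (by simp) (by simp)]; simp [h0]
  · rw [f₂ _ (by simp) (by simp)]; simp

variable [Fintype Λ] [Fintype R]

variable (lc fc) in
/-- The body of the main loop, which writes the output of one run. -/
noncomputable def Cmd.enumBody : Cmd Var :=
  .seq .popForest <| .seq (.loop .tag .descendBody) <| .seq (.startWrite fc rc codeO φ) <|
    .loop .todo (.writeBody lc rc codeO τ)

/-- The descent pays for the new labels only, whereas writing pays for the whole history `p.1`,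
including the part stored with the popped forest. Both are linear in the length of `p.1`. -/
theorem Exec.enumBody (hlc : lc.Injective) (hlc0 : ∀ l, lc l ≠ 0) (hfc : fc.Injective)
    (hrc : rc.Injective) (hrc0 : ∀ r, rc r ≠ 0) (hτ : ∀ l, CopylessTotal (τ l)) :
    ∃ K, ∀ {σ : Var → Val} {p : List Λ × F} {L : List (List Λ × F)},
      EncStack lc fc (σ .stack) (p :: L) → σ .nil = .atom 0 →
      ∃ t σ', Exec (.enumBody lc fc rc codeO τ φ) (σ, [])
          ((expandAll τ p.1 (φ p.2)).map codeO) t (σ', []) ∧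
        t ≤ K * (p.1.length + 1) ∧ EncStack lc fc (σ' .stack) L ∧ σ' .nil = .atom 0 := by
  obtain ⟨C, hC⟩ := expandCost_le τ hτ
  have hcost : ∀ (s : List (R ⊕ O)) (h : List Λ),
      itemsCost τ (s.map fun x => (x, h)) ≤ s.length * (1 + C) * (h.length + 1) := by
    intro s h
    have hone : ∀ x : R ⊕ O, Sum.elim (expandCost τ h) (fun _ => 1) x ≤ (1 + C) * (h.length + 1) := by
      intro x
      rw [add_mul, one_mul]
      cases x with
      | inl r =>
        have := (Finset.single_le_sum (f := expandCost τ h) (fun _ _ => Nat.zero_le _)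
          (Finset.mem_univ r)).trans (hC h)
        simp only [Sum.elim_inl]; omega
      | inr o => simp only [Sum.elim_inr]; omega
    rw [itemsCost, List.map_map, mul_assoc]
    refine (List.sum_le_card_nsmul _ ((1 + C) * (h.length + 1)) ?_).trans ?_
    · simp only [List.mem_map]
      rintro _ ⟨x, -, rfl⟩
      exact hone x
    · simp
  let d := Cmd.descendBody.bound
  let wb := (Cmd.writeBody lc rc codeO τ).bound
  -- The summands pay for popping, descending, starting the output, and writing; in the last one
  -- each symbol of a final string costs at most `(1 + C) * (n + 1)` rounds for a history of length
  -- `n`.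
  refine ⟨Cmd.popForest.bound + (d + 2) + (Cmd.startWrite fc rc codeO φ).bound +
    ((wb + 1) * ((∑ f, (φ f).length) * (1 + C)) + 1), ?_⟩
  intro σ p L hst h0
  obtain ⟨t₁, σ₁, e, M, h, L', hL', e₁, he, hev, htag, hh, hst₁, hn₁⟩ :=
    Exec.popForest hst (by simp)
  obtain ⟨t₂, σ₂, ls, f, M', hM', e₂, ht₂, hev₂, hh₂, hst₂, hn₂⟩ :=
    Exec.descend hlc0 he rfl hev htag hst₁ hh
  obtain ⟨t₃, σ₃, e₃, htodo, hn₃, hst₃⟩ := Exec.startWrite rc codeO φ hfc hev₂ hh₂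
    (hn₂.trans (hn₁.trans h0))
  obtain ⟨t₄, σ₄, e₄, ht₄, hn₄, hst₄⟩ := Exec.writeLoop rc codeO τ hlc hrc hrc0 _ rfl hn₃ htodo
  rw [hM', List.map_cons, List.cons_append, List.cons.injEq] at hL'
  obtain ⟨rfl, rfl⟩ := hL'
  have hw : itemsWord τ ((φ f).map fun x => (x, ls.reverse ++ h)) =
      expandAll τ (ls.reverse ++ h) (φ f) := by
    simp [itemsWord, expandAll, List.flatMap_map]
  rw [hw] at e₄
  refine ⟨_, σ₄, .andThen e₁ <| .andThen e₂ <| .andThen e₃ e₄, ?_, ?_, hn₄⟩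
  · have b₁ := e₁.le_bound Cmd.loopFree_popForest
    have b₃ := e₃.le_bound (Cmd.loopFree_startWrite rc codeO φ)
    have b₄ := hcost (φ f) (ls.reverse ++ h)
    have b₅ : (φ f).length ≤ ∑ f, (φ f).length :=
      Finset.single_le_sum (f := fun f => (φ f).length) (fun _ _ => Nat.zero_le _)
        (Finset.mem_univ f)
    have hlen : ls.length ≤ (ls.reverse ++ h).length := by simp
    generalize (ls.reverse ++ h).length = n at *
    have b₆ : t₄ ≤ (wb + 1) * ((∑ f, (φ f).length) * (1 + C)) * (n + 1) + 1 := by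
      refine ht₄.trans (Nat.add_le_add_right ?_ 1)
      rw [mul_assoc (wb + 1)]
      refine Nat.mul_le_mul_left _ (b₄.trans ?_)
      exact Nat.mul_le_mul_right _ (Nat.mul_le_mul_right _ b₅)
    have b₇ : t₂ ≤ (d + 1) * (n + 1) + 1 :=
      ht₂.trans (Nat.add_le_add_right (Nat.mul_le_mul_left _ (by omega)) 1)
    have b₈ : t₁ ≤ Cmd.popForest.bound * (n + 1) := b₁.trans (Nat.le_mul_of_pos_right _ (by omega))
    have b₉ : t₃ ≤ (Cmd.startWrite fc rc codeO φ).bound * (n + 1) :=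
      b₃.trans (Nat.le_mul_of_pos_right _ (by omega))
    generalize (Cmd.startWrite fc rc codeO φ).bound = x at *
    generalize Cmd.popForest.bound = y at *
    generalize (wb + 1) * ((∑ f, (φ f).length) * (1 + C)) = z at *
    have : (y + (d + 2) + x + (z + 1)) * (n + 1) = y * (n + 1) + ((d + 1) * (n + 1) + (n + 1)) +
      x * (n + 1) + (z * (n + 1) + (n + 1)) := by ring
    omega
  · rw [hst₄, hst₃]; exact hst₂

/-! #### Initialization -/

variable (iS : St → ℕ) {tr : St → A → List (Option Λ × St)} {fin : St → List F}

/-- Push the bag of a state. -/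
def Cmd.pushBag (s : St) : Cmd Var :=
  .ite (.bag (iS s)) 0 .skip <| .seq (.car .x₁ (.bag (iS s))) <| .seq (.cdr .x₂ (.bag (iS s))) <|
    .seq (.cons .x₂ .x₂ .nil) <| .seq (.cons .x₁ .x₁ .x₂) <| .seq (.cons .x₁ .x₁ .nil) <|
    .cons .stack .x₁ .stack

-- A nonempty bag `(e, c)` becomes a forest with the single root `e` and no second part, pushed with
-- the empty history. The labels appear reversed because histories list the latest label first.
omit [Fintype F] [Fintype Λ] in
theorem Exec.pushBags {D : List A} (l : List St) :
    ∀ {σ : Var → Val} {L : List (List Λ × F)}, BagInv lc fc iS tr fin σ D →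
    EncStack lc fc (σ .stack) L →
    ∃ t σ' L', Exec (.seqs (l.map (.pushBag iS))) (σ, []) [] t (σ', []) ∧
      EncStack lc fc (σ' .stack) L' ∧ σ' .nil = .atom 0 ∧
      (L' : Multiset (List Λ × F)) = L + (l.map fun s =>
        (layeredRuns tr fin s D).map fun q => (q.1.reverse, q.2)).sum := by
  induction l with
  | nil => exact fun {σ L} h hst => ⟨_, σ, L, .skip _, hst, h.1, by simp⟩
  | cons s l ih =>
    intro σ L h hst
    obtain ⟨t, σ₁, L₁, e₁, hst₁, hinv, hL₁⟩ : ∃ t σ' L', Exec (.pushBag iS s) (σ, []) [] t (σ', []) ∧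
        EncStack lc fc (σ' .stack) L' ∧ BagInv lc fc iS tr fin σ' D ∧
        (L' : Multiset (List Λ × F)) =
          L + (layeredRuns tr fin s D).map fun q => (q.1.reverse, q.2) := by
      rcases h.2 s with ⟨h0, hr⟩ | ⟨e, c, N₁, N₂, hv, he, hc, hr⟩
      · exact ⟨_, σ, L, .ite_eq h0 (.skip _), hst, h, by simp [hr]⟩
      · refine ⟨_, update (update (update σ .x₂ (.cell c (.atom 0))) .x₁
          (.cell (.cell e (.cell c (.atom 0))) (.atom 0))) .stack
          (.cell (.cell (.cell e (.cell c (.atom 0))) (.ofHist lc [])) (σ .stack)),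
          (N₁ ++ N₂ ++ []).map (fun q : List Λ × F => (q.1.reverse ++ [], q.2)) ++ L,
          .ite_ne (show (σ (.bag (iS s))).Differs 0 by rw [hv]; rfl) <| .andThen (.car _ hv) <|
          .andThen (.cdr _ (x := e) (y := c) (by simpa using hv)) <| .andThen (.cons ..) <|
          .andThen (.cons ..) <| .andThen (.cons ..) (?_ : Exec _ _ _ 1 _), ?_, h.congr (by simp) (by simp), ?_⟩
        · convert Exec.cons Var.stack Var.x₁ Var.stack _ _ using 2
          funext v
          simp [h.1, Val.ofHist, Val.ofList]
          by_cases h1 : v = .stack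
          · simp [h1]
          · by_cases h2 : v = .x₁
            · simp [h2]
            · by_cases h3 : v = .x₂ <;> simp [h1, h2, h3]
        · rw [Function.update_self]
          exact .cons [] (.node he hc .nil) rfl hst
        · rw [hr, Multiset.map_coe, Multiset.coe_add, Multiset.coe_eq_coe]
          simpa only [List.append_nil, List.map_append] using List.perm_append_comm
    obtain ⟨t', σ₂, L₂, e₂, hst₂, hn, hL₂⟩ := ih hinv hst₁
    exact ⟨_, σ₂, L₂, .andThen e₁ e₂, hst₂, hn, by simp [hL₂, hL₁, add_assoc]⟩

/-- The assumption that a run has no more labels than its output has letters turns time linear in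
the labels into output-linear delay. -/
theorem EnumLoop.of_encStack (hlc : lc.Injective) (hlc0 : ∀ l, lc l ≠ 0) (hfc : fc.Injective)
    (hrc : rc.Injective) (hrc0 : ∀ r, rc r ≠ 0) (hτ : ∀ l, CopylessTotal (τ l)) :
    ∃ K, ∀ {L : List (List Λ × F)} {σ : Var → Val},
      (∀ q ∈ L, q.1.length ≤ (expandAll τ q.1 (φ q.2)).length) →
      EncStack lc fc (σ .stack) L → σ .nil = .atom 0 →
      EnumLoop .stack (.enumBody lc fc rc codeO τ φ) .nil K (σ, [])
        (L.map fun q => (expandAll τ q.1 (φ q.2)).map codeO) := by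
  obtain ⟨K, hK⟩ := Exec.enumBody rc codeO τ φ hlc hlc0 hfc hrc hrc0 hτ
  refine ⟨K, ?_⟩
  intro L
  induction L with
  | nil =>
    intro σ _ hst _
    refine .done ?_
    show σ .stack = _
    generalize σ .stack = v at hst
    generalize hL : ([] : List (List Λ × F)) = L at hst
    cases hst with
    | nil => rfl
    | cons h hf hd hv =>
      have := hf.ne_nil_of_differs hd
      simp only [List.nil_eq, List.append_eq_nil_iff, List.map_eq_nil_iff] at hL
      exact absurd hL.1 this
  | cons q L ih =>
    intro σ hq hst h0
    obtain ⟨t, σ', e, ht, hst', h0'⟩ := hK hst h0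
    refine .step ?_ e ?_ h0' (ih (fun q hq' => hq q (by simp [hq'])) hst' h0')
    · show (σ .stack).Differs 0
      generalize σ .stack = v at hst
      generalize hL : q :: L = L' at hst
      cases hst with
      | nil => simp at hL
      | cons => rfl
    · refine ht.trans (Nat.mul_le_mul_left _ ?_)
      rw [List.length_map]
      exact Nat.add_le_add_right (hq q (by simp)) 1

theorem EnumLoop.mono {V : Type*} [DecidableEq V] {a z : V} {c : Cmd V} {k k' : ℕ} (hk : k ≤ k')
    {s : CState V} {ws : List (List ℤ)} (h : EnumLoop a c z k s ws) : EnumLoop a c z k' s ws := by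
  induction h with
  | done h => exact .done h
  | step h hc ht hz _ ih => exact .step h hc (ht.trans (Nat.mul_le_mul_right _ hk)) hz ih

end MainLoop

theorem mem_sum_map {α β : Type*} {f : α → Multiset β} {l : List α} {x : β}
    (h : x ∈ (l.map f).sum) : ∃ s ∈ l, x ∈ f s := by
  induction l with
  | nil => simp at h
  | cons s l ih =>
    rw [List.map_cons, List.sum_cons, Multiset.mem_add] at h
    rcases h with h | h
    · exact ⟨s, by simp, h⟩
    · obtain ⟨s', hs', h⟩ := ih h
      exact ⟨s', by simp [hs'], h⟩

/-- The outputs of the runs of a layered system can be enumerated, if every productive label of a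
run contributes to the length of its output. -/
theorem admitsLinearEnumeration_layered {A O St Λ F R : Type*} [Fintype A] [Fintype St]
    [Fintype Λ] [Fintype F] [Fintype R] (tr : St → A → List (Option Λ × St)) (fin : St → List F)
    (inits : List St) (τ : Λ → R → List (R ⊕ O)) (φ : F → List (R ⊕ O))
    (hτ : ∀ l, CopylessTotal (τ l))
    (hlen : ∀ D, ∀ s ∈ inits, ∀ q ∈ layeredRuns tr fin s D,
      q.1.length ≤ (expandAll τ q.1.reverse (φ q.2)).length) :
    AdmitsLinearEnumeration fun D => ((inits.map fun s => layeredRuns tr fin s D).sum).map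
      fun q => expandAll τ q.1.reverse (φ q.2) := by
  refine admitsLinearEnumeration_of_cmd fun codeA codeO hA0 hA hO0 => ?_
  let iS : St → ℕ := fun s => Fintype.equivFin St s
  -- Labels and registers get nonzero codes, because the tag `0` marks leaves among the events and
  -- letters among the symbols to be written. Final symbols are never tested against `0`.
  let lc : Λ → ℤ := fun l => ((Fintype.equivFin Λ l : ℕ) : ℤ) + 1
  let fc : F → ℤ := fun f => ((Fintype.equivFin F f : ℕ) : ℤ)
  let rc : R → ℤ := fun r => ((Fintype.equivFin R r : ℕ) : ℤ) + 1
  have hS : iS.Injective := fun a b h => (Fintype.equivFin St).injective (Fin.ext h)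
  have hlc : lc.Injective := fun a b h => (Fintype.equivFin Λ).injective (Fin.ext (by
    simp only [lc] at h; omega))
  have hfc : fc.Injective := fun a b h => (Fintype.equivFin F).injective (Fin.ext (by
    simp only [fc] at h; omega))
  have hrc : rc.Injective := fun a b h => (Fintype.equivFin R).injective (Fin.ext (by
    simp only [rc] at h; omega))
  have hlc0 : ∀ l, lc l ≠ 0 := fun l => by simp only [lc]; omega
  have hrc0 : ∀ r, rc r ≠ 0 := fun r => by simp only [rc]; omega
  obtain ⟨k₁, h₁⟩ := Exec.preprocess (lc := lc) (fc := fc) (iS := iS) (tr := tr) (fin := fin)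
    codeA hS hA hA0
  obtain ⟨k₂, h₂⟩ := EnumLoop.of_encStack rc codeO τ φ hlc hlc0 hfc hrc hrc0 hτ
  let cinit : Cmd Var := .seq (.const .stack 0) (.seqs (inits.map (.pushBag iS)))
  have hinit : cinit.LoopFree := by
    refine ⟨trivial, Cmd.loopFree_seqs ?_⟩
    simp only [List.mem_map]
    rintro c ⟨s, -, rfl⟩
    simp [Cmd.pushBag, Cmd.LoopFree]
  refine ⟨Var, inferInstance, Var.code, Var.code_injective, .preprocess lc fc iS tr fin codeA,
    cinit, .enumBody lc fc rc codeO τ φ, .stack, .nil, k₁ + cinit.bound + k₂, fun D => ?_⟩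
  obtain ⟨t, σ, e, ht, hinv⟩ := h₁ D
  obtain ⟨t', σ', L, e', hst, h0, hL⟩ := Exec.pushBags iS inits
    (σ := update σ .stack (.atom 0)) (L := []) (hinv.congr (by simp) (by simp))
    (by simpa using EncStack.nil)
  have e'' : Exec cinit (σ, []) [] _ (σ', []) := .andThen (.const ..) e'
  refine ⟨t, _, σ, [], (σ', []), L.map fun q => expandAll τ q.1 (φ q.2), ?_, ?_, e, e'', ?_, ?_⟩
  · exact ht.trans (Nat.mul_le_mul_right _ (by omega))
  · exact (e''.le_bound hinit).trans (by omega)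
  · rw [List.map_map]
    refine (h₂ (L := L) (σ := σ') (fun q hq => ?_) hst h0).mono (by omega)
    rw [← Multiset.mem_coe, hL] at hq
    simp only [Multiset.coe_nil, zero_add] at hq
    obtain ⟨s, hs, hqN⟩ := mem_sum_map hq
    obtain ⟨q, hq', rfl⟩ := Multiset.mem_map.1 hqN
    simpa using hlen D s hs q hq'
  · rw [← Multiset.map_coe, hL]
    simp only [Multiset.coe_nil, zero_add]
    generalize inits = l
    induction l with
    | nil => simp
    | cons s l ih => simp [ih]

/-! ### Streaming string transducers with choices -/

section Choices

open Classical

variable {P A B O R : Type*}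

/-- Replace registers by words. -/
def applyVal (ν : R → List O) (s : List (R ⊕ O)) : List O := s.flatMap (Sum.elim ν fun o => [o])

/-- Replace registers by strings of registers and letters. -/
def substAll (σ : R → List (R ⊕ O)) (s : List (R ⊕ O)) : List (R ⊕ O) :=
  s.flatMap (Sum.elim σ fun o => [Sum.inr o])

@[simp] theorem applyVal_nil (ν : R → List O) : applyVal ν [] = [] := rfl

@[simp] theorem applyVal_cons_inl (ν : R → List O) (r : R) (s : List (R ⊕ O)) :
    applyVal ν (Sum.inl r :: s) = ν r ++ applyVal ν s := by simp [applyVal]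

@[simp] theorem applyVal_cons_inr (ν : R → List O) (o : O) (s : List (R ⊕ O)) :
    applyVal ν (Sum.inr o :: s) = o :: applyVal ν s := by simp [applyVal]

@[simp] theorem applyVal_append (ν : R → List O) (s s' : List (R ⊕ O)) :
    applyVal ν (s ++ s') = applyVal ν s ++ applyVal ν s' := by simp [applyVal]

@[simp] theorem substAll_nil (σ : R → List (R ⊕ O)) : substAll σ [] = [] := rfl

@[simp] theorem substAll_cons_inl (σ : R → List (R ⊕ O)) (r : R) (s : List (R ⊕ O)) :
    substAll σ (Sum.inl r :: s) = σ r ++ substAll σ s := by simp [substAll]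

@[simp] theorem substAll_cons_inr (σ : R → List (R ⊕ O)) (o : O) (s : List (R ⊕ O)) :
    substAll σ (Sum.inr o :: s) = Sum.inr o :: substAll σ s := by simp [substAll]

theorem applyVal_substAll (ν : R → List O) (σ : R → List (R ⊕ O)) (s : List (R ⊕ O)) :
    applyVal ν (substAll σ s) = applyVal (fun r => applyVal ν (σ r)) s := by
  induction s with
  | nil => rfl
  | cons x s ih => cases x <;> simp [ih]

theorem applyVal_congr {ν ν' : R → List O} {s : List (R ⊕ O)} (h : ∀ r ∈ regs s, ν r = ν' r) :
    applyVal ν s = applyVal ν' s := by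
  induction s with
  | nil => rfl
  | cons x s ih =>
    cases x with
    | inl r =>
      simp only [regs_cons_inl, List.mem_cons, forall_eq_or_imp] at h
      simp [ih h.2, h.1]
    | inr o => simp [ih (by simpa using h)]

@[simp] theorem regs_map_inl (l : List R) : regs (l.map (Sum.inl : R → R ⊕ O)) = l := by
  induction l with
  | nil => rfl
  | cons r l ih => simp [ih]

/-- The letters of a string of registers and letters. -/
def letters (s : List (R ⊕ O)) : List O := s.filterMap Sum.getRight?

@[simp] theorem letters_nil : letters ([] : List (R ⊕ O)) = [] := rfl

@[simp] theorem letters_cons_inl (r : R) (s : List (R ⊕ O)) :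
    letters (Sum.inl r :: s) = letters s := rfl

@[simp] theorem letters_cons_inr (o : O) (s : List (R ⊕ O)) :
    letters (Sum.inr o :: s) = o :: letters s := rfl

@[simp] theorem letters_append (s s' : List (R ⊕ O)) :
    letters (s ++ s') = letters s ++ letters s' := List.filterMap_append

@[simp] theorem letters_map_inl (l : List R) : letters (l.map (Sum.inl : R → R ⊕ O)) = [] := by
  induction l with
  | nil => rfl
  | cons r l ih => simp [ih]

theorem eq_map_inl_of_letters {s : List (R ⊕ O)} (h : letters s = []) :
    s = (regs s).map Sum.inl := by
  induction s with
  | nil => rfl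
  | cons x s ih =>
    cases x with
    | inl r => simpa using ih h
    | inr o => simp at h

theorem letters_substAll {κ : R → List (R ⊕ O)} (h : ∀ r, letters (κ r) = []) (s : List (R ⊕ O)) :
    letters (substAll κ s) = letters s := by
  induction s with
  | nil => rfl
  | cons x s ih => cases x <;> simp [ih, h]

theorem length_applyVal (ν : R → List O) (s : List (R ⊕ O)) :
    (applyVal ν s).length = ((regs s).map fun r => (ν r).length).sum + (letters s).length := by
  induction s with
  | nil => rfl
  | cons x s ih =>
    cases x <;> simp [ih] <;> omega

theorem sum_toFinset_le (f : R → ℕ) (l : List R) : ∑ r ∈ l.toFinset, f r ≤ (l.map f).sum := by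
  induction l with
  | nil => simp
  | cons r l ih =>
    rw [List.toFinset_cons, List.map_cons, List.sum_cons]
    by_cases h : r ∈ l.toFinset
    · rw [Finset.insert_eq_of_mem h]; omega
    · rw [Finset.sum_insert h]; omega

theorem sum_toFinset_regs_le (ν : R → List O) (s : List (R ⊕ O)) :
    ∑ r ∈ (regs s).toFinset, (ν r).length + (letters s).length ≤ (applyVal ν s).length := by
  rw [length_applyVal]
  exact Nat.add_le_add_right (sum_toFinset_le _ _) _

theorem sum_biUnion_le (f : R → ℕ) (U : Finset R) (t : R → Finset R) :
    ∑ r ∈ U.biUnion t, f r ≤ ∑ r' ∈ U, ∑ r ∈ t r', f r := by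
  induction U using Finset.induction_on with
  | empty => simp
  | insert r' U h ih =>
    rw [Finset.biUnion_insert, Finset.sum_insert h]
    have := Finset.sum_union_inter (s₁ := t r') (s₂ := U.biUnion t) (f := f)
    omega

variable [Fintype R]

theorem count_regs_substAll (σ : R → List (R ⊕ O)) (s : List (R ⊕ O)) (r : R) :
    (regs (substAll σ s)).count r = ∑ r', (regs s).count r' * (regs (σ r')).count r := by
  induction s with
  | nil => simp
  | cons x s ih =>
    cases x with
    | inl r' =>
      simp [ih, List.count_cons, add_mul, Finset.sum_add_distrib, add_comm]
    | inr o => simp [ih]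

/-- Occurrences multiply along a substitution; summing first over the outer strings uses `h'`, then
over the inner ones `h`. -/
theorem CopylessTotal.comp {σ σ' : R → List (R ⊕ O)} (h : CopylessTotal σ)
    (h' : CopylessTotal σ') : CopylessTotal fun r => substAll σ (σ' r) := by
  intro r
  simp only [count_regs_substAll]
  rw [Finset.sum_comm]
  refine le_trans (Finset.sum_le_sum fun r' _ => ?_) (h r)
  rw [← Finset.sum_mul]
  exact (Nat.mul_le_mul_right _ (h' r')).trans (one_mul _).le

theorem CopylessTotal.of_le {σ σ' : R → List (R ⊕ O)} (h : CopylessTotal σ)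
    (h' : ∀ r, σ' r = σ r ∨ σ' r = []) : CopylessTotal σ' := by
  intro r
  refine le_trans (Finset.sum_le_sum fun r' _ => ?_) (h r)
  rcases h' r' with h | h <;> simp [h]

theorem CopylessTotal.id : CopylessTotal fun r : R => [(Sum.inl r : R ⊕ O)] := by
  intro r
  simp [List.count_cons]

variable [Fintype B] (step : P → B → A → Option ((R → List (R ⊕ O)) × P))
  (fin : P → B → Option (List (R ⊕ O)))

/-- The bag of outputs over all sequences of choices. -/
noncomputable def choiceOutputs : P → (R → List O) → List A → Multiset (List O)
  | p, ν, [] => ∑ b, (fin p b).elim 0 fun s => {applyVal ν s}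
  | p, ν, a :: D => ∑ b, (step p b a).elim 0 fun q =>
      choiceOutputs q.2 (fun r => applyVal ν (q.1 r)) D

/-! ### Guessing the live registers. -/

/-- The registers that are used by an assignment to the registers in `U`. -/
noncomputable def demand (σ : R → List (R ⊕ O)) (U : Finset R) : Finset R :=
  U.biUnion fun r => (regs (σ r)).toFinset

/-- The bag of outputs over all sequences of choices for which `U` is the set of registers whose
initial contents are used. -/
noncomputable def liveOutputs : P → Finset R → (R → List O) → List A → Multiset (List O)
  | p, U, ν, [] => ∑ b, (fin p b).elim 0 fun s =>
      if (regs s).toFinset = U then {applyVal ν s} else 0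
  | p, U, ν, a :: D => ∑ b, (step p b a).elim 0 fun q =>
      ∑ U', if demand q.1 U' = U then liveOutputs q.2 U' (fun r => applyVal ν (q.1 r)) D else 0

/-- The live registers are determined backwards: by the final string at the end, and by `demand`
before each step. So exactly one sequence of guesses is consistent with a given sequence of choices,
and guessing does not change multiplicities. -/
theorem choiceOutputs_eq (D : List A) : ∀ (p : P) (ν : R → List O),
    choiceOutputs step fin p ν D = ∑ U, liveOutputs step fin p U ν D := by
  induction D with
  | nil =>
    intro p ν
    simp only [choiceOutputs, liveOutputs]
    rw [Finset.sum_comm]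
    refine Finset.sum_congr rfl fun b _ => ?_
    cases fin p b <;> simp
  | cons a D ih =>
    intro p ν
    simp only [choiceOutputs, liveOutputs]
    rw [Finset.sum_comm]
    refine Finset.sum_congr rfl fun b _ => ?_
    cases step p b a with
    | none => simp
    | some q =>
      simp only [Option.elim_some]
      rw [Finset.sum_comm, ih]
      simp

/-- Dead registers have no influence. This is what permits labels and pending assignments to erase
everything outside of the live set. -/
theorem liveOutputs_congr (D : List A) : ∀ (p : P) (U : Finset R) (ν ν' : R → List O),
    (∀ r ∈ U, ν r = ν' r) → liveOutputs step fin p U ν D = liveOutputs step fin p U ν' D := by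
  induction D with
  | nil =>
    intro p U ν ν' h
    simp only [liveOutputs]
    refine Finset.sum_congr rfl fun b _ => ?_
    cases fin p b with
    | none => rfl
    | some s =>
      simp only [Option.elim_some]
      split_ifs with hU
      · rw [applyVal_congr fun r hr => h r (by rw [← hU]; simpa using hr)]
      · rfl
  | cons a D ih =>
    intro p U ν ν' h
    simp only [liveOutputs]
    refine Finset.sum_congr rfl fun b _ => ?_
    cases step p b a with
    | none => rfl
    | some q =>
      simp only [Option.elim_some]
      refine Finset.sum_congr rfl fun U' _ => ?_
      split_ifs with hU
      · refine ih _ _ _ _ fun r hr => applyVal_congr fun r' hr' => h r' ?_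
        rw [← hU]
        exact Finset.mem_biUnion.2 ⟨r, hr, by simpa using hr'⟩
      · rfl

/-! #### The layered system of a system with choices -/

variable (R) in
/-- Copyless assignments without letters. -/
def Pending : Type _ := {κ : R → List R // ∀ r, ∑ r', (κ r').count r ≤ 1}

/-- In a copyless assignment without letters each string is a list of distinct registers, and there
are finitely many of those. -/
instance : Finite (Pending R) := by
  have hnd : ∀ κ : Pending R, ∀ r, (κ.1 r).Nodup := fun κ r =>
    List.nodup_iff_count_le_one.2 fun r' => (Finset.single_le_sum
      (f := fun r => (κ.1 r).count r') (fun _ _ => Nat.zero_le _) (Finset.mem_univ r)).trans (κ.2 r')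
  refine Finite.of_injective
    (fun κ : Pending R => fun r => (⟨κ.1 r, hnd κ r⟩ : {l : List R // l.Nodup})) ?_
  intro κ κ' h
  refine Subtype.ext (funext fun r => ?_)
  simpa using congrFun h r

/-- The identity. -/
def Pending.one : Pending R := ⟨fun r => [r], fun r => by simp [List.count_cons]⟩

/-- The total assignment that belongs to a pending assignment. -/
def Pending.toTotal (κ : Pending R) (r : R) : List (R ⊕ O) := (κ.1 r).map Sum.inl

theorem Pending.copyless_toTotal (κ : Pending R) :
    CopylessTotal (κ.toTotal : R → List (R ⊕ O)) := by
  intro r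
  simpa [Pending.toTotal] using κ.2 r

/-- The pending assignment that belongs to a copyless assignment without letters. -/
noncomputable def Pending.ofTotal (ρ : R → List (R ⊕ O)) : Pending R :=
  if h : CopylessTotal ρ then ⟨fun r => regs (ρ r), h⟩ else Pending.one

theorem Pending.toTotal_ofTotal {ρ : R → List (R ⊕ O)} (h : CopylessTotal ρ)
    (hl : ∀ r, letters (ρ r) = []) : (Pending.ofTotal ρ).toTotal = ρ := by
  funext r
  have e : Pending.ofTotal ρ = ⟨fun r => regs (ρ r), h⟩ := dif_pos h
  rw [e]
  exact (eq_map_inl_of_letters (hl r)).symm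

/-- Compose an assignment to the registers in `U` with a pending assignment. -/
noncomputable def Pending.comp (κ : Pending R) (σ : R → List (R ⊕ O)) (U : Finset R) (r : R) :
    List (R ⊕ O) :=
  if r ∈ U then substAll κ.toTotal (σ r) else []

theorem Pending.copyless_comp (κ : Pending R) {σ : R → List (R ⊕ O)} (hσ : CopylessTotal σ)
    (U : Finset R) : CopylessTotal (κ.comp σ U) :=
  (κ.copyless_toTotal.comp hσ).of_le fun r => by
    by_cases h : r ∈ U <;> simp [Pending.comp, h]

/-- The labels of the layered system. -/
abbrev ChoiceLabel (P A B R : Type*) [Fintype R] := P × B × A × Finset R × Pending R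

/-- The assignment of a label. -/
noncomputable def labelAssignment (l : ChoiceLabel P A B R) : R → List (R ⊕ O) :=
  (step l.1 l.2.1 l.2.2.1).elim (fun _ => []) fun q => l.2.2.2.2.comp q.1 l.2.2.2.1

/-- The string of a final symbol. -/
noncomputable def finalString (f : P × B × Pending R) : List (R ⊕ O) :=
  (fin f.1 f.2.1).elim [] fun s => substAll f.2.2.toTotal s

/-- The transitions of the layered system. -/
noncomputable def layeredStep (s : P × Finset R × Pending R) (a : A) :
    List (Option (ChoiceLabel P A B R) × (P × Finset R × Pending R)) :=
  (Finset.univ : Finset B).toList.flatMap fun b => (step s.1 b a).elim [] fun q =>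
    (Finset.univ : Finset (Finset R)).toList.flatMap fun U =>
      if demand q.1 U = s.2.1 then
        [if ∀ r, letters (s.2.2.comp q.1 U r) = [] then
            (none, (q.2, U, .ofTotal (s.2.2.comp q.1 U)))
          else (some (s.1, b, a, U, s.2.2), (q.2, U, .one))]
      else []

/-- The final symbols of the layered system. -/
noncomputable def layeredFinal (s : P × Finset R × Pending R) : List (P × B × Pending R) :=
  (Finset.univ : Finset B).toList.flatMap fun b => (fin s.1 b).elim [] fun w =>
    if (regs w).toFinset = s.2.1 then [(s.1, b, s.2.2)] else []

theorem sum_map_toList_flatMap {ι α M : Type*} [AddCommMonoid M] (s : Finset ι) (f : ι → List α)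
    (g : α → M) : ((s.toList.flatMap f).map g).sum = ∑ i ∈ s, ((f i).map g).sum := by
  rw [← Finset.sum_map_toList]
  generalize s.toList = l
  induction l with
  | nil => simp
  | cons x l ih => simp [ih]

theorem coe_eq_sum_map {α : Type*} (l : List α) :
    (l : Multiset α) = (l.map fun x => ({x} : Multiset α)).sum := by
  induction l with
  | nil => rfl
  | cons x l ih => rw [List.map_cons, List.sum_cons, ← ih]; rfl

theorem map_sum_multiset {ι α β : Type*} (s : Finset ι) (f : ι → Multiset α) (g : α → β) :
    (∑ i ∈ s, f i).map g = ∑ i ∈ s, (f i).map g :=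
  map_sum (Multiset.mapAddMonoidHom g) f s

variable {step fin}

/-- The contents of the registers for a history and a pending assignment. -/
noncomputable def Pending.val (κ : Pending R) (h : List (ChoiceLabel P A B R)) (r : R) : List O :=
  applyVal (expand (labelAssignment step) h) (κ.toTotal r)

omit [Fintype B] in
theorem applyVal_val (κ : Pending R) (h : List (ChoiceLabel P A B R)) (s : List (R ⊕ O)) :
    applyVal (κ.val (step := step) h) s =
      applyVal (expand (labelAssignment step) h) (substAll κ.toTotal s) :=
  (applyVal_substAll ..).symm

theorem expand_label {p : P} {b : B} {a : A} {q : (R → List (R ⊕ O)) × P}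
    (hq : step p b a = some q) (U : Finset R) (κ : Pending R) (h : List (ChoiceLabel P A B R))
    {r : R} (hr : r ∈ U) :
    expand (labelAssignment step) ((p, b, a, U, κ) :: h) r =
      applyVal (κ.val (step := step) h) (q.1 r) := by
  rw [applyVal_val]
  simp only [expand, labelAssignment, hq, Option.elim_some, Pending.comp, hr, if_true]
  rfl

omit [Fintype B] in
theorem Pending.one_val (h : List (ChoiceLabel P A B R)) :
    Pending.one.val (step := step) h = expand (labelAssignment step) h := by
  funext r
  simp [Pending.val, Pending.toTotal, Pending.one]

theorem Pending.ofTotal_val {q : R → List (R ⊕ O)} (hq : CopylessTotal q) {κ : Pending R}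
    {U : Finset R} (hl : ∀ r, letters (κ.comp q U r) = []) (h : List (ChoiceLabel P A B R))
    {r : R} (hr : r ∈ U) :
    (Pending.ofTotal (κ.comp q U)).val (step := step) h r =
      applyVal (κ.val (step := step) h) (q r) := by
  rw [applyVal_val, Pending.val, Pending.toTotal_ofTotal (κ.copyless_comp hq U) hl]
  simp [Pending.comp, hr]

/-- Invariant: the contents of live registers are the pending assignment applied to the expansion of
the history. A step that creates no letter in a live register is composed into the pending
assignment; any other step moves the composition to the history and resets the pending assignment to
the identity. -/
theorem liveOutputs_eq (hstep : ∀ p b a q, step p b a = some q → CopylessTotal q.1) (D : List A) :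
    ∀ (p : P) (U : Finset R) (κ : Pending R) (h : List (ChoiceLabel P A B R)),
    liveOutputs step fin p U (κ.val (step := step) h) D =
      (layeredRuns (layeredStep step) (layeredFinal fin) (p, U, κ) D).map fun q =>
        expandAll (labelAssignment step) (q.1.reverse ++ h) (finalString fin q.2) := by
  induction D with
  | nil =>
    intro p U κ h
    simp only [liveOutputs, layeredRuns]
    rw [coe_eq_sum_map, List.map_map, layeredFinal, sum_map_toList_flatMap, map_sum_multiset]
    refine Finset.sum_congr rfl fun b _ => ?_
    cases hb : fin p b with
    | none => simp
    | some s =>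
      simp only [Option.elim_some]
      split_ifs with hU
      · simp [finalString, hb, applyVal_val]
        rfl
      · simp
  | cons a D ih =>
    intro p U κ h
    simp only [liveOutputs, layeredRuns]
    rw [layeredStep, sum_map_toList_flatMap, map_sum_multiset]
    refine Finset.sum_congr rfl fun b _ => ?_
    cases hb : step p b a with
    | none => simp
    | some q =>
      simp only [Option.elim_some]
      rw [sum_map_toList_flatMap, map_sum_multiset]
      refine Finset.sum_congr rfl fun U' _ => ?_
      by_cases hU : demand q.1 U' = U
      · rw [if_pos hU, if_pos hU]
        by_cases hl : ∀ r, letters (κ.comp q.1 U' r) = []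
        · rw [if_pos hl]
          simp only [List.map_cons, List.map_nil, List.sum_cons, List.sum_nil, add_zero,
            Option.elim_none]
          rw [← ih]
          -- The two valuations agree only on the live set `U'`, since the composition is empty
          -- elsewhere.
          exact liveOutputs_congr _ _ _ _ _ _ _ fun r hr =>
            (Pending.ofTotal_val (hstep _ _ _ _ hb) hl h hr).symm
        · rw [if_neg hl]
          simp only [List.map_cons, List.map_nil, List.sum_cons, List.sum_nil, add_zero,
            Option.elim_some, Multiset.map_map, Function.comp_def, List.reverse_cons,
            List.append_assoc, List.singleton_append]
          rw [← ih]
          refine liveOutputs_congr _ _ _ _ _ _ _ fun r hr => ?_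
          rw [Pending.one_val, expand_label hb _ _ _ hr]
      · rw [if_neg hU, if_neg hU]
        simp

/-! ### Labels are paid for by letters of the output. -/

omit [Fintype B] in
theorem sum_demand_le (ν : R → List O) (σ : R → List (R ⊕ O)) (U : Finset R) :
    ∑ r ∈ demand σ U, (ν r).length + ∑ r ∈ U, (letters (σ r)).length ≤
      ∑ r ∈ U, (applyVal ν (σ r)).length := by
  have h := sum_biUnion_le (fun r => (ν r).length) U fun r => (regs (σ r)).toFinset
  have h' := Finset.sum_le_sum fun r (_ : r ∈ U) => sum_toFinset_regs_le ν (σ r)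
  rw [Finset.sum_add_distrib] at h'
  exact (Nat.add_le_add_right h _).trans h'

/-- The total length of the live registers serves as a potential. By `sum_demand_le` it never
decreases, every labelled step raises it by at least one, and at the end all live registers go into
the output. -/
theorem length_le_length_output (hstep : ∀ p b a q, step p b a = some q → CopylessTotal q.1)
    (D : List A) :
    ∀ (p : P) (U : Finset R) (κ : Pending R) (h : List (ChoiceLabel P A B R)),
    ∀ q ∈ layeredRuns (layeredStep step) (layeredFinal fin) (p, U, κ) D,
      ∑ r ∈ U, (κ.val (step := step) h r).length + q.1.length ≤
        (expandAll (labelAssignment step) (q.1.reverse ++ h) (finalString fin q.2)).length := by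
  induction D with
  | nil =>
    intro p U κ h q hq
    simp only [layeredRuns, Multiset.mem_coe, List.mem_map, layeredFinal, List.mem_flatMap] at hq
    obtain ⟨f, ⟨b, -, hf⟩, rfl⟩ := hq
    cases hb : fin p b with
    | none => simp [hb] at hf
    | some s =>
      rw [hb, Option.elim_some] at hf
      split_ifs at hf with hU
      · rw [List.mem_singleton.1 hf]
        have := sum_toFinset_regs_le (κ.val (step := step) h) s
        rw [hU, applyVal_val] at this
        have e : expandAll (labelAssignment step) h (finalString fin (p, b, κ)) =
            applyVal (expand (labelAssignment step) h) (substAll κ.toTotal s) := by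
          simp only [finalString, hb, Option.elim_some]; rfl
        simp only [List.reverse_nil, List.nil_append, e, List.length_nil]
        omega
      · simp at hf
  | cons a D ih =>
    intro p U κ h q hq
    obtain ⟨⟨o, s'⟩, hs', hq⟩ := mem_sum_map hq
    simp only [layeredStep, List.mem_flatMap] at hs'
    obtain ⟨b, -, hs'⟩ := hs'
    cases hb : step p b a with
    | none => simp [hb] at hs'
    | some t =>
      rw [hb, Option.elim_some] at hs'
      obtain ⟨U', -, hs'⟩ := List.mem_flatMap.1 hs'
      by_cases hU : demand t.1 U' = U
      · rw [if_pos hU, List.mem_singleton] at hs'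
        have hd := sum_demand_le (κ.val (step := step) h) t.1 U'
        rw [hU] at hd
        by_cases hl : ∀ r, letters (κ.comp t.1 U' r) = []
        · rw [if_pos hl, Prod.mk.injEq] at hs'
          obtain ⟨rfl, rfl⟩ := hs'
          have := ih _ _ _ h q hq
          rw [Finset.sum_congr rfl fun r hr => congrArg List.length
            (Pending.ofTotal_val (hstep _ _ _ _ hb) hl h hr)] at this
          omega
        · rw [if_neg hl, Prod.mk.injEq] at hs'
          obtain ⟨rfl, rfl⟩ := hs'
          obtain ⟨q', hq', rfl⟩ := Multiset.mem_map.1 hq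
          have := ih _ _ _ ((p, b, a, U', κ) :: h) q' hq'
          rw [Finset.sum_congr rfl fun r hr => congrArg List.length
            ((congrFun (Pending.one_val _) r).trans (expand_label hb U' κ h hr))] at this
          -- The letter found in the composition belongs to a register in `U'`, and it stems from
          -- the step itself because pending assignments contain no letters.
          have hpos : 0 < ∑ r ∈ U', (letters (t.1 r)).length := by
            push Not at hl
            obtain ⟨r, hr⟩ := hl
            by_cases hrU : r ∈ U'
            · refine lt_of_lt_of_le ?_ (Finset.single_le_sum
                (f := fun r => (letters (t.1 r)).length) (fun _ _ => Nat.zero_le _) hrU)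
              rw [Pending.comp, if_pos hrU,
                letters_substAll fun r => by simp [Pending.toTotal]] at hr
              exact List.length_pos_iff.2 hr
            · simp [Pending.comp, hrU] at hr
          simp only [List.reverse_cons, List.append_assoc, List.singleton_append, List.length_cons]
          omega
      · simp [hU] at hs'

/-- The outputs of a copyless streaming string transducer with choices can be enumerated. -/
theorem admitsLinearEnumeration_choice [Fintype P] [Fintype A]
    (hstep : ∀ p b a q, step p b a = some q → CopylessTotal q.1) (p₀ : P) :
    AdmitsLinearEnumeration (choiceOutputs step fin p₀ fun _ => []) := by
  have : Fintype (Pending R) := Fintype.ofFinite _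
  have key := admitsLinearEnumeration_layered (layeredStep step) (layeredFinal fin)
    ((Finset.univ : Finset (Finset R)).toList.map fun U => (p₀, U, Pending.one))
    (labelAssignment step) (finalString fin) ?_ ?_
  · convert key using 2 with D
    rw [choiceOutputs_eq, List.map_map, Finset.sum_map_toList, map_sum_multiset]
    refine Finset.sum_congr rfl fun U _ => ?_
    have := liveOutputs_eq (fin := fin) hstep D p₀ U Pending.one []
    rw [Pending.one_val, show expand (labelAssignment step) [] = fun _ => [] from
      funext fun _ => rfl] at this
    simpa using this
  · rintro ⟨p, b, a, U, κ⟩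
    simp only [labelAssignment]
    cases hb : step p b a with
    | none => intro r; simp
    | some q => exact κ.copyless_comp (hstep _ _ _ _ hb) U
  · intro D s hs q hq
    obtain ⟨U, -, rfl⟩ := List.mem_map.1 hs
    have := length_le_length_output hstep D p₀ U Pending.one [] q hq
    simp only [List.append_nil] at this
    omega

end Choices

/-! ### Regular languages are closed under the regular operations -/

section Regular

open Computability

variable {S : Type*}

/-- Here and below regularity follows from the Myhill–Nerode criterion: all left quotients lie in a
finite set. -/
theorem isRegular_one : (1 : Language S).IsRegular := by
  refine Language.IsRegular.of_finite_range_leftQuotient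
    (((Set.finite_singleton (0 : Language S)).insert 1).subset ?_)
  rintro _ ⟨x, rfl⟩
  cases x with
  | nil => exact Or.inl rfl
  | cons a x =>
    right
    ext y
    simp [Language.mem_one, Language.notMem_zero]

theorem isRegular_letterLang (b : S) : (letterLang b).IsRegular := by
  refine Language.IsRegular.of_finite_range_leftQuotient
    ((((Set.finite_singleton (0 : Language S)).insert 1).insert (letterLang b)).subset ?_)
  have hmem : ∀ y, y ∈ letterLang b ↔ y = [b] := fun y => Iff.rfl
  rintro _ ⟨x, rfl⟩
  match x with
  | [] => exact Or.inl rfl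
  | [a] =>
    right
    by_cases h : a = b
    · left
      subst h
      ext y
      simp [hmem, Language.mem_one]
    · right
      ext y
      simp [hmem, Language.notMem_zero, h]
  | a :: a' :: x =>
    right; right
    ext y
    simp [hmem, Language.notMem_zero]

/-- The quotient of `L * M` by `x` depends only on the quotient of `L` by `x` and on the set of
quotients of `M` by those `v` for which `x = u ++ v` with `u ∈ L`. There are finitely many such
pairs. -/
theorem isRegular_mul {L M : Language S} (hL : L.IsRegular) (hM : M.IsRegular) :
    (L * M).IsRegular := by
  let f : Language S × Set (Language S) → Language S := fun p =>
    ({z | z ∈ p.1 * M ∨ ∃ K ∈ p.2, z ∈ K} : Set (List S))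
  refine Language.IsRegular.of_finite_range_leftQuotient
    (((hL.finite_range_leftQuotient.prod hM.finite_range_leftQuotient.finite_subsets).image
      f).subset ?_)
  rintro _ ⟨x, rfl⟩
  refine ⟨(L.leftQuotient x, {K | ∃ u v, x = u ++ v ∧ u ∈ L ∧ K = M.leftQuotient v}),
    ⟨⟨x, rfl⟩, ?_⟩, ?_⟩
  · rintro K ⟨u, v, -, -, rfl⟩
    exact ⟨v, rfl⟩
  · ext z
    rw [Language.mem_leftQuotient, Language.mem_mul]
    refine Iff.trans (or_congr Language.mem_mul Iff.rfl) ⟨?_, ?_⟩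
    · rintro (⟨a, ha, b, hb, rfl⟩ | ⟨K, ⟨u, v, rfl, hu, rfl⟩, hz⟩)
      · exact ⟨x ++ a, ha, b, hb, by simp⟩
      · exact ⟨u, hu, v ++ z, hz, by simp⟩
    · rintro ⟨a, ha, b, hb, h⟩
      rcases List.append_eq_append_iff.1 h with ⟨c, rfl, rfl⟩ | ⟨c, rfl, rfl⟩
      · exact Or.inr ⟨_, ⟨a, c, rfl, ha, rfl⟩, hb⟩
      · exact Or.inl ⟨c, ha, b, hb, rfl⟩

/-- Unless `z` is empty, some factor `v ++ a` contains the cut between `x` and `z`; what precedes it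
and what follows it are in the star. -/
theorem mem_leftQuotient_kstar (L : Language S) (x z : List S) :
    x ++ z ∈ L∗ ↔ (x ∈ L∗ ∧ z = []) ∨
      ∃ u v, x = u ++ v ∧ u ∈ L∗ ∧ z ∈ L.leftQuotient v * L∗ := by
  constructor
  · rw [Language.mem_kstar]
    rintro ⟨l, hl, h⟩
    induction l generalizing x with
    | nil =>
      simp only [List.flatten_nil, List.append_eq_nil_iff] at hl
      obtain ⟨rfl, rfl⟩ := hl
      exact Or.inl ⟨Language.nil_mem_kstar L, rfl⟩
    | cons y l ih =>
      simp only [List.mem_cons, forall_eq_or_imp] at h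
      have cons_mem : ∀ u, u ∈ L∗ → y ++ u ∈ L∗ := by
        intro u hu
        obtain ⟨l', rfl, h'⟩ := Language.mem_kstar.1 hu
        exact Language.mem_kstar.2 ⟨y :: l', rfl, by simpa using ⟨h.1, h'⟩⟩
      rw [List.flatten_cons] at hl
      rcases List.append_eq_append_iff.1 hl with ⟨c, rfl, rfl⟩ | ⟨c, rfl, hc⟩
      · refine Or.inr ⟨[], x, rfl, Language.nil_mem_kstar L, ?_⟩
        exact Language.mem_mul.2 ⟨c, h.1, _, Language.join_mem_kstar h.2, rfl⟩
      · rcases ih c hc.symm h.2 with ⟨hc', rfl⟩ | ⟨u, v, rfl, hu, hz⟩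
        · exact Or.inl ⟨cons_mem _ hc', rfl⟩
        · exact Or.inr ⟨y ++ u, v, by simp, cons_mem _ hu, hz⟩
  · rintro (⟨hx, rfl⟩ | ⟨u, v, rfl, hu, hz⟩)
    · simpa using hx
    · obtain ⟨a, ha, b, hb, rfl⟩ := Language.mem_mul.1 hz
      obtain ⟨l, rfl, h⟩ := Language.mem_kstar.1 hu
      obtain ⟨l', rfl, h'⟩ := Language.mem_kstar.1 hb
      refine Language.mem_kstar.2 ⟨l ++ (v ++ a) :: l', by simp, ?_⟩
      intro y hy
      simp only [List.mem_append, List.mem_cons] at hy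
      rcases hy with hy | rfl | hy
      exacts [h _ hy, ha, h' _ hy]

/-- By `mem_leftQuotient_kstar`, a quotient is determined by one truth value and a set of quotients
of `L`. -/
theorem isRegular_kstar {L : Language S} (hL : L.IsRegular) : (L∗).IsRegular := by
  let f : Prop × Set (Language S) → Language S := fun p =>
    ({z | (p.1 ∧ z = []) ∨ ∃ K ∈ p.2, z ∈ K * L∗} : Set (List S))
  refine Language.IsRegular.of_finite_range_leftQuotient
    ((((Set.toFinite (Set.univ : Set Prop)).prod
      hL.finite_range_leftQuotient.finite_subsets).image f).subset ?_)
  rintro _ ⟨x, rfl⟩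
  refine ⟨(x ∈ L∗, {K | ∃ u v, x = u ++ v ∧ u ∈ L∗ ∧ K = L.leftQuotient v}),
    ⟨trivial, ?_⟩, ?_⟩
  · rintro K ⟨u, v, -, -, rfl⟩
    exact ⟨v, rfl⟩
  · ext z
    rw [Language.mem_leftQuotient, mem_leftQuotient_kstar]
    refine or_congr Iff.rfl ⟨?_, ?_⟩
    · rintro ⟨K, ⟨u, v, h, hu, rfl⟩, hz⟩
      exact ⟨u, v, h, hu, hz⟩
    · rintro ⟨u, v, h, hu, hz⟩
      exact ⟨_, ⟨u, v, h, hu, rfl⟩, hz⟩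

theorem MExpr.isRegular_lang {A X : Type*} (R : MExpr A X) : R.lang.IsRegular := by
  induction R with
  | eps => exact isRegular_one
  | sym a => exact isRegular_letterLang _
  | cat R R' ih ih' => exact isRegular_mul ih ih'
  | alt R R' ih ih' => exact ih.add ih'
  | star R ih => exact isRegular_kstar ih
  | bind x R ih =>
    exact isRegular_mul (isRegular_mul (isRegular_letterLang _) ih) (isRegular_letterLang _)

end Regular

/-! ### Bracket structure of the words of an expression -/

section Balance

open Classical

variable {A X : Type*}

/-- Read a word and keep track of whether the variable `x` is open; `none` if the brackets of `x`
do not alternate. -/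
noncomputable def track (x : X) : Prop → List (RefSym A X) → Option Prop
  | p, [] => some p
  | p, Sum.inl _ :: w => track x p w
  | p, Sum.inr (Bracket.opn y) :: w =>
      if y = x then if p then none else track x True w else track x p w
  | p, Sum.inr (Bracket.cls y) :: w =>
      if y = x then if p then track x False w else none else track x p w

theorem track_append (x : X) (u v : List (RefSym A X)) (p : Prop) :
    track x p (u ++ v) = (track x p u).bind fun q => track x q v := by
  induction u generalizing p with
  | nil => rfl
  | cons s u ih =>
    match s with
    | Sum.inl a => exact ih p
    | Sum.inr (Bracket.opn y) =>
      simp only [List.cons_append, track]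
      split_ifs <;> simp [ih]
    | Sum.inr (Bracket.cls y) =>
      simp only [List.cons_append, track]
      split_ifs <;> simp [ih]

theorem track_flatten (x : X) (p : Prop) (l : List (List (RefSym A X)))
    (h : ∀ y ∈ l, track x p y = some p) : track x p l.flatten = some p := by
  induction l with
  | nil => rfl
  | cons y l ih =>
    simp only [List.mem_cons, forall_eq_or_imp] at h
    rw [List.flatten_cons, track_append, h.1, Option.bind_some, ih h.2]

/-- Needed with `x` open as well as closed: inside of `x{R}` the variable stays open throughout. -/
theorem MExpr.track_of_notMem (R : MExpr A X) (x : X) (hx : x ∉ R.vars) (p : Prop) :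
    ∀ w ∈ R.lang, track x p w = some p := by
  induction R with
  | eps => rintro w rfl; rfl
  | sym a => rintro w rfl; rfl
  | cat R R' ih ih' =>
    simp only [MExpr.vars, Set.mem_union, not_or] at hx
    intro w hw
    obtain ⟨u, hu, v, hv, rfl⟩ := Language.mem_mul.1 hw
    rw [track_append, ih hx.1 u hu, Option.bind_some, ih' hx.2 v hv]
  | alt R R' ih ih' =>
    simp only [MExpr.vars, Set.mem_union, not_or] at hx
    rintro w (hw | hw)
    exacts [ih hx.1 w hw, ih' hx.2 w hw]
  | star R ih =>
    intro w hw
    obtain ⟨l, rfl, h⟩ := Language.mem_kstar.1 hw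
    exact track_flatten x p l fun y hy => ih hx y (h y hy)
  | bind y R ih =>
    simp only [MExpr.vars, Set.mem_insert_iff, not_or] at hx
    intro w hw
    obtain ⟨u', hu', v, rfl, rfl⟩ := Language.mem_mul.1 hw
    obtain ⟨u, rfl, v, hv, rfl⟩ := Language.mem_mul.1 hu'
    rw [track_append, track_append]
    simp [track, Ne.symm hx.1, ih hx.2 v hv]

/-- Well-formedness excludes nested brackets of the same variable, so the brackets of each variable
alternate and all of them are closed at the end. -/
theorem MExpr.track_of_wellFormed (R : MExpr A X) (hR : R.WellFormed) (x : X) :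
    ∀ w ∈ R.lang, track x False w = some False := by
  induction R with
  | eps => rintro w rfl; rfl
  | sym a => rintro w rfl; rfl
  | cat R R' ih ih' =>
    intro w hw
    obtain ⟨u, hu, v, hv, rfl⟩ := Language.mem_mul.1 hw
    rw [track_append, ih hR.1 u hu, Option.bind_some, ih' hR.2 v hv]
  | alt R R' ih ih' =>
    rintro w (hw | hw)
    exacts [ih hR.1 w hw, ih' hR.2 w hw]
  | star R ih =>
    intro w hw
    obtain ⟨l, rfl, h⟩ := Language.mem_kstar.1 hw
    exact track_flatten x _ l fun y hy => ih hR y (h y hy)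
  | bind y R ih =>
    intro w hw
    obtain ⟨u', hu', v, rfl, rfl⟩ := Language.mem_mul.1 hw
    obtain ⟨u, rfl, v, hv, rfl⟩ := Language.mem_mul.1 hu'
    rw [track_append, track_append]
    by_cases h : y = x
    · subst h
      simp [track, R.track_of_notMem y hR.1 True v hv]
    · simp [track, h, ih hR.2 v hv]

/-! ### How spans arise while a word is read from left to right. -/

/-- The variable `x` has been opened at position `i` and has not been closed yet. -/
def OpenAt (w : List (RefSym A X)) (x : X) (i : ℕ) : Prop :=
  ∃ u v : List (RefSym A X), w = u ++ Sum.inr (Bracket.opn x) :: v ∧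
    Sum.inr (Bracket.opn x) ∉ v ∧ Sum.inr (Bracket.cls x) ∉ v ∧ i = (doc u).length + 1

theorem openAt_snoc_ne {w : List (RefSym A X)} {s : RefSym A X} {x : X}
    (h₁ : s ≠ Sum.inr (Bracket.opn x)) (h₂ : s ≠ Sum.inr (Bracket.cls x)) (i : ℕ) :
    OpenAt (w ++ [s]) x i ↔ OpenAt w x i := by
  constructor
  · rintro ⟨u, v, h, hv₁, hv₂, rfl⟩
    rcases List.eq_nil_or_concat v with rfl | ⟨v, s', rfl⟩
    · have := List.append_inj_right' h rfl
      simp [h₁] at this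
    · rw [List.concat_eq_append] at h hv₁ hv₂
      rw [← List.cons_append, ← List.append_assoc] at h
      obtain ⟨rfl, -⟩ := List.append_inj' h rfl
      exact ⟨u, v, rfl, fun h => hv₁ (by simp [h]), fun h => hv₂ (by simp [h]), rfl⟩
  · rintro ⟨u, v, rfl, hv₁, hv₂, rfl⟩
    exact ⟨u, v ++ [s], by simp, by simp [hv₁, h₁.symm], by simp [hv₂, h₂.symm], rfl⟩

theorem openAt_snoc_opn {w : List (RefSym A X)} {x : X} (i : ℕ) :
    OpenAt (w ++ [Sum.inr (Bracket.opn x)]) x i ↔ i = (doc w).length + 1 := by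
  constructor
  · rintro ⟨u, v, h, hv₁, hv₂, rfl⟩
    rcases List.eq_nil_or_concat v with rfl | ⟨v, s', rfl⟩
    · rw [List.append_inj_left' h rfl]
    · rw [List.concat_eq_append] at h hv₁ hv₂
      rw [← List.cons_append, ← List.append_assoc] at h
      have := List.append_inj_right' h rfl
      simp only [List.cons.injEq, and_true] at this
      simp [← this] at hv₁
  · rintro rfl
    exact ⟨w, [], rfl, by simp, by simp, rfl⟩

theorem not_openAt_snoc_cls {w : List (RefSym A X)} {x : X} (i : ℕ) :
    ¬ OpenAt (w ++ [Sum.inr (Bracket.cls x)]) x i := by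
  rintro ⟨u, v, h, hv₁, hv₂, rfl⟩
  rcases List.eq_nil_or_concat v with rfl | ⟨v, s', rfl⟩
  · have := List.append_inj_right' h rfl
    simp at this
  · rw [List.concat_eq_append] at h hv₁ hv₂
    rw [← List.cons_append, ← List.append_assoc] at h
    have := List.append_inj_right' h rfl
    simp only [List.cons.injEq, and_true] at this
    simp [← this] at hv₂

theorem OpenAt.le {w : List (RefSym A X)} {x : X} {i : ℕ} (h : OpenAt w x i) :
    i ≤ (doc w).length + 1 := by
  obtain ⟨u, v, rfl, -, -, rfl⟩ := h
  simp [doc_append]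

theorem tupleOf_snoc_ne {w : List (RefSym A X)} {s : RefSym A X} {x : X}
    (h : s ≠ Sum.inr (Bracket.cls x)) : tupleOf (w ++ [s]) x = tupleOf w x := by
  ext p
  constructor
  · rintro ⟨u, v, z, hw, hv₁, hv₂, rfl⟩
    rcases List.eq_nil_or_concat z with rfl | ⟨z, s', rfl⟩
    · rw [← List.cons_append, ← List.append_assoc] at hw
      have := List.append_inj_right' hw rfl
      simp [h] at this
    · rw [List.concat_eq_append] at hw
      rw [← List.cons_append, ← List.append_assoc, ← List.cons_append, ← List.append_assoc] at hw
      obtain ⟨rfl, -⟩ := List.append_inj' hw rfl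
      exact ⟨u, v, z, by simp, hv₁, hv₂, rfl⟩
  · rintro ⟨u, v, z, rfl, hv₁, hv₂, rfl⟩
    exact ⟨u, v, z ++ [s], by simp, hv₁, hv₂, rfl⟩

theorem mem_tupleOf_snoc_cls {w : List (RefSym A X)} {x : X} {i j : ℕ} :
    (i, j) ∈ tupleOf (w ++ [Sum.inr (Bracket.cls x)]) x ↔
      (i, j) ∈ tupleOf w x ∨ OpenAt w x i ∧ j = (doc w).length + 1 := by
  constructor
  · rintro ⟨u, v, z, hw, hv₁, hv₂, he⟩
    rw [Prod.mk.injEq] at he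
    obtain ⟨rfl, rfl⟩ := he
    rcases List.eq_nil_or_concat z with rfl | ⟨z, s', rfl⟩
    · rw [← List.cons_append, ← List.append_assoc] at hw
      obtain ⟨rfl, -⟩ := List.append_inj' hw rfl
      refine Or.inr ⟨⟨u, v, rfl, hv₁, hv₂, rfl⟩, ?_⟩
      simp [doc_append, doc_cons_inr]
    · rw [List.concat_eq_append] at hw
      rw [← List.cons_append, ← List.append_assoc, ← List.cons_append, ← List.append_assoc] at hw
      obtain ⟨rfl, -⟩ := List.append_inj' hw rfl
      exact Or.inl ⟨u, v, z, by simp, hv₁, hv₂, rfl⟩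
  · rintro (⟨u, v, z, rfl, hv₁, hv₂, he⟩ | ⟨⟨u, v, rfl, hv₁, hv₂, rfl⟩, rfl⟩)
    · exact ⟨u, v, z ++ [Sum.inr (Bracket.cls x)], by simp, hv₁, hv₂, he⟩
    · refine ⟨u, v, [], by simp, hv₁, hv₂, ?_⟩
      simp [doc_append, doc_cons_inr]

/-- Links the state of the scan to an actual open bracket, so that alternation can be used in
statements about spans. -/
theorem track_iff_openAt (x : X) (w : List (RefSym A X)) :
    ∀ p, track x False w = some p → (p ↔ ∃ i, OpenAt w x i) := by
  induction w using List.reverseRecOn with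
  | nil =>
    intro p hp
    simp only [track, Option.some.injEq] at hp
    subst hp
    simp [OpenAt]
  | append_singleton w s ih =>
    intro p hp
    rw [track_append] at hp
    obtain ⟨q, hq, hp⟩ := Option.bind_eq_some_iff.1 hp
    have := ih q hq
    match s with
    | Sum.inl a =>
      simp only [track, Option.some.injEq] at hp
      simp [openAt_snoc_ne, ← this, hp]
    | Sum.inr (Bracket.opn y) =>
      by_cases h : y = x
      · subst h
        simp only [track, if_true] at hp
        split_ifs at hp
        simp only [Option.some.injEq] at hp
        simp [openAt_snoc_opn, ← hp]
      · simp only [track, if_neg h, Option.some.injEq] at hp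
        simp [openAt_snoc_ne (s := Sum.inr (Bracket.opn y)) (x := x) (by simpa using h) (by simp),
          ← this, hp]
    | Sum.inr (Bracket.cls y) =>
      by_cases h : y = x
      · subst h
        simp only [track, if_true] at hp
        split_ifs at hp
        simp only [Option.some.injEq] at hp
        simp [not_openAt_snoc_cls, ← hp]
      · simp only [track, if_neg h, Option.some.injEq] at hp
        simp [openAt_snoc_ne (s := Sum.inr (Bracket.cls y)) (x := x) (by simp) (by simpa using h),
          ← this, hp]

end Balance

/-! ### Multispan-tuples as sequences of flags -/

section Flags

open Classical

variable {A X : Type*}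

/-- For every variable: whether a nonempty span ends here, whether there is an empty span here,
and whether a nonempty span starts here. -/
abbrev Flags (X : Type*) := X → Prop × Prop × Prop

/-- The flags of the tuple `t` at position `i`. -/
def flagsAt (t : X → Set Span) (i : ℕ) : Flags X := fun x =>
  (∃ j, j ≠ i ∧ (j, i) ∈ t x, (i, i) ∈ t x, ∃ j, j ≠ i ∧ (i, j) ∈ t x)

/-- The flags at position `i` of the tuple described by a prefix of a word. -/
def prefixFlags (w : List (RefSym A X)) (i : ℕ) : Flags X := fun x =>
  (∃ j, j ≠ i ∧ (j, i) ∈ tupleOf w x, (i, i) ∈ tupleOf w x,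
    (∃ j, j ≠ i ∧ (i, j) ∈ tupleOf w x) ∨ OpenAt w x i)

/-- The flags of no bracket. -/
def noFlags : Flags X := fun _ => (False, False, False)

/-- The effect of a bracket on the flags of the current position. -/
noncomputable def Bracket.update (f : Flags X) : Bracket X → Flags X
  | .opn x => Function.update f x ((f x).1, (f x).2.1, True)
  | .cls x => Function.update f x ((f x).1 ∨ ¬ (f x).2.2, (f x).2.1 ∨ (f x).2.2, False)

/-- The flags of the positions of a word, when `f` are the flags of the brackets that have already
been read at the first position. -/
noncomputable def wordFlags : Flags X → List (RefSym A X) → List (Flags X)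
  | f, [] => [f]
  | f, Sum.inl _ :: w => f :: wordFlags noFlags w
  | f, Sum.inr b :: w => wordFlags (b.update f) w

/-- The brackets of every variable alternate. -/
def Balanced (w : List (RefSym A X)) : Prop := ∀ x, track x False w = some False

/-- A prefix of a balanced word. -/
def PrefixBalanced (w : List (RefSym A X)) : Prop := ∀ x, (track x False w).isSome

theorem PrefixBalanced.of_append {u v : List (RefSym A X)} (h : PrefixBalanced (u ++ v)) :
    PrefixBalanced u := by
  intro x
  have := h x
  rw [track_append] at this
  cases hu : track x False u <;> simp [hu] at this ⊢

theorem Balanced.prefixBalanced {w : List (RefSym A X)} (h : Balanced w) : PrefixBalanced w :=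
  fun x => by simp [h x]

theorem Balanced.not_openAt {w : List (RefSym A X)} (h : Balanced w) (x : X) (i : ℕ) :
    ¬ OpenAt w x i := by
  have := (track_iff_openAt x w False (h x)).2
  exact fun hi => this ⟨i, hi⟩

theorem prefixFlags_of_balanced {w : List (RefSym A X)} (h : Balanced w) (i : ℕ) :
    prefixFlags w i = flagsAt (tupleOf w) i := by
  funext x
  simp [prefixFlags, flagsAt, h.not_openAt]

theorem PrefixBalanced.not_openAt {w : List (RefSym A X)} {x : X}
    (h : PrefixBalanced (w ++ [Sum.inr (Bracket.opn x)])) (i : ℕ) : ¬ OpenAt w x i := by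
  obtain ⟨q, hq⟩ := Option.isSome_iff_exists.1 (h.of_append x)
  intro hi
  have hq' := (track_iff_openAt x w q hq).2 ⟨i, hi⟩
  have := h x
  simp [track_append, hq, track, hq'] at this

theorem PrefixBalanced.exists_openAt {w : List (RefSym A X)} {x : X}
    (h : PrefixBalanced (w ++ [Sum.inr (Bracket.cls x)])) : ∃ i, OpenAt w x i := by
  obtain ⟨q, hq⟩ := Option.isSome_iff_exists.1 (h.of_append x)
  rw [← track_iff_openAt x w q hq]
  by_contra hq'
  have := h x
  simp [track_append, hq, track, hq'] at this

theorem OpenAt.unique {w : List (RefSym A X)} {x : X} {i j : ℕ} (hi : OpenAt w x i)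
    (hj : OpenAt w x j) : i = j := by
  induction w using List.reverseRecOn generalizing i j with
  | nil =>
    obtain ⟨u, v, h, -⟩ := hi
    simp at h
  | append_singleton w s ih =>
    by_cases h₁ : s = Sum.inr (Bracket.opn x)
    · subst h₁
      rw [openAt_snoc_opn] at hi hj
      rw [hi, hj]
    · by_cases h₂ : s = Sum.inr (Bracket.cls x)
      · subst h₂
        exact absurd hi (not_openAt_snoc_cls i)
      · rw [openAt_snoc_ne h₁ h₂] at hi hj
        exact ih hi hj

theorem prefixFlags_snoc_of_ne {w : List (RefSym A X)} {s : RefSym A X} {x : X}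
    (h₁ : s ≠ Sum.inr (Bracket.opn x)) (h₂ : s ≠ Sum.inr (Bracket.cls x)) (i : ℕ) :
    prefixFlags (w ++ [s]) i x = prefixFlags w i x := by
  simp [prefixFlags, tupleOf_snoc_ne h₂, openAt_snoc_ne h₁ h₂]

theorem le_of_mem_tupleOf {w : List (RefSym A X)} {x : X} {i j : ℕ} (h : (i, j) ∈ tupleOf w x) :
    1 ≤ i ∧ i ≤ j ∧ j ≤ (doc w).length + 1 := (isMultispanTuple_tupleOf w x).1 _ h

/-- Flags of past positions are final. A closing bracket turns an open bracket at `i` into a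
nonempty span that starts at `i`, and the third component of `prefixFlags` counts both alike. -/
theorem prefixFlags_snoc_lt {w : List (RefSym A X)} {s : RefSym A X}
    (h : PrefixBalanced (w ++ [s])) {i : ℕ} (hi : i < (doc w).length + 1) :
    prefixFlags (w ++ [s]) i = prefixFlags w i := by
  funext x
  by_cases h₁ : s = Sum.inr (Bracket.opn x)
  · subst h₁
    simp [prefixFlags, tupleOf_snoc_ne (s := Sum.inr (Bracket.opn x)) (x := x) (w := w) (by simp),
      openAt_snoc_opn, h.not_openAt, hi.ne]
  by_cases h₂ : s = Sum.inr (Bracket.cls x)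
  · subst h₂
    simp only [prefixFlags, mem_tupleOf_snoc_cls, hi.ne, not_openAt_snoc_cls, and_false, or_false,
      Prod.mk.injEq, true_and, eq_iff_iff]
    constructor
    · rintro ⟨j, hj, hj' | hj'⟩
      · exact Or.inl ⟨j, hj, hj'⟩
      · exact Or.inr hj'.1
    · rintro (⟨j, hj, hj'⟩ | h)
      · exact ⟨j, hj, Or.inl hj'⟩
      · exact ⟨_, hi.ne', Or.inr ⟨h, rfl⟩⟩
  · exact prefixFlags_snoc_of_ne h₁ h₂ i

theorem prefixFlags_append_lt {w v : List (RefSym A X)} (h : PrefixBalanced (w ++ v)) {i : ℕ}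
    (hi : i < (doc w).length + 1) : prefixFlags (w ++ v) i = prefixFlags w i := by
  induction v using List.reverseRecOn with
  | nil => simp
  | append_singleton v s ih =>
    rw [← List.append_assoc] at h ⊢
    rw [prefixFlags_snoc_lt h (by rw [doc_append, List.length_append]; omega), ih h.of_append]

theorem prefixFlags_of_lt {w : List (RefSym A X)} {i : ℕ} (hi : (doc w).length + 1 < i) :
    prefixFlags w i = noFlags := by
  funext x
  simp only [prefixFlags, noFlags, Prod.mk.injEq, eq_iff_iff, iff_false]
  refine ⟨?_, ?_, ?_⟩
  · rintro ⟨j, -, h⟩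
    have := le_of_mem_tupleOf h
    omega
  · intro h
    have := le_of_mem_tupleOf h
    omega
  · rintro (⟨j, -, h⟩ | h)
    · have := le_of_mem_tupleOf h
      omega
    · have := h.le
      omega

/-- At the current position the third flag can only mean that `x` was opened right here, since no
completed nonempty span starts here yet. So a closing bracket completes an empty span if this flag
is set, and otherwise a nonempty span from an earlier position. -/
theorem prefixFlags_snoc_bracket {w : List (RefSym A X)} {b : Bracket X}
    (h : PrefixBalanced (w ++ [Sum.inr b])) :
    prefixFlags (w ++ [Sum.inr b]) ((doc w).length + 1) =
      b.update (prefixFlags w ((doc w).length + 1)) := by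
  have no_start : ∀ (x : X) (j : ℕ), j ≠ (doc w).length + 1 →
      ¬ ((doc w).length + 1, j) ∈ tupleOf w x := by
    intro x j hj hm
    have := le_of_mem_tupleOf hm
    omega
  funext x
  cases b with
  | opn y =>
    by_cases hxy : x = y
    · subst hxy
      simp [Bracket.update, prefixFlags, openAt_snoc_opn,
        tupleOf_snoc_ne (s := Sum.inr (Bracket.opn x)) (x := x) (w := w) (by simp)]
    · rw [Bracket.update, Function.update_of_ne hxy]
      exact prefixFlags_snoc_of_ne (by simpa using Ne.symm hxy) (by simp) _
  | cls y =>
    by_cases hxy : x = y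
    · subst hxy
      obtain ⟨i, hi⟩ := h.exists_openAt
      have hio : ∀ j, OpenAt w x j ↔ j = i := fun j => ⟨fun hj => hj.unique hi, fun e => e ▸ hi⟩
      simp only [Bracket.update, prefixFlags, Function.update_self, mem_tupleOf_snoc_cls,
        not_openAt_snoc_cls, or_false, hio, and_true, Prod.mk.injEq, eq_iff_iff, iff_false]
      have hno : ¬ ∃ j, j ≠ (doc w).length + 1 ∧ ((doc w).length + 1, j) ∈ tupleOf w x :=
        fun ⟨j, hj, hm⟩ => no_start x j hj hm
      simp only [hno, false_or]
      refine ⟨?_, trivial, ?_⟩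
      · constructor
        · rintro ⟨j, hj, hj' | rfl⟩
          · exact Or.inl ⟨j, hj, hj'⟩
          · exact Or.inr fun e => hj e.symm
        · rintro (⟨j, hj, hj'⟩ | hne)
          · exact ⟨j, hj, Or.inl hj'⟩
          · exact ⟨i, fun e => hne e.symm, Or.inr rfl⟩
      · rintro ⟨j, hj, hj' | ⟨-, rfl⟩⟩
        · exact no_start x j hj hj'
        · exact hj rfl
    · rw [Bracket.update, Function.update_of_ne hxy]
      exact prefixFlags_snoc_of_ne (by simp) (by simpa using Ne.symm hxy) _

/-- The flags of the positions `i, …, i + n`. -/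
def flagList (F : ℕ → Flags X) (i n : ℕ) : List (Flags X) := (List.range' i (n + 1)).map F

/-- Induction on the unread part, with the part already read as accumulator. A letter finalizes the
flags of its position, and the next position starts without brackets. -/
theorem wordFlags_prefixFlags (v : List (RefSym A X)) : ∀ w : List (RefSym A X),
    PrefixBalanced (w ++ v) → wordFlags (prefixFlags w ((doc w).length + 1)) v =
      flagList (prefixFlags (w ++ v)) ((doc w).length + 1) (doc v).length := by
  induction v with
  | nil => intro w _; simp [wordFlags, flagList, doc]
  | cons s v ih =>
    intro w h
    have e : w ++ s :: v = (w ++ [s]) ++ v := by simp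
    have hs : PrefixBalanced (w ++ [s]) := (e ▸ h).of_append
    have key := ih (w ++ [s]) (e ▸ h)
    rw [e]
    cases s with
    | inl a =>
      have hd : (doc (w ++ [Sum.inl a])).length = (doc w).length + 1 := by
        rw [doc_append, List.length_append]
        rfl
      have hn : prefixFlags (w ++ [Sum.inl a]) ((doc w).length + 1 + 1) = noFlags := by
        funext x
        rw [prefixFlags_snoc_of_ne (by simp) (by simp), prefixFlags_of_lt (by omega)]
      rw [hd, hn] at key
      have hw : prefixFlags (w ++ [Sum.inl a] ++ v) ((doc w).length + 1) =
          prefixFlags w ((doc w).length + 1) := by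
        rw [prefixFlags_append_lt (e ▸ h) (by omega)]
        funext x
        exact prefixFlags_snoc_of_ne (by simp) (by simp) _
      rw [wordFlags, key, ← hw]
      rfl
    | inr b =>
      have hd : doc (w ++ [Sum.inr b]) = doc w := by
        rw [doc_append, doc_cons_inr]
        simp [doc]
      rw [hd, prefixFlags_snoc_bracket hs] at key
      rw [wordFlags, key, doc_cons_inr]

theorem Balanced.wordFlags_eq {w : List (RefSym A X)} (h : Balanced w) :
    wordFlags noFlags w = flagList (flagsAt (tupleOf w)) 1 (doc w).length := by
  have h₀ : prefixFlags ([] : List (RefSym A X)) 1 = noFlags := by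
    funext x
    simp [prefixFlags, noFlags, tupleOf, OpenAt]
  have := wordFlags_prefixFlags w [] h.prefixBalanced
  rw [List.nil_append, funext (prefixFlags_of_balanced h)] at this
  rw [← h₀]
  exact this

theorem flagList_succ (F : ℕ → Flags X) (i n : ℕ) :
    flagList F i (n + 1) = F i :: flagList F (i + 1) n := rfl

theorem length_flagList (F : ℕ → Flags X) (i n : ℕ) : (flagList F i n).length = n + 1 := by
  simp [flagList]

/-- A multispan-tuple over a document is determined by its flags. -/
theorem subset_of_flagsAt {D : List A} {t t' : X → Set Span} (ht : IsMultispanTuple D t)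
    (ht' : IsMultispanTuple D t')
    (h : ∀ i, 1 ≤ i → i ≤ D.length + 1 → flagsAt t i = flagsAt t' i) (x : X) : t x ⊆ t' x := by
  have h' : ∀ i, 1 ≤ i → i ≤ D.length + 1 → _ := fun i h₁ h₂ => congrFun (h i h₁ h₂) x
  simp only [flagsAt, Prod.mk.injEq, eq_iff_iff] at h'
  have disj : ∀ {t : X → Set Span}, IsMultispanTuple D t → ∀ {i j i' j' : ℕ},
      (i, j) ∈ t x → (i', j') ∈ t x → (i, j) ≠ (i', j') → j ≤ i' ∨ j' ≤ i :=
    fun ht _ _ _ _ hs hs' hne => (ht x).2 hs hs' hne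
  rintro ⟨i, j⟩ hij
  obtain ⟨hi, hle, hj⟩ := (ht x).1 _ hij
  simp only at hi hle hj
  by_cases hne : i = j
  · subst hne
    exact (h' i hi hj).2.1.1 hij
  obtain ⟨j', hj'i, hij'⟩ := (h' i hi (by omega)).2.2.1 ⟨j, Ne.symm hne, hij⟩
  obtain ⟨-, hle', hj'⟩ := (ht' x).1 _ hij'
  simp only at hle' hj'
  obtain ⟨k, hkj, hk⟩ := (h' j (by omega) hj).1.1 ⟨i, hne, hij⟩
  obtain ⟨l, hlj, hl⟩ := (h' j' (by omega) hj').1.2 ⟨i, hj'i.symm, hij'⟩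
  have hk' := ((ht' x).1 _ hk).2.1
  have hl' := ((ht x).1 _ hl).2.1
  simp only at hk' hl'
  by_cases e : j = j'
  · rwa [e]
  -- Suppose the spans starting at `i` end at different positions `j` and `j'`. The span of `t'`
  -- that ends at `j` must avoid `(i, j')`, which forces `j' < j`; the span of `t` that ends at `j'`
  -- must avoid `(i, j)`, which forces `j < j'`.
  have h₁ := disj ht' hij' hk (by simp [Ne.symm e])
  have h₂ := disj ht hij hl (by simp [e])
  omega

theorem eq_of_flagList_eq {D : List A} {t t' : X → Set Span} (ht : IsMultispanTuple D t)
    (ht' : IsMultispanTuple D t')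
    (h : flagList (flagsAt t) 1 D.length = flagList (flagsAt t') 1 D.length) : t = t' := by
  have h' : ∀ i, 1 ≤ i → i ≤ D.length + 1 → flagsAt t i = flagsAt t' i := by
    intro i h₁ h₂
    rw [flagList, flagList, List.map_inj_left] at h
    exact h i (by rw [List.mem_range'_1]; omega)
  funext x
  exact (subset_of_flagsAt ht ht' h' x).antisymm
    (subset_of_flagsAt ht' ht (fun i h₁ h₂ => (h' i h₁ h₂).symm) x)

/-! ### The words that encode sequences of flags -/

variable [Fintype X] [LinearOrder X]

/-- The brackets that are described by the flags of one position. -/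
noncomputable def flagWord (f : Flags X) : List (RefSym A X) :=
  ((Finset.univ : Finset X).sort (· ≤ ·)).flatMap fun x =>
    (if (f x).1 then [Sum.inr (Bracket.cls x)] else []) ++
    (if (f x).2.1 then [Sum.inr (Bracket.opn x), Sum.inr (Bracket.cls x)] else []) ++
    (if (f x).2.2 then [Sum.inr (Bracket.opn x)] else [])

/-- The word that encodes a document together with a sequence of flags. -/
noncomputable def encodeFlags : List (Flags X) → List A → List (RefSym A X)
  | [], _ => []
  | f :: _, [] => flagWord f
  | f :: fs, a :: D => flagWord f ++ Sum.inl a :: encodeFlags fs D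

theorem block_eq (t : X → Set Span) (i : ℕ) :
    (block t i : List (RefSym A X)) = flagWord (flagsAt t i) := rfl

theorem nref_eq (t : X → Set Span) (D : List A) :
    nref t D = encodeFlags (flagList (flagsAt t) 1 D.length) D := by
  have : ∀ i, nrefFrom t i D = encodeFlags (flagList (flagsAt t) i D.length) D := by
    induction D with
    | nil => exact fun i => block_eq t i
    | cons a D ih =>
      intro i
      rw [nrefFrom, List.length_cons, flagList_succ, encodeFlags, ih, block_eq]
  exact this 1

end Flags

/-! ### The sequences of flags that belong to a regular language -/

section SubsetAutomaton

variable {A X Q : Type*} (M : DFA (RefSym A X) Q)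

/-- The states that can be reached by brackets with the given flags. -/
def readFlags (S : Set Q) (f : Flags X) : Set Q :=
  {q' | ∃ q ∈ S, ∃ u : List (Bracket X),
    q' = M.evalFrom q (u.map Sum.inr) ∧ u.foldl (fun f b => b.update f) noFlags = f}

/-- Some word with the given document and the given flags is accepted from a state in `S`. -/
def AcceptsFlags (S : Set Q) (D : List A) (fs : List (Flags X)) : Prop :=
  ∃ q ∈ S, ∃ w, wordFlags noFlags w = fs ∧ doc w = D ∧ M.evalFrom q w ∈ M.accept

theorem wordFlags_append (u : List (Bracket X)) (w : List (RefSym A X)) (f : Flags X) :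
    wordFlags f (u.map Sum.inr ++ w) = wordFlags (u.foldl (fun f b => b.update f) f) w := by
  induction u generalizing f with
  | nil => rfl
  | cons b u ih => exact ih _

theorem doc_map_inr_append (u : List (Bracket X)) (w : List (RefSym A X)) :
    doc (u.map Sum.inr ++ w) = doc w := by
  induction u with
  | nil => rfl
  | cons b u ih => exact ih

theorem exists_brackets (w : List (RefSym A X)) :
    ∃ (u : List (Bracket X)) (v : List (RefSym A X)), w = u.map Sum.inr ++ v ∧
      (v = [] ∨ ∃ a v', v = Sum.inl a :: v') := by
  induction w with
  | nil => exact ⟨[], [], rfl, Or.inl rfl⟩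
  | cons s w ih =>
    cases s with
    | inl a => exact ⟨[], _, rfl, Or.inr ⟨a, w, rfl⟩⟩
    | inr b =>
      obtain ⟨u, v, rfl, hv⟩ := ih
      exact ⟨b :: u, v, rfl, hv⟩

theorem acceptsFlags_nil (S : Set Q) (f : Flags X) :
    AcceptsFlags M S [] [f] ↔ ∃ q ∈ readFlags M S f, q ∈ M.accept := by
  constructor
  · rintro ⟨q, hq, w, hf, hd, ha⟩
    obtain ⟨u, v, rfl, rfl | ⟨a, v', rfl⟩⟩ := exists_brackets w
    · rw [wordFlags_append, wordFlags, List.cons.injEq] at hf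
      rw [List.append_nil] at ha
      exact ⟨_, ⟨q, hq, u, rfl, hf.1⟩, ha⟩
    · rw [doc_map_inr_append] at hd
      cases hd
  · rintro ⟨_, ⟨q, hq, u, rfl, rfl⟩, ha⟩
    refine ⟨q, hq, u.map Sum.inr ++ [], ?_, ?_, ?_⟩
    · rw [wordFlags_append, wordFlags]
    · rw [doc_map_inr_append]
      rfl
    · rwa [List.append_nil]

/-- A letter resets the flags, so the set of reachable states is all that must be remembered between
positions. Brackets with the same flags may come in many orders; taking sets of states identifies
them. -/
theorem acceptsFlags_cons (S : Set Q) (a : A) (D : List A) (f : Flags X) (fs : List (Flags X)) :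
    AcceptsFlags M S (a :: D) (f :: fs) ↔
      AcceptsFlags M ((fun q => M.step q (Sum.inl a)) '' readFlags M S f) D fs := by
  constructor
  · rintro ⟨q, hq, w, hf, hd, ha⟩
    obtain ⟨u, v, rfl, rfl | ⟨a', v', rfl⟩⟩ := exists_brackets w
    · rw [doc_map_inr_append] at hd
      cases hd
    · rw [wordFlags_append, wordFlags, List.cons.injEq] at hf
      rw [doc_map_inr_append, show doc (Sum.inl a' :: v' : List (RefSym A X)) = a' :: doc v' from rfl,
        List.cons.injEq] at hd
      obtain ⟨rfl, hd⟩ := hd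
      rw [DFA.evalFrom_of_append] at ha
      exact ⟨_, ⟨_, ⟨q, hq, u, rfl, hf.1⟩, rfl⟩, v', hf.2, hd, ha⟩
  · rintro ⟨_, ⟨_, ⟨q, hq, u, rfl, rfl⟩, rfl⟩, w, rfl, rfl, ha⟩
    refine ⟨q, hq, u.map Sum.inr ++ Sum.inl a :: w, ?_, ?_, ?_⟩
    · rw [wordFlags_append, wordFlags]
    · rw [doc_map_inr_append]
      rfl
    · rw [DFA.evalFrom_of_append]
      exact ha

/-- Several words of the language may describe the same tuple. They share their sequence of flags,
and acceptance asks only for the existence of a word, so duplicates disappear here. -/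
theorem acceptsFlags_iff {R : MExpr A X} (hR : R.WellFormed) (hM : M.accepts = R.lang)
    (D : List A) (fs : List (Flags X)) :
    AcceptsFlags M {M.start} D fs ↔
      ∃ t ∈ (Multispanner.ofLanguage R.lang).rel D, flagList (flagsAt t) 1 D.length = fs := by
  constructor
  · rintro ⟨_, rfl, w, rfl, rfl, hw⟩
    have hw : w ∈ R.lang := hM ▸ hw
    exact ⟨_, ⟨w, hw, rfl, rfl⟩,
      (Balanced.wordFlags_eq fun x => R.track_of_wellFormed hR x w hw).symm⟩
  · rintro ⟨_, ⟨w, hw, rfl, rfl⟩, rfl⟩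
    refine ⟨_, rfl, w, Balanced.wordFlags_eq fun x => R.track_of_wellFormed hR x w hw, rfl, ?_⟩
    rw [← hM] at hw
    exact hw

end SubsetAutomaton

/-! ### Totalization of streaming string transducers -/

section Totalization

open Classical

variable {B R O : Type*}

/-- The restriction of a total valuation. -/
noncomputable def mask (U : Set R) (ν : R → List O) : Valuation R O :=
  fun r => if r ∈ U then some (ν r) else none

theorem mask_eval (U : Set R) (ν : R → List O) (s : List (R ⊕ O)) :
    (mask U ν).eval s = if ∀ r ∈ regs s, r ∈ U then some (applyVal ν s) else none := by
  induction s with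
  | nil => simp [Valuation.eval]
  | cons y s ih =>
    cases y with
    | inl r =>
      rw [Valuation.eval, ih, mask]
      by_cases hr : r ∈ U
      · by_cases hs : ∀ r ∈ regs s, r ∈ U
        · simp [hr, if_pos hs]
        · simp [hr, if_neg hs]
      · simp [hr]
    | inr o =>
      rw [Valuation.eval, ih]
      by_cases hs : ∀ r ∈ regs s, r ∈ U
      · rw [if_pos hs, if_pos (by simpa using hs)]
        simp
      · rw [if_neg hs, if_neg (by simpa using hs)]
        rfl

/-- The registers that are defined after an assignment if those in `U` are defined before. -/
def definedRegs (σ : Assignment R O) (U : Set R) : Set R :=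
  {r | ∃ s, σ r = some s ∧ ∀ r' ∈ regs s, r' ∈ U}

theorem mask_comp (σ : Assignment R O) (U : Set R) (ν : R → List O) :
    (mask U ν).comp σ = mask (definedRegs σ U) fun r => applyVal ν ((σ r).getD []) := by
  funext r
  cases h : σ r with
  | none => simp [Valuation.comp, mask, definedRegs, h]
  | some s =>
    rw [Valuation.comp, h, Option.bind_some, mask_eval, mask]
    simp [definedRegs, h]

theorem count_inl_eq (s : List (R ⊕ O)) (r : R) : s.count (Sum.inl r) = (regs s).count r := by
  induction s with
  | nil => rfl
  | cons y s ih =>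
    cases y with
    | inl r' =>
      rw [regs_cons_inl, List.count_cons, List.count_cons, ih]
      rfl
    | inr o =>
      rw [regs_cons_inr, List.count_cons, ih]
      rfl

attribute [local instance] DSST.finQ DSST.finR

variable (M : DSST B O)

/-- A transition of a transducer with total assignments that records which registers are
defined. -/
def DSST.totalStep (p : M.Q × Set M.R) (b : B) :
    Option ((M.R → List (M.R ⊕ O)) × (M.Q × Set M.R)) :=
  (M.δ p.1 b).map fun t => (fun r => (t.1 r).getD [], t.2, definedRegs t.1 p.2)

/-- The effect of the run over a word. -/
def DSST.totalRun : M.Q × Set M.R → List B → Option ((M.R → List (M.R ⊕ O)) × (M.Q × Set M.R))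
  | p, [] => some (fun r => [Sum.inl r], p)
  | p, b :: w => (M.totalStep p b).bind fun t =>
      (DSST.totalRun t.2 w).map fun t' => (fun r => substAll t.1 (t'.1 r), t'.2)

theorem DSST.copylessTotal_totalStep {p : M.Q × Set M.R} {b : B} {t}
    (h : M.totalStep p b = some t) : CopylessTotal t.1 := by
  obtain ⟨⟨σ, q⟩, hδ, rfl⟩ := Option.map_eq_some_iff.1 h
  intro r
  have := M.copyless _ _ _ _ hδ r
  simp only [count_inl_eq] at this
  exact this

theorem DSST.copylessTotal_totalRun (w : List B) : ∀ {p : M.Q × Set M.R} {t},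
    M.totalRun p w = some t → CopylessTotal t.1 := by
  induction w with
  | nil =>
    intro p t h
    cases h
    exact CopylessTotal.id
  | cons b w ih =>
    intro p t h
    obtain ⟨t₁, h₁, h⟩ := Option.bind_eq_some_iff.1 h
    obtain ⟨t₂, h₂, rfl⟩ := Option.map_eq_some_iff.1 h
    exact (M.copylessTotal_totalStep h₁).comp (ih h₂)

/-- Which registers are defined is finite information and can be kept in the state. A partial
valuation is then a total one masked by this set, and the strings for undefined registers are
irrelevant. -/
theorem DSST.run_eq_totalRun (w : List B) : ∀ (p : M.Q × Set M.R) (ν : M.R → List O),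
    M.run p.1 (mask p.2 ν) w =
      (M.totalRun p w).map fun t => (t.2.1, mask t.2.2 fun r => applyVal ν (t.1 r)) := by
  induction w with
  | nil => simp [DSST.run, DSST.totalRun]
  | cons b w ih =>
    intro p ν
    rw [DSST.run, DSST.totalRun, DSST.totalStep]
    cases M.δ p.1 b with
    | none => rfl
    | some t =>
      rw [Option.bind_some, Option.map_some, Option.bind_some, mask_comp,
        ih (t.2, definedRegs t.1 p.2), Option.map_map]
      simp only [Function.comp_def, applyVal_substAll]

theorem DSST.run_append (u v : List B) (q : M.Q) (ν : Valuation M.R O) :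
    M.run q ν (u ++ v) = (M.run q ν u).bind fun p => M.run p.1 p.2 v := by
  induction u generalizing q ν with
  | nil => rfl
  | cons b u ih =>
    simp only [List.cons_append, DSST.run]
    cases M.δ q b with
    | none => rfl
    | some t => exact ih _ _

end Totalization

/-! ### Linear extract-transform programs as transducers with choices -/

section Programs

open Classical

attribute [local instance] DSST.finQ DSST.finR

/-- All sequences of `n + 1` choices. -/
noncomputable def choiceSeqs (B : Type*) [Fintype B] : ℕ → Multiset (List B)
  | 0 => (Finset.univ : Finset B).val.map fun b => [b]
  | n + 1 => (Finset.univ : Finset B).val.bind fun b => (choiceSeqs B n).map (List.cons b)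

theorem mem_choiceSeqs {B : Type*} [Fintype B] {n : ℕ} {l : List B} :
    l ∈ choiceSeqs B n ↔ l.length = n + 1 := by
  induction n generalizing l with
  | zero => simp [choiceSeqs, List.length_eq_one_iff, eq_comm]
  | succ n ih =>
    cases l with
    | nil => simp [choiceSeqs]
    | cons b l => simp [choiceSeqs, ih]

theorem nodup_choiceSeqs (B : Type*) [Fintype B] (n : ℕ) : (choiceSeqs B n).Nodup := by
  induction n with
  | zero => exact Finset.univ.nodup.map fun b b' h => by simpa using h
  | succ n ih =>
    rw [choiceSeqs, Multiset.nodup_bind]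
    refine ⟨fun b _ => ih.map (List.cons_injective), ?_⟩
    refine Finset.univ.nodup.pairwise fun b _ b' _ hne => ?_
    rw [Function.onFun, Multiset.disjoint_left]
    intro l hl hl'
    obtain ⟨u, -, rfl⟩ := Multiset.mem_map.1 hl
    obtain ⟨u', -, h⟩ := Multiset.mem_map.1 hl'
    exact hne (List.cons.inj h).1.symm

variable {A X O Q : Type*} [Fintype X] [LinearOrder X]
  (N : DFA (RefSym A X) Q) (M : DSST (RefSym A X) O)

/-- Process the flags of a position and the letter at that position. -/
noncomputable def etStep (p : Set Q × M.Q × Set M.R) (f : Flags X) (a : A) :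
    Option ((M.R → List (M.R ⊕ O)) × (Set Q × M.Q × Set M.R)) :=
  (M.totalRun p.2 (flagWord f ++ [Sum.inl a])).map fun t =>
    (t.1, (fun q => N.step q (Sum.inl a)) '' readFlags N p.1 f, t.2)

/-- Process the flags of the last position. -/
noncomputable def etFinal (p : Set Q × M.Q × Set M.R) (f : Flags X) : Option (List (M.R ⊕ O)) :=
  if ∃ q ∈ readFlags N p.1 f, q ∈ N.accept then
    (M.totalRun p.2 (flagWord f)).bind fun t => (M.F t.2.1).bind fun s =>
      if ∀ r ∈ regs s, r ∈ t.2.2 then some (substAll t.1 s) else none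
  else none

/-- The subset automaton and the transducer run side by side. Acceptance is tested at the last
position only, where sequences of choices that are not accepted drop out without output. -/
theorem choiceOutputs_et (D : List A) : ∀ (p : Set Q × M.Q × Set M.R) (ν : M.R → List O),
    choiceOutputs (etStep N M) (etFinal N M) p ν D =
      (choiceSeqs (Flags X) D.length).filterMap fun fs =>
        if AcceptsFlags N p.1 D fs then
          (M.run p.2.1 (mask p.2.2 ν) (encodeFlags fs D)).bind fun c => (M.F c.1).bind c.2.eval
        else none := by
  induction D with
  | nil =>
    intro p ν
    rw [choiceOutputs, List.length_nil, choiceSeqs, Multiset.filterMap_map,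
      Multiset.filterMap_eq_bind]
    refine congrArg Multiset.sum (Multiset.map_congr rfl fun f _ => ?_)
    simp only [Function.comp_apply, acceptsFlags_nil, encodeFlags, etFinal, M.run_eq_totalRun]
    split_ifs
    · cases M.totalRun p.2 (flagWord f) with
      | none => rfl
      | some t =>
        simp only [Option.map_some, Option.bind_some]
        cases M.F t.2.1 with
        | none => rfl
        | some s =>
          simp only [Option.bind_some, mask_eval]
          split_ifs <;> simp [applyVal_substAll]
    · rfl
  | cons a D ih =>
    intro p ν
    rw [choiceOutputs, List.length_cons, choiceSeqs, Multiset.filterMap_bind]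
    refine congrArg Multiset.sum (Multiset.map_congr rfl fun f _ => ?_)
    rw [Multiset.filterMap_map]
    simp only [Function.comp_def, acceptsFlags_cons, encodeFlags, etStep]
    have e : ∀ w : List (RefSym A X),
        M.run p.2.1 (mask p.2.2 ν) (flagWord f ++ Sum.inl a :: w) =
          ((M.totalRun p.2 (flagWord f ++ [Sum.inl a])).map fun t =>
            (t.2.1, mask t.2.2 fun r => applyVal ν (t.1 r))).bind fun c => M.run c.1 c.2 w := by
      intro w
      rw [← M.run_eq_totalRun, ← M.run_append, List.append_assoc, List.singleton_append]
    simp only [e]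
    cases M.totalRun p.2 (flagWord f ++ [Sum.inl a]) with
    | none =>
      symm
      simp only [Option.map_none, Option.bind_none, ite_self, Option.elim_none]
      exact Multiset.eq_zero_of_forall_notMem fun l hl => by
        simp [Multiset.mem_filterMap] at hl
    | some t =>
      simp only [Option.map_some, Option.bind_some, Option.elim_some, ih]

/-- The outputs of a linear extract-transform program are the ones of a transducer that chooses
the flags of all positions. -/
theorem outputBag_eq {R : MExpr A X} (hR : R.WellFormed) (hN : N.accepts = R.lang) (D : List A) :
    outputBag (Multispanner.ofLanguage R.lang) M.fn D =
      choiceOutputs (etStep N M) (etFinal N M) ({N.start}, M.q₀, Set.univ) (fun _ => []) D := by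
  -- Both sides are free of duplicates, the right one because tuples are determined by their flags,
  -- so comparing elements is enough.
  have hfilter : (choiceSeqs (Flags X) D.length).filter (AcceptsFlags N {N.start} D) =
      ((Multispanner.ofLanguage R.lang).finite D).toFinset.val.map
        fun t => flagList (flagsAt t) 1 D.length := by
    refine (Multiset.Nodup.ext ((nodup_choiceSeqs _ _).filter _) ?_).2 fun fs => ?_
    · refine Multiset.Nodup.map_on (fun t ht t' ht' h => ?_) (Finset.nodup _)
      rw [Finset.mem_val, Set.Finite.mem_toFinset] at ht ht'
      exact eq_of_flagList_eq (Multispanner.valid _ D t ht) (Multispanner.valid _ D t' ht') h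
    · rw [Multiset.mem_filter, mem_choiceSeqs, acceptsFlags_iff N hR hN, Multiset.mem_map]
      simp only [Finset.mem_val, Set.Finite.mem_toFinset, and_iff_right_iff_imp]
      rintro ⟨t, -, rfl⟩
      exact length_flagList _ _ _
  have hmask : (mask Set.univ fun _ => [] : Valuation M.R O) = fun _ => some [] := by
    funext r
    simp [mask]
  rw [choiceOutputs_et, outputBag]
  simp only [hmask, nref_eq]
  have := congrArg (Multiset.filterMap fun fs => M.fn (encodeFlags fs D)) hfilter
  rw [Multiset.filterMap_map] at this
  refine Eq.trans this.symm ?_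
  rw [← Multiset.filterMap_eq_filter, Multiset.filterMap_filterMap]
  refine congrArg (fun g => Multiset.filterMap g _) (funext fun fs => ?_)
  by_cases h : AcceptsFlags N {N.start} D fs
  · simp [Option.guard, h, DSST.fn]
  · simp [Option.guard, h]

theorem admitsLinearEnumeration_et [Fintype A] [Finite Q] {R : MExpr A X} (hR : R.WellFormed)
    (hN : N.accepts = R.lang) :
    AdmitsLinearEnumeration (outputBag (Multispanner.ofLanguage R.lang) M.fn) := by
  have : Fintype (Set Q × M.Q × Set M.R) := Fintype.ofFinite _
  have key := admitsLinearEnumeration_choice (step := etStep N M) (fin := etFinal N M)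
    (fun p f a q hq => by
      obtain ⟨t, ht, rfl⟩ := Option.map_eq_some_iff.1 hq
      exact M.copylessTotal_totalRun _ ht) ({N.start}, M.q₀, Set.univ)
  convert key using 1
  exact funext fun D => outputBag_eq N M hR hN D

end Programs

end ET

theorem theorem3 {A X O : Type*} [Fintype A] [Fintype X] [LinearOrder X] [Fintype O]
    (E : ET.Multispanner A X) (T : List (ET.RefSym A X) → Option (List O))
    (hET : ET.IsLinearET E T) :
    ET.AdmitsLinearEnumeration (ET.outputBag E T) := by
  obtain ⟨⟨R, hR, rfl⟩, M, hM⟩ := hET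
  obtain ⟨Q, _, N, hN⟩ := R.isRegular_lang
  obtain rfl : T = M.fn := funext hM
  exact ET.admitsLinearEnumeration_et N M hR hN
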